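/- **Setting.** Let $N\ge 1$, let $e_1,\dots,e_N\in\mathbb R^2$ be pairwise different unit vectors, $J_i=[0,\infty)e_i$, $J_i^*=J_i\setminus\{0\}$ and $J=\bigcup_{i=1}^N J_i$ (the junction). Let $T>0$ and $J_T=(0,T)\times J$. Let $L_1,\dots,L_N\in C^2(\mathbb R)$ satisfy $L_i''\ge\gamma$ for some constant $\gamma>0$ (A1), and let $u_0:J\to\mathbb R$ be Lipschitz continuous (A0). Put $$H_i(p)=\sup_{q\in\mathbb R}(pq-L_i(q)),\qquad H_i^-(p)=\sup_{q\le 0}(pq-L_i(q)).$$ **Equation.** Consider $$u_t+H_i(u_x)=0\ \text{ on }(0,T)\times J_i^*\ (1\le i\le N),\qquad u_t+\max_{1\le i\le N}H_i^-(u_x^i)=0\ \text{ on }(0,T)\times\{0\},\qquad u(0,\cdot)=u_0. \tag{HJ}$$ Here $u^i_x$ is the derivative along $e_i$ (one-sided at $0$). The test functions are the continuous $\phi:J_T\to\mathbb R$ whose restriction to each $(0,T)\times J_i$ is $C^1$ (up to the junction point). An upper (lower) semicontinuous $v:[0,T)\times J\to\mathbb R$ is a sub-solution (super-solution) of (HJ)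 if $v(0,\cdot)\le u_0$ ($\ge u_0$) and, whenever a test function $\phi$ satisfies $v\le\phi$ ($v\ge\phi$) on a neighbourhood in $J_T$ of a point $(t,x)\in J_T$ with equality at $(t,x)$, then $\phi_t(t,x)+H_i(\phi_x(t,x))\le 0$ ($\ge0$) if $x\in J_i^*$, and $\phi_t(t,0)+\max_iH_i^-(\phi^i_x(t,0))\le0$ ($\ge 0$) if $x=0$. A function $u:[0,T)\times J\to\mathbb R$ is a viscosity solution of (HJ) if its upper semicontinuous envelope $u^*$ is a (finite) sub-solution and its lower semicontinuous envelope $u_*$ a (finite) super-solution. **Control problem.** Let $A(x)=\mathbb R e_i$ for $x\in J_i^*$ and $A(0)=\bigcup_i\mathbb R^+e_i$. For $s\le t$ and $x,y\in J$ let $\mathcal A(s,y;t,x)$ be the set of $X\in W^{1,1}([s,t];\mathbb R^2)$ with $X(\tau)\in J$ for all $\tau\in(s,t)$, $\dot X(\tau)\in A(X(\tau))$ for a.e. $\tau\in(s,t)$, $X(s)=y$ and $X(t)=x$. For $P=pe_i\in A(x)$ let $L(x,P)=L_i(p)$ if $x\in J_i^*$, and $L(0,P)=\min_jL_j(p)$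 with $p\ge0$ if $x=0$. For $t\ge 0$ and $x\in J$ let $$u_{\mathrm{oc}}(t,x)=\inf_{y\in J,\ X\in\mathcal A(0,y;t,x)}\Big\{u_0(y)+\int_0^tL(X(\tau),\dot X(\tau))\,d\tau\Big\},\qquad \mathcal D(0,y;t,x)=\inf_{X\in\mathcal A(0,y;t,x)}\int_0^tL(X(\tau),\dot X(\tau))\,d\tau ,$$ where integrals may take the value $+\infty$ and $\inf\emptyset=+\infty$. **Theorem 1.3 (Optimal control representation).** There is exactly one viscosity solution $u:[0,T)\times J\to\mathbb R$ of (HJ) for which there is a constant $C_T>0$ with $|u(t,x)-u_0(x)|\le C_T$ for all $(t,x)\in J_T$. It is continuous, and it is the value function: $u=u_{\mathrm{oc}}$ on $[0,T)\times J$ (in particular $u_{\mathrm{oc}}$ is finite there). Moreover, for all $t\ge0$ and $x\in J$ the Hopf–Lax formula holds: $$u_{\mathrm{oc}}(t,x)=\inf_{y\in J}\{u_0(y)+\mathcal D(0,y;t,x)\}.$$ -/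

import Mathlib

open Set Filter Topology MeasureTheory

noncomputable section

namespace JunctionHJ

/-- The Euclidean plane in which the junction is embedded. -/
abbrev Plane : Type := EuclideanSpace ℝ (Fin 2)

/-- The data of a junction with `N` branches: `N` pairwise different unit vectors of the plane. -/
structure Junction (N : ℕ) where
  e : Fin N → Plane
  norm_e : ∀ i, ‖e i‖ = 1
  injective_e : Function.Injective e

namespace Junction

variable {N : ℕ} (J : Junction N)

/-- The branch `J_i = [0, ∞) e_i`. -/
def branch (i : Fin N) : Set Plane := {x | ∃ r : ℝ, 0 ≤ r ∧ x = r • J.e i}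

/-- The open branch `J_i^* = J_i \ {0}`. -/
def branchStar (i : Fin N) : Set Plane := J.branch i \ {0}

/-- The junction `J`, the union of the branches. -/
def carrier : Set Plane := ⋃ i, J.branch i

/-- The set `A(x)` of admissible controls at `x`: all of `ℝ e_i` if `x` lies on the open branch
`J_i^*`, and the union of the half-lines `ℝ⁺ e_i` if `x = 0`. -/
def controls (x : Plane) : Set Plane :=
  {P | (∃ i, x ∈ J.branchStar i ∧ ∃ p : ℝ, P = p • J.e i) ∨
    (x = 0 ∧ ∃ i, ∃ p : ℝ, 0 ≤ p ∧ P = p • J.e i)}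

/-- The admissible trajectories from `(s, y)` to `(t, x)`. A function belongs to `W^{1,1}([s,t])`
exactly when it is absolutely continuous on `[s, t]`; its weak derivative is then the almost
everywhere derivative. Only the values of `X` on `[s, t]` matter. -/
def trajectories (s : ℝ) (y : Plane) (t : ℝ) (x : Plane) : Set (ℝ → Plane) :=
  {X | AbsolutelyContinuousOnInterval X s t ∧
    (∀ τ ∈ Ioo s t, X τ ∈ J.carrier) ∧
    (∀ᵐ τ ∂(volume.restrict (Ioo s t)), deriv X τ ∈ J.controls (X τ)) ∧
    X s = y ∧ X t = x}

open Classical in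
/-- The Lagrangian on the junction. For `P = p e_i` and `x ∈ J_i^*` it is `L_i(p)`, where
`p = ⟪e_i, P⟫`; for `x = 0` and `P = p e_i` with `p ≥ 0` it is `L_0(p) = min_j L_j(p)`, where
`p = ‖P‖`. -/
def lagrangian (L : Fin N → ℝ → ℝ) (x P : Plane) : ℝ :=
  if h : ∃ i, x ∈ J.branchStar i then L h.choose (inner ℝ (J.e h.choose) P)
  else ⨅ j, L j ‖P‖

theorem lagrangian_of_branchStar (L : Fin N → ℝ → ℝ) {i : Fin N} {r : ℝ} (hr : 0 < r) (p : ℝ) :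
    J.lagrangian L (r • J.e i) (p • J.e i) = L i p := by
  have hne : ∀ j, J.e j ≠ 0 := fun j h => by simpa [h] using J.norm_e j
  have h : ∃ j, r • J.e i ∈ J.branchStar j :=
    ⟨i, ⟨r, hr.le, rfl⟩, by simp [hr.ne', hne i]⟩
  have hi : h.choose = i := by
    obtain ⟨⟨r', hr', he⟩, -⟩ := h.choose_spec
    have hn : r = r' := by
      have := congrArg norm he
      simpa [norm_smul, J.norm_e, abs_of_pos hr, abs_of_nonneg hr'] using this
    subst hn
    exact (J.injective_e (smul_right_injective Plane hr.ne' he)).symm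
  rw [lagrangian, dif_pos h, hi, inner_smul_right, real_inner_self_eq_norm_sq, J.norm_e]
  norm_num

theorem lagrangian_zero (L : Fin N → ℝ → ℝ) (i : Fin N) {p : ℝ} (hp : 0 ≤ p) :
    J.lagrangian L 0 (p • J.e i) = ⨅ j, L j p := by
  rw [lagrangian, dif_neg (by rintro ⟨j, -, h⟩; exact h rfl), norm_smul, J.norm_e,
    Real.norm_of_nonneg hp, mul_one]

open Classical in
/-- The cost of a trajectory on `[s, t]`, with values in the extended reals. When every `L_i` is
continuous and bounded below, the integrand is measurable and bounded below along an admissible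
trajectory, so that the integral is `+∞` exactly when the integrand is not integrable. -/
def action (L : Fin N → ℝ → ℝ) (s t : ℝ) (X : ℝ → Plane) : EReal :=
  if IntervalIntegrable (fun τ => J.lagrangian L (X τ) (deriv X τ)) volume s t then
    ((∫ τ in s..t, J.lagrangian L (X τ) (deriv X τ) : ℝ) : EReal)
  else ⊤

/-- The minimal action `D(s, y; t, x)` (an infimum over the empty set is `+∞`). -/
def minimalAction (L : Fin N → ℝ → ℝ) (s : ℝ) (y : Plane) (t : ℝ) (x : Plane) : EReal :=
  ⨅ X ∈ J.trajectories s y t x, J.action L s t X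

/-- The value function `u_oc(t, x)` of the optimal control problem with initial cost `u₀`. -/
def valueFunction (L : Fin N → ℝ → ℝ) (u₀ : Plane → ℝ) (t : ℝ) (x : Plane) : EReal :=
  ⨅ y ∈ J.carrier, ⨅ X ∈ J.trajectories 0 y t x, ((u₀ y : ℝ) : EReal) + J.action L 0 t X

end Junction

/-- `H = L^*`, the Legendre-Fenchel transform (a supremum of a set that is bounded above as soon as
`L` is superlinear). -/
def hamiltonian (L : ℝ → ℝ) (p : ℝ) : ℝ := ⨆ q : ℝ, (p * q - L q)

/-- `H⁻(p) = sup_{q ≤ 0} (p q - L(q))`. -/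
def hamiltonianMinus (L : ℝ → ℝ) (p : ℝ) : ℝ := ⨆ q : Iic (0 : ℝ), (p * (q : ℝ) - L q)

namespace Junction

variable {N : ℕ} (J : Junction N)

/-- `J_T = (0, T) × J`. -/
def cylinder (T : ℝ) : Set (ℝ × Plane) := Ioo 0 T ×ˢ J.carrier

/-- `[0, T) × J`. -/
def cylinder₀ (T : ℝ) : Set (ℝ × Plane) := Ico 0 T ×ˢ J.carrier

/-- The space `C^1_*(J_T)`: continuous on `J_T`, and of class `C^1` (up to the junction point) on
`(0, T) × J_i` for every branch, in the coordinates `(t, r) ↦ (t, r e_i)`. -/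
structure IsC1Star (T : ℝ) (φ : ℝ → Plane → ℝ) : Prop where
  continuousOn : ContinuousOn (Function.uncurry φ) (J.cylinder T)
  contDiffOn : ∀ i,
    ContDiffOn ℝ 1 (fun q : ℝ × ℝ => φ q.1 (q.2 • J.e i)) (Ioo 0 T ×ˢ Ici 0)

/-- The time derivative `φ_t(t, x)`. -/
def timeDeriv (φ : ℝ → Plane → ℝ) (t : ℝ) (x : Plane) : ℝ := deriv (fun s => φ s x) t

/-- The space derivative `φ^i_x(t, r e_i)` along the branch `J_i`, one-sided at `r = 0`. -/
def spaceDeriv (φ : ℝ → Plane → ℝ) (i : Fin N) (t r : ℝ) : ℝ :=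
  derivWithin (fun ρ => φ t (ρ • J.e i)) (Ici 0) r

/-- Viscosity sub-solutions on `J_T` of `u_t + H(x, u_x) = 0`. -/
structure IsSubsolution (L : Fin N → ℝ → ℝ) (T : ℝ) (u : ℝ → Plane → ℝ) : Prop where
  usc : UpperSemicontinuousOn (Function.uncurry u) (J.cylinder₀ T)
  touch : ∀ φ : ℝ → Plane → ℝ, J.IsC1Star T φ → ∀ t x, (t, x) ∈ J.cylinder T →
    (∃ ρ : ℝ, 0 < ρ ∧ ∀ s y, (s, y) ∈ Metric.ball (t, x) ρ ∩ J.cylinder T → u s y ≤ φ s y) →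
    u t x = φ t x →
    (∀ (i : Fin N) (r : ℝ), 0 < r → x = r • J.e i →
      timeDeriv φ t x + hamiltonian (L i) (J.spaceDeriv φ i t r) ≤ 0) ∧
    (x = 0 → timeDeriv φ t x + ⨆ i, hamiltonianMinus (L i) (J.spaceDeriv φ i t 0) ≤ 0)

/-- Viscosity super-solutions on `J_T` of `u_t + H(x, u_x) = 0`. -/
structure IsSupersolution (L : Fin N → ℝ → ℝ) (T : ℝ) (u : ℝ → Plane → ℝ) : Prop where
  lsc : LowerSemicontinuousOn (Function.uncurry u) (J.cylinder₀ T)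
  touch : ∀ φ : ℝ → Plane → ℝ, J.IsC1Star T φ → ∀ t x, (t, x) ∈ J.cylinder T →
    (∃ ρ : ℝ, 0 < ρ ∧ ∀ s y, (s, y) ∈ Metric.ball (t, x) ρ ∩ J.cylinder T → φ s y ≤ u s y) →
    u t x = φ t x →
    (∀ (i : Fin N) (r : ℝ), 0 < r → x = r • J.e i →
      0 ≤ timeDeriv φ t x + hamiltonian (L i) (J.spaceDeriv φ i t r)) ∧
    (x = 0 → 0 ≤ timeDeriv φ t x + ⨆ i, hamiltonianMinus (L i) (J.spaceDeriv φ i t 0))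

/-- The upper semicontinuous envelope `u^*` of `u : [0, T) × J → ℝ`. -/
def upperEnvelope (T : ℝ) (u : ℝ → Plane → ℝ) (t : ℝ) (x : Plane) : EReal :=
  limsup (fun q : ℝ × Plane => ((u q.1 q.2 : ℝ) : EReal)) (𝓝[J.cylinder₀ T] (t, x))

/-- The lower semicontinuous envelope `u_*` of `u : [0, T) × J → ℝ`. -/
def lowerEnvelope (T : ℝ) (u : ℝ → Plane → ℝ) (t : ℝ) (x : Plane) : EReal :=
  liminf (fun q : ℝ × Plane => ((u q.1 q.2 : ℝ) : EReal)) (𝓝[J.cylinder₀ T] (t, x))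

/-- (Possibly discontinuous) viscosity solutions on `J_T` of `u_t + H(x, u_x) = 0`,
`u(0, ·) = u₀`: both envelopes are finite, `u^*` is a sub-solution with `u^*(0, ·) ≤ u₀`, and `u_*`
is a super-solution with `u_*(0, ·) ≥ u₀`. -/
def IsViscositySolution (L : Fin N → ℝ → ℝ) (u₀ : Plane → ℝ) (T : ℝ) (u : ℝ → Plane → ℝ) : Prop :=
  ∃ v w : ℝ → Plane → ℝ,
    (∀ t x, (t, x) ∈ J.cylinder₀ T →
      ((v t x : ℝ) : EReal) = J.upperEnvelope T u t x ∧
      ((w t x : ℝ) : EReal) = J.lowerEnvelope T u t x) ∧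
    J.IsSubsolution L T v ∧ (∀ x ∈ J.carrier, v 0 x ≤ u₀ x) ∧
    J.IsSupersolution L T w ∧ (∀ x ∈ J.carrier, u₀ x ≤ w 0 x)

/-- The growth condition `|u - u₀| ≤ C_T` on `J_T` that singles out the solution. -/
def StaysClose (u₀ : Plane → ℝ) (T : ℝ) (u : ℝ → Plane → ℝ) : Prop :=
  ∃ C : ℝ, 0 < C ∧ ∀ t x, (t, x) ∈ J.cylinder T → |u t x - u₀ x| ≤ C

end Junction

end JunctionHJ

end

/-! The proof turns on the suboptimality principle: travelling on a branch `i` with velocity `q`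
during a time `h` raises a function by at most `h * L i q`. The value function has this property
because trajectories can be concatenated, and it is the infimum of costs along trajectories. The
infinitesimal form of the principle is the subsolution inequality; a segment that ends at the vertex
and stays in its branch has `q ≤ 0`, which is why only `hamiltonianMinus` appears there.

Lower bounds on costs come from calibrations: if `c + p i * q ≤ L i q` for all `q`, integration
along a trajectory bounds its cost below by an affine function of the end points
(`IsFinitePath.calibration`). This gives finiteness and Lipschitz continuity of the value function,
the supersolution inequality (applied to almost optimal trajectories on a short final interval), and
Jensen's inequality on a branch.

Comparison is made with the value function only, without doubling of variables. For a subsolution,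
an explicit barrier that follows a segment yields the suboptimality principle
(`IsSubsolution.segment_le`). Cutting a trajectory at its first and last visits to the vertex
extends the principle to all trajectories (`IsSubsolution.le_add_cost`), so a subsolution lies below
the value function. For a supersolution `w`, the value function is perturbed into a strictly
suboptimal `V` whose trace at the vertex is `C¹` in time. At a maximum of `V - w` a smooth test
function contradicts the equation of `w`: on a branch a mollification of `V` with a quadratic
correction, at the vertex the trace of `V` transported along incoming segments. The bound
`StaysClose` confines the maximum to a compact set.

For a solution, `u_* ≤ u ≤ u^*`, `u^*` lies below the value function and `u_*` above it, so all
coincide. The Hopf–Lax formula only regroups the infimum. -/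

noncomputable section

/-! ### Convexity and growth of the Lagrangians. -/

namespace JunctionHJ

/-- Lagrangians of class `C²` whose second derivative is bounded below by a positive constant. -/
structure IsStronglyConvexLagrangian (L : ℝ → ℝ) : Prop where
  contDiff : ContDiff ℝ 2 L
  pos : ∃ γ : ℝ, 0 < γ ∧ ∀ q, γ ≤ deriv (deriv L) q

namespace IsStronglyConvexLagrangian

variable {L : ℝ → ℝ}

theorem continuous (hL : IsStronglyConvexLagrangian L) : Continuous L := hL.contDiff.continuous

theorem differentiable (hL : IsStronglyConvexLagrangian L) : Differentiable ℝ L :=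
  hL.contDiff.differentiable (by norm_num)

theorem contDiff_deriv (hL : IsStronglyConvexLagrangian L) : ContDiff ℝ 1 (deriv L) := by
  have h := hL.contDiff
  rw [show (2 : WithTop ℕ∞) = 1 + 1 by norm_num, contDiff_succ_iff_deriv] at h
  exact h.2.2

/-- After subtraction of the tangent and of the parabola, the derivative is a nondecreasing function
vanishing at `q₀`, so the difference is minimal at `q₀`. -/
theorem exists_quadratic_support (hL : IsStronglyConvexLagrangian L) :
    ∃ γ : ℝ, 0 < γ ∧ ∀ q₀ q, L q₀ + deriv L q₀ * (q - q₀) + γ / 2 * (q - q₀) ^ 2 ≤ L q := by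
  obtain ⟨γ, hγ, h⟩ := hL.pos
  refine ⟨γ, hγ, fun q₀ q => ?_⟩
  have hd2 : Differentiable ℝ (deriv L) := hL.contDiff_deriv.differentiable (by norm_num)
  let k : ℝ → ℝ := fun q => deriv L q - γ * q
  have hk : Monotone k := by
    refine monotone_of_deriv_nonneg (by fun_prop) fun x => ?_
    have : HasDerivAt k (deriv (deriv L) x - γ * 1) x :=
      (hd2 x).hasDerivAt.sub ((hasDerivAt_id x).const_mul γ)
    rw [this.deriv]; linarith [h x]
  let g : ℝ → ℝ := fun q => L q - deriv L q₀ * (q - q₀) - γ / 2 * (q - q₀) ^ 2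
  have hg : ∀ x, HasDerivAt g (k x - k q₀) x := fun x => by
    have h1 := ((hL.differentiable x).hasDerivAt.sub
      (((hasDerivAt_id x).sub_const q₀).const_mul (deriv L q₀))).sub
      ((((hasDerivAt_id x).sub_const q₀).pow 2).const_mul (γ / 2))
    convert! h1 using 1
    simp [k]; ring
  have hgd : Differentiable ℝ g := fun x => (hg x).differentiableAt
  suffices g q₀ ≤ g q by simp [g] at this; linarith
  rcases le_total q₀ q with hq | hq
  · refine monotoneOn_of_deriv_nonneg (convex_Ici q₀) hgd.continuous.continuousOn
      hgd.differentiableOn (fun x hx => ?_) self_mem_Ici hq hq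
    rw [interior_Ici] at hx
    rw [(hg x).deriv]; linarith [hk hx.le]
  · refine antitoneOn_of_deriv_nonpos (convex_Iic q₀) hgd.continuous.continuousOn
      hgd.differentiableOn (fun x hx => ?_) hq self_mem_Iic hq
    rw [interior_Iic] at hx
    rw [(hg x).deriv]; linarith [hk hx.le]

theorem support (hL : IsStronglyConvexLagrangian L) (q₀ q : ℝ) :
    L q₀ + deriv L q₀ * (q - q₀) ≤ L q := by
  obtain ⟨γ, hγ, h⟩ := hL.exists_quadratic_support
  nlinarith [h q₀ q, sq_nonneg (q - q₀)]

/-- Completion of the square in the quadratic lower bound at `0`. It makes both Hamiltonians finite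
and lets costs control displacements. -/
theorem superlinear (hL : IsStronglyConvexLagrangian L) (K : ℝ) :
    ∃ A : ℝ, ∀ q, K * |q| - A ≤ L q := by
  obtain ⟨γ, hγ, h⟩ := hL.exists_quadratic_support
  refine ⟨(K + |deriv L 0|) ^ 2 / (2 * γ) - L 0, fun q => ?_⟩
  have h0 := h 0 q
  have h1 : -(|deriv L 0| * |q|) ≤ deriv L 0 * q := by
    rw [← abs_mul]; exact neg_abs_le _
  have h2 : (K + |deriv L 0|) * |q| ≤
      γ / 2 * q ^ 2 + (K + |deriv L 0|) ^ 2 / (2 * γ) := by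
    have : 0 ≤ (γ * |q| - (K + |deriv L 0|)) ^ 2 / (2 * γ) := by positivity
    have e : (γ * |q| - (K + |deriv L 0|)) ^ 2 / (2 * γ) =
        γ / 2 * |q| ^ 2 + (K + |deriv L 0|) ^ 2 / (2 * γ) - (K + |deriv L 0|) * |q| := by
      field_simp; ring
    rw [e, sq_abs] at this; linarith
  simp only [sub_zero] at h0
  linarith

/-- The quantity `L q - q * deriv L q` is the intercept at `0` of the tangent at `q`, that is, minus
the Hamiltonian at `deriv L q`. It equals `L 0` at `q = 0` and tends to `-∞` as `q → -∞`. The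
incoming velocities of the test function at the vertex are chosen this way. -/
theorem exists_neg_sub_mul_deriv_eq (hL : IsStronglyConvexLagrangian L) {c : ℝ} (hc : c < L 0) :
    ∃ q < 0, L q - q * deriv L q = c := by
  obtain ⟨γ, hγ, h⟩ := hL.exists_quadratic_support
  have hcont : Continuous fun q => L q - q * deriv L q := by
    have := hL.contDiff_deriv.continuous
    have := hL.continuous
    fun_prop
  -- By quadratic support the intercept at `b` is at most `L 0 - γ / 2 * b ^ 2`, so `γ * b ^ 2 ≥ 2 *
  -- (L 0 - c)` suffices.
  let b : ℝ := -(1 + 2 * (L 0 - c) / γ)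
  have hb : 1 + 2 * (L 0 - c) / γ > 0 := by
    have : 0 < 2 * (L 0 - c) / γ := div_pos (by linarith) hγ
    linarith
  have hb2 : L b - b * deriv L b ≤ c := by
    have h1 := h b 0
    have e : γ * (2 * (L 0 - c) / γ) = 2 * (L 0 - c) := by field_simp
    have h3 : 0 < 2 * (L 0 - c) / γ := div_pos (by linarith) hγ
    have : γ * b ^ 2 ≥ 2 * (L 0 - c) := by
      simp only [b]; nlinarith
    nlinarith
  obtain ⟨q, hq, hq2⟩ := intermediate_value_Icc (a := b) (b := 0) (by simp only [b]; linarith)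
    hcont.continuousOn ⟨hb2, by simpa using hc.le⟩
  refine ⟨q, lt_of_le_of_ne hq.2 ?_, hq2⟩
  rintro rfl
  simp at hq2; linarith

theorem le_hamiltonian (hL : IsStronglyConvexLagrangian L) (p q : ℝ) :
    p * q - L q ≤ hamiltonian L p := by
  obtain ⟨A, hA⟩ := hL.superlinear |p|
  refine le_ciSup (f := fun q => p * q - L q) ⟨A, ?_⟩ q
  rintro _ ⟨q, rfl⟩
  have := le_abs_self (p * q)
  rw [abs_mul] at this
  simp only; linarith [hA q]

theorem le_hamiltonianMinus (hL : IsStronglyConvexLagrangian L) (p : ℝ) {q : ℝ} (hq : q ≤ 0) :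
    p * q - L q ≤ hamiltonianMinus L p := by
  obtain ⟨A, hA⟩ := hL.superlinear |p|
  refine le_ciSup (f := fun q : Iic (0 : ℝ) => p * (q : ℝ) - L q) ⟨A, ?_⟩ ⟨q, hq⟩
  rintro _ ⟨q, rfl⟩
  have := le_abs_self (p * (q : ℝ))
  rw [abs_mul] at this
  simp only; linarith [hA q]

end IsStronglyConvexLagrangian

theorem hamiltonian_le {L : ℝ → ℝ} {p c : ℝ} (h : ∀ q, p * q - L q ≤ c) : hamiltonian L p ≤ c :=
  ciSup_le h

theorem hamiltonianMinus_le {L : ℝ → ℝ} {p c : ℝ} (h : ∀ q ≤ 0, p * q - L q ≤ c) :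
    hamiltonianMinus L p ≤ c :=
  have : Nonempty (Iic (0 : ℝ)) := ⟨⟨0, self_mem_Iic⟩⟩
  ciSup_le fun q => h q q.2

end JunctionHJ

end

/-! ### Coordinates on the junction, and test functions glued from the branches. -/

noncomputable section

namespace JunctionHJ

namespace Junction

variable {N : ℕ} (J : Junction N)

/-- Finitely many distinct unit vectors have a uniform angular gap; it separates the branches in the
definition of `coord`. -/
theorem exists_inner_le : ∃ m : ℝ, m < 1 ∧ ∀ i j, i ≠ j → inner ℝ (J.e i) (J.e j) ≤ m := by
  have hlt : ∀ i j, i ≠ j → inner ℝ (J.e i) (J.e j) < 1 := fun i j hij =>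
    (inner_lt_one_iff_real_of_norm_eq_one (J.norm_e i) (J.norm_e j)).2 fun h => hij (J.injective_e h)
  let S : Finset (Fin N × Fin N) := Finset.univ.filter fun p => p.1 ≠ p.2
  by_cases hS : S.Nonempty
  · obtain ⟨p, hp, hmax⟩ := S.exists_max_image (fun p => inner ℝ (J.e p.1) (J.e p.2)) hS
    exact ⟨_, hlt p.1 p.2 (by simpa [S] using hp), fun i j hij => hmax (i, j) (by simpa [S])⟩
  · refine ⟨0, one_pos, fun i j hij => (hS ⟨(i, j), by simpa [S]⟩).elim⟩

/-- The coordinate along the branch `J_i`, extended to the plane as a Lipschitz function: it maps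
`r e_i` to `r` and vanishes on the other branches. -/
def coord (i : Fin N) (x : Plane) : ℝ :=
  max 0 ((inner ℝ (J.e i) x - J.exists_inner_le.choose * ‖x‖) / (1 - J.exists_inner_le.choose))

theorem coord_nonneg (i : Fin N) (x : Plane) : 0 ≤ J.coord i x := le_max_left _ _

theorem norm_smul_e (i : Fin N) {r : ℝ} (hr : 0 ≤ r) : ‖r • J.e i‖ = r := by
  rw [norm_smul, J.norm_e, mul_one, Real.norm_of_nonneg hr]

theorem e_ne_zero (i : Fin N) : J.e i ≠ 0 := fun h => by simpa [h] using J.norm_e i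

theorem coord_smul_self (i : Fin N) {r : ℝ} (hr : 0 ≤ r) : J.coord i (r • J.e i) = r := by
  have h1 := J.exists_inner_le.choose_spec.1
  rw [coord, J.norm_smul_e i hr, inner_smul_right, real_inner_self_eq_norm_sq, J.norm_e]
  rw [show (r * 1 ^ 2 - J.exists_inner_le.choose * r) / (1 - J.exists_inner_le.choose) = r by
    rw [div_eq_iff (by linarith)]; ring]
  exact max_eq_right hr

theorem coord_smul_of_ne {i j : Fin N} (hij : i ≠ j) {r : ℝ} (hr : 0 ≤ r) :
    J.coord i (r • J.e j) = 0 := by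
  have h1 := J.exists_inner_le.choose_spec.1
  have h2 := J.exists_inner_le.choose_spec.2 i j hij
  rw [coord, J.norm_smul_e j hr, inner_smul_right]
  exact max_eq_left (div_nonpos_of_nonpos_of_nonneg (by nlinarith) (by linarith))

@[simp] theorem coord_zero (i : Fin N) : J.coord i 0 = 0 := by simp [coord]

/-- Being Lipschitz on the whole plane, the coordinates turn absolutely continuous trajectories into
absolutely continuous real functions. -/
theorem exists_lipschitzWith_coord : ∃ K : NNReal, ∀ i, LipschitzWith K (J.coord i) := by
  have h1 := J.exists_inner_le.choose_spec.1
  set m := J.exists_inner_le.choose with hm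
  refine ⟨((1 + |m|) / (1 - m)).toNNReal, fun i => LipschitzWith.of_dist_le_mul fun x y => ?_⟩
  rw [Real.coe_toNNReal _ (div_nonneg (by positivity) (by linarith)), Real.dist_eq, dist_eq_norm]
  have h2 : |J.coord i x - J.coord i y| ≤
      |(inner ℝ (J.e i) x - m * ‖x‖) / (1 - m) - (inner ℝ (J.e i) y - m * ‖y‖) / (1 - m)| := by
    rw [coord, coord, ← hm, max_comm 0, max_comm 0]
    exact abs_max_sub_max_le_abs _ _ _
  refine h2.trans ?_
  rw [← sub_div, abs_div, abs_of_pos (by linarith : 0 < 1 - m), div_mul_eq_mul_div]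
  refine div_le_div_of_nonneg_right ?_ (by linarith)
  have h3 : |inner ℝ (J.e i) (x - y)| ≤ ‖x - y‖ := by
    simpa [J.norm_e] using abs_real_inner_le_norm (J.e i) (x - y)
  have h4 : |m * (‖x‖ - ‖y‖)| ≤ |m| * ‖x - y‖ := by
    rw [abs_mul]; exact mul_le_mul_of_nonneg_left (abs_norm_sub_norm_le x y) (abs_nonneg _)
  calc _ = |inner ℝ (J.e i) (x - y) - m * (‖x‖ - ‖y‖)| := by rw [inner_sub_right]; ring_nf
    _ ≤ _ := (abs_sub _ _).trans (by linarith)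

theorem continuous_coord (i : Fin N) : Continuous (J.coord i) :=
  (J.exists_lipschitzWith_coord.choose_spec i).continuous

theorem mem_carrier {x : Plane} : x ∈ J.carrier ↔ ∃ i, ∃ r : ℝ, 0 ≤ r ∧ x = r • J.e i := by
  simp [carrier, branch]

theorem smul_mem_carrier (i : Fin N) {r : ℝ} (hr : 0 ≤ r) : r • J.e i ∈ J.carrier :=
  J.mem_carrier.2 ⟨i, r, hr, rfl⟩

theorem zero_mem_carrier [Nonempty (Fin N)] : (0 : Plane) ∈ J.carrier :=
  J.mem_carrier.2 ⟨Classical.arbitrary _, 0, le_rfl, by simp⟩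

theorem smul_mem_branchStar (i : Fin N) {r : ℝ} (hr : 0 < r) : r • J.e i ∈ J.branchStar i :=
  ⟨⟨r, hr.le, rfl⟩, by simp [hr.ne', J.e_ne_zero i]⟩

theorem eq_coord_smul_of_coord_pos {x : Plane} (hx : x ∈ J.carrier) {i : Fin N}
    (hi : 0 < J.coord i x) : x = J.coord i x • J.e i := by
  obtain ⟨j, r, hr, rfl⟩ := J.mem_carrier.1 hx
  obtain rfl : i = j := by
    by_contra h
    simp [J.coord_smul_of_ne h hr] at hi
  rw [J.coord_smul_self i hr]

theorem eq_zero_of_coord {x : Plane} (hx : x ∈ J.carrier) (h : ∀ i, J.coord i x = 0) : x = 0 := by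
  obtain ⟨j, r, hr, rfl⟩ := J.mem_carrier.1 hx
  have := h j
  rw [J.coord_smul_self j hr] at this
  simp [this]

theorem exists_coord_pos {x : Plane} (hx : x ∈ J.carrier) (h : x ≠ 0) : ∃ i, 0 < J.coord i x := by
  by_contra! hc
  exact h (J.eq_zero_of_coord hx fun i => le_antisymm (hc i) (J.coord_nonneg i x))

theorem coord_eq_zero_of_ne {x : Plane} (hx : x ∈ J.carrier) {i j : Fin N} (hij : j ≠ i)
    (hi : 0 < J.coord i x) : J.coord j x = 0 := by
  rw [J.eq_coord_smul_of_coord_pos hx hi]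
  exact J.coord_smul_of_ne hij hi.le

theorem eq_sum_coord {x : Plane} (hx : x ∈ J.carrier) : x = ∑ i, J.coord i x • J.e i := by
  obtain ⟨j, r, hr, rfl⟩ := J.mem_carrier.1 hx
  rw [Finset.sum_eq_single j]
  · rw [J.coord_smul_self j hr]
  · intro i _ hij; rw [J.coord_smul_of_ne hij hr, zero_smul]
  · simp

theorem isClosed_carrier : IsClosed J.carrier := by
  have : ∀ i, J.branch i = {x | x = J.coord i x • J.e i} := fun i => by
    ext x
    constructor
    · rintro ⟨r, hr, rfl⟩
      simp [J.coord_smul_self i hr]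
    · exact fun h => ⟨_, J.coord_nonneg i x, h⟩
  refine isClosed_iUnion_of_finite fun i => ?_
  rw [this]
  exact isClosed_eq continuous_id ((J.continuous_coord i).smul continuous_const)

theorem isCompact_carrier_inter_closedBall (R : ℝ) :
    IsCompact (J.carrier ∩ Metric.closedBall 0 R) :=
  (isCompact_closedBall _ _).inter_left J.isClosed_carrier

/-- The function on the junction with given restrictions to the branches. -/
def glue (g : ℝ → ℝ) (f : Fin N → ℝ × ℝ → ℝ) (s : ℝ) (x : Plane) : ℝ :=
  g s + ∑ i, (f i (s, J.coord i x) - g s)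

variable {J} in
theorem glue_smul {g : ℝ → ℝ} {f : Fin N → ℝ × ℝ → ℝ} (h0 : ∀ i s, f i (s, 0) = g s) (i : Fin N)
    (s : ℝ) {r : ℝ} (hr : 0 ≤ r) : J.glue g f s (r • J.e i) = f i (s, r) := by
  rw [glue, Finset.sum_eq_single i]
  · rw [J.coord_smul_self i hr]; ring
  · intro j _ hji; rw [J.coord_smul_of_ne hji hr, h0, sub_self]
  · simp

variable {J} in
theorem glue_zero {g : ℝ → ℝ} {f : Fin N → ℝ × ℝ → ℝ} (h0 : ∀ i s, f i (s, 0) = g s) (s : ℝ) :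
    J.glue g f s 0 = g s := by
  simp [glue, h0]

theorem continuous_glue {g : ℝ → ℝ} {f : Fin N → ℝ × ℝ → ℝ} (hg : Continuous g)
    (hf : ∀ i, Continuous (f i)) : Continuous (Function.uncurry (J.glue g f)) := by
  have := J.continuous_coord
  simp only [Function.uncurry_def, glue]
  fun_prop

theorem isC1Star_glue {g : ℝ → ℝ} {f : Fin N → ℝ × ℝ → ℝ} (h0 : ∀ i s, f i (s, 0) = g s)
    (hg : Continuous g) (hf : ∀ i, ContDiff ℝ 1 (f i)) (T : ℝ) : J.IsC1Star T (J.glue g f) where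
  continuousOn := (J.continuous_glue hg fun i => (hf i).continuous).continuousOn
  contDiffOn i := (hf i).contDiffOn.congr fun q hq => glue_smul h0 i q.1 hq.2

variable {J} in
theorem timeDeriv_glue {g : ℝ → ℝ} {f : Fin N → ℝ × ℝ → ℝ} (h0 : ∀ i s, f i (s, 0) = g s)
    (i : Fin N) {t r a : ℝ} (hr : 0 ≤ r) (ha : HasDerivAt (fun s => f i (s, r)) a t) :
    timeDeriv (J.glue g f) t (r • J.e i) = a := by
  rw [timeDeriv, ← ha.deriv]
  congr 1
  ext s
  exact glue_smul h0 i s hr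

variable {J} in
theorem spaceDeriv_glue {g : ℝ → ℝ} {f : Fin N → ℝ × ℝ → ℝ} (h0 : ∀ i s, f i (s, 0) = g s)
    (i : Fin N) {t r b : ℝ} (hr : 0 ≤ r) (hb : HasDerivAt (fun ρ => f i (t, ρ)) b r) :
    J.spaceDeriv (J.glue g f) i t r = b := by
  rw [spaceDeriv, ← (hb.hasDerivWithinAt (s := Ici 0)).derivWithin (uniqueDiffOn_Ici 0 r hr)]
  exact derivWithin_congr (fun ρ hρ => glue_smul h0 i t hρ) (glue_smul h0 i t hr)

variable {J}

/-- The chain rule along the two coordinate lines identifies the components of the derivative within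
the half-strip, the vertex `r = 0` included, since one-sided derivatives on `Ici 0` are unique. -/
theorem IsC1Star.hasFDerivWithinAt {T : ℝ} {φ : ℝ → Plane → ℝ} (hφ : J.IsC1Star T φ) {t : ℝ}
    (ht : t ∈ Ioo 0 T) (i : Fin N) {r : ℝ} (hr : 0 ≤ r) :
    HasFDerivWithinAt (fun q : ℝ × ℝ => φ q.1 (q.2 • J.e i))
      (timeDeriv φ t (r • J.e i) • ContinuousLinearMap.fst ℝ ℝ ℝ +
        J.spaceDeriv φ i t r • ContinuousLinearMap.snd ℝ ℝ ℝ) (Ioo 0 T ×ˢ Ici 0) (t, r) := by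
  have hd := (((hφ.contDiffOn i).differentiableOn one_ne_zero) (t, r) ⟨ht, hr⟩).hasFDerivWithinAt
  set F := fderivWithin ℝ (fun q : ℝ × ℝ => φ q.1 (q.2 • J.e i)) (Ioo 0 T ×ˢ Ici 0) (t, r)
  have h1 : timeDeriv φ t (r • J.e i) = F (1, 0) := by
    have hc : HasDerivWithinAt (fun s : ℝ => (s, r)) ((1 : ℝ), (0 : ℝ)) (Ioo 0 T) t :=
      ((hasDerivAt_id t).prodMk (hasDerivAt_const t r)).hasDerivWithinAt
    have hm : MapsTo (fun s : ℝ => (s, r)) (Ioo 0 T) (Ioo 0 T ×ˢ Ici 0) := fun s hs => ⟨hs, hr⟩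
    have := hd.comp_hasDerivWithinAt t hc hm
    exact (this.hasDerivAt (isOpen_Ioo.mem_nhds ht)).deriv
  have h2 : J.spaceDeriv φ i t r = F (0, 1) := by
    have hc : HasDerivWithinAt (fun s : ℝ => (t, s)) ((0 : ℝ), (1 : ℝ)) (Ici 0) r :=
      ((hasDerivAt_const r t).prodMk (hasDerivAt_id r)).hasDerivWithinAt
    have hm : MapsTo (fun s : ℝ => (t, s)) (Ici 0) (Ioo 0 T ×ˢ Ici 0) := fun s hs => ⟨ht, hs⟩
    have := hd.comp_hasDerivWithinAt r hc hm
    exact this.derivWithin (uniqueDiffOn_Ici 0 r hr)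
  convert! hd using 1
  ext <;> simp [h1, h2]

theorem IsC1Star.exists_abs_le {T : ℝ} {φ : ℝ → Plane → ℝ} (hφ : J.IsC1Star T φ) {t : ℝ}
    (ht : t ∈ Ioo 0 T) (i : Fin N) {r : ℝ} (hr : 0 ≤ r) {δ : ℝ} (hδ : 0 < δ) :
    ∃ η > 0, ∀ s ρ, |s - t| < η → |ρ - r| < η → 0 ≤ ρ →
      |φ s (ρ • J.e i) - φ t (r • J.e i) - (timeDeriv φ t (r • J.e i) * (s - t) +
        J.spaceDeriv φ i t r * (ρ - r))| ≤ δ * (|s - t| + |ρ - r|) := by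
  have h := (hφ.hasFDerivWithinAt ht i hr).isLittleO.def hδ
  rw [eventually_nhdsWithin_iff, Metric.eventually_nhds_iff] at h
  obtain ⟨η, hη, h⟩ := h
  refine ⟨min η (min t (T - t)), lt_min hη (lt_min ht.1 (sub_pos.2 ht.2)), fun s ρ hs hρ hρ0 => ?_⟩
  have hs1 := hs.trans_le (min_le_right _ _)
  have hs2 := abs_lt.1 (hs1.trans_le (min_le_left _ _))
  have hs3 := abs_lt.1 (hs1.trans_le (min_le_right _ _))
  have := @h (s, ρ) (by
    rw [Prod.dist_eq, Real.dist_eq, Real.dist_eq]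
    exact max_lt (hs.trans_le (min_le_left _ _)) (hρ.trans_le (min_le_left _ _)))
    ⟨⟨by linarith, by linarith⟩, hρ0⟩
  simp only [Real.norm_eq_abs, Prod.mk_sub_mk, add_apply,
    smul_apply, ContinuousLinearMap.coe_fst', ContinuousLinearMap.coe_snd',
    smul_eq_mul, Prod.norm_mk] at this
  refine this.trans (mul_le_mul_of_nonneg_left ?_ hδ.le)
  exact max_le (le_add_of_nonneg_right (abs_nonneg _)) (le_add_of_nonneg_left (abs_nonneg _))

end Junction

end JunctionHJ

end

/-! ### Absolute continuity under shifts, truncation and concatenation. -/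

noncomputable section

-- Such a change of time sends a disjoint family of short intervals to another one of no larger
-- total length. It covers translations and the truncations `min · b` and `max · b`.
open AbsolutelyContinuousOnInterval in
theorem AbsolutelyContinuousOnInterval.comp_nonexpansive {E : Type*} [PseudoMetricSpace E]
    {f : ℝ → E} {g : ℝ → ℝ} {a b c d : ℝ} (hf : AbsolutelyContinuousOnInterval f a b)
    (hg : ∀ p q, dist (g p) (g q) ≤ dist p q) (hm : MapsTo g (uIcc c d) (uIcc a b))
    (hdisj : ∀ p q p' q', Disjoint (uIoc p q) (uIoc p' q') →
      Disjoint (uIoc (g p) (g q)) (uIoc (g p') (g q'))) :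
    AbsolutelyContinuousOnInterval (fun τ => f (g τ)) c d := by
  rw [absolutelyContinuousOnInterval_iff] at hf ⊢
  intro ε hε
  obtain ⟨δ, hδ, h⟩ := hf ε hε
  refine ⟨δ, hδ, fun E hE hsum => h (E.1, fun i => (g (E.2 i).1, g (E.2 i).2)) ⟨?_, ?_⟩ ?_⟩
  · exact fun i hi => ⟨hm (hE.1 i hi).1, hm (hE.1 i hi).2⟩
  · exact fun i hi j hj hij => hdisj _ _ _ _ (hE.2 hi hj hij)
  · exact (Finset.sum_le_sum fun i _ => hg _ _).trans_lt hsum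

theorem AbsolutelyContinuousOnInterval.comp_add_right {E : Type*} [PseudoMetricSpace E]
    {f : ℝ → E} {a b : ℝ} (h : ℝ) (hf : AbsolutelyContinuousOnInterval f (a + h) (b + h)) :
    AbsolutelyContinuousOnInterval (fun τ => f (τ + h)) a b := by
  refine hf.comp_nonexpansive (g := fun τ => τ + h) (by simp) (fun τ hτ => ?_) ?_
  · rw [mem_uIcc] at hτ ⊢; simpa using hτ
  · intro p q p' q' hd
    rw [Set.disjoint_left] at hd ⊢
    intro z hz hz'
    refine @hd (z - h) ?_ ?_ <;> rw [mem_uIoc] at hz hz' ⊢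
    · rcases hz with hz | hz
      · left; constructor <;> linarith [hz.1, hz.2]
      · right; constructor <;> linarith [hz.1, hz.2]
    · rcases hz' with hz | hz
      · left; constructor <;> linarith [hz.1, hz.2]
      · right; constructor <;> linarith [hz.1, hz.2]

/-- The concatenation equals `f (min τ b) + g (max τ b) - f b`. -/
theorem AbsolutelyContinuousOnInterval.ite_le {E : Type*} [NormedAddCommGroup E] {f g : ℝ → E}
    {a b c : ℝ} (hab : a ≤ b) (hbc : b ≤ c) (hf : AbsolutelyContinuousOnInterval f a b)
    (hg : AbsolutelyContinuousOnInterval g b c) (hfg : f b = g b) :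
    AbsolutelyContinuousOnInterval (fun τ => if τ ≤ b then f τ else g τ) a c := by
  have h1 : AbsolutelyContinuousOnInterval (fun τ => f (min τ b)) a c := by
    refine hf.comp_nonexpansive (g := fun τ => min τ b) (fun p q => ?_) (fun τ hτ => ?_) ?_
    · simpa [Real.dist_eq] using abs_min_sub_min_le_max p b q b
    · rw [uIcc_of_le (hab.trans hbc)] at hτ
      rw [uIcc_of_le hab]
      exact ⟨le_min hτ.1 hab, min_le_right _ _⟩
    · intro p q p' q' hd
      refine hd.mono ?_ ?_ <;>
      · intro z hz
        rw [mem_uIoc] at hz ⊢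
        grind
  have h2 : AbsolutelyContinuousOnInterval (fun τ => g (max τ b)) a c := by
    refine hg.comp_nonexpansive (g := fun τ => max τ b) (fun p q => ?_) (fun τ hτ => ?_) ?_
    · simpa [Real.dist_eq] using abs_max_sub_max_le_max p b q b
    · rw [uIcc_of_le (hab.trans hbc)] at hτ
      rw [uIcc_of_le hbc]
      exact ⟨le_max_right _ _, max_le hτ.2 hbc⟩
    · intro p q p' q' hd
      refine hd.mono ?_ ?_ <;>
      · intro z hz
        rw [mem_uIoc] at hz ⊢
        grind
  have h3 : AbsolutelyContinuousOnInterval (fun _ : ℝ => f b) a c :=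
    (LipschitzWith.const (f b)).lipschitzOnWith.absolutelyContinuousOnInterval
  have h4 := (h1.add h2).sub h3
  convert! h4 using 1
  ext1 τ
  simp only [Pi.sub_apply, Pi.add_apply]
  split_ifs with h
  · rw [min_eq_left h, max_eq_right h, hfg]; abel
  · rw [min_eq_right (not_le.1 h).le, max_eq_left (not_le.1 h).le]; abel

theorem LipschitzWith.comp_absolutelyContinuousOnInterval {E F : Type*} [PseudoMetricSpace E]
    [PseudoMetricSpace F] {K : NNReal} {g : E → F} (hg : LipschitzWith K g) {f : ℝ → E} {a b : ℝ}
    (hf : AbsolutelyContinuousOnInterval f a b) :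
    AbsolutelyContinuousOnInterval (fun τ => g (f τ)) a b := by
  have h : Tendsto _ _ _ := hf
  refine squeeze_zero (fun E => Finset.sum_nonneg fun i _ => dist_nonneg)
    (fun E => ?_) (by simpa using h.const_mul (K : ℝ))
  rw [Finset.mul_sum]
  exact Finset.sum_le_sum fun i _ => hg.dist_le_mul _ _

/-! ### Trajectories of finite cost and calibrations. -/

namespace JunctionHJ

namespace Junction

variable {N : ℕ} (J : Junction N)

/-- The running cost along a trajectory. -/
def runningCost (L : Fin N → ℝ → ℝ) (X : ℝ → Plane) (τ : ℝ) : ℝ :=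
  J.lagrangian L (X τ) (deriv X τ)

/-- Admissible trajectories of finite cost. -/
structure IsFinitePath (L : Fin N → ℝ → ℝ) (s : ℝ) (y : Plane) (t : ℝ) (x : Plane)
    (X : ℝ → Plane) : Prop where
  mem : X ∈ J.trajectories s y t x
  integrable : IntervalIntegrable (J.runningCost L X) volume s t

variable {J} {L : Fin N → ℝ → ℝ} {s t : ℝ} {x y : Plane} {X : ℝ → Plane}

theorem runningCost_congr {Y : ℝ → Plane} {τ : ℝ} (h : X =ᶠ[𝓝 τ] Y) :
    J.runningCost L X τ = J.runningCost L Y τ := by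
  rw [runningCost, runningCost, h.deriv_eq, h.eq_of_nhds]

theorem IsFinitePath.mono (hX : J.IsFinitePath L s y t x X) {a b : ℝ} (ha : s ≤ a) (hab : a ≤ b)
    (hb : b ≤ t) : J.IsFinitePath L a (X a) b (X b) X := by
  have hsub : Ioo a b ⊆ Ioo s t := Ioo_subset_Ioo ha hb
  have hsub' : uIcc a b ⊆ uIcc s t := by
    rw [uIcc_of_le hab, uIcc_of_le (by linarith)]; exact Icc_subset_Icc ha hb
  exact ⟨⟨hX.mem.1.mono hsub', fun τ hτ => hX.mem.2.1 τ (hsub hτ),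
    ae_restrict_of_ae_restrict_of_subset hsub hX.mem.2.2.1, rfl, rfl⟩, hX.integrable.mono_set hsub'⟩

theorem IsFinitePath.integral_add (hX : J.IsFinitePath L s y t x X) {a : ℝ} (ha : s ≤ a)
    (hb : a ≤ t) : (∫ τ in s..a, J.runningCost L X τ) + ∫ τ in a..t, J.runningCost L X τ =
      ∫ τ in s..t, J.runningCost L X τ :=
  intervalIntegral.integral_add_adjacent_intervals (hX.mono le_rfl ha hb).integrable
    (hX.mono ha hb le_rfl).integrable

theorem IsFinitePath.comp_add_right (h : ℝ) (hX : J.IsFinitePath L (s + h) y (t + h) x X) :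
    J.IsFinitePath L s y t x (fun τ => X (τ + h)) ∧
    ∫ τ in s..t, J.runningCost L (fun τ => X (τ + h)) τ =
      ∫ τ in (s + h)..(t + h), J.runningCost L X τ := by
  have hc : J.runningCost L (fun τ => X (τ + h)) = fun τ => J.runningCost L X (τ + h) := by
    ext τ
    rw [runningCost, runningCost, deriv_comp_add_const]
  refine ⟨⟨⟨hX.mem.1.comp_add_right h, fun τ hτ => hX.mem.2.1 _ ⟨?_, ?_⟩, ?_, hX.mem.2.2.2.1,
    hX.mem.2.2.2.2⟩, ?_⟩, ?_⟩
  · linarith [hτ.1]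
  · linarith [hτ.2]
  · have h1 := (ae_restrict_iff' measurableSet_Ioo).1 hX.mem.2.2.1
    rw [ae_restrict_iff' measurableSet_Ioo]
    have h2 := (measurePreserving_add_right volume h).quasiMeasurePreserving.ae h1
    filter_upwards [h2] with τ hτ hmem
    rw [deriv_comp_add_const]
    exact hτ ⟨by linarith [hmem.1], by linarith [hmem.2]⟩
  · rw [hc]
    have := hX.integrable.comp_add_right h
    simpa using this
  · rw [hc]; exact intervalIntegral.integral_comp_add_right _ _

theorem IsFinitePath.trans {a b c : ℝ} {y z x : Plane} {X Y : ℝ → Plane} (hab : a ≤ b)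
    (hbc : b ≤ c) (hz : z ∈ J.carrier) (hX : J.IsFinitePath L a y b z X)
    (hY : J.IsFinitePath L b z c x Y) :
    ∃ Z, J.IsFinitePath L a y c x Z ∧ ∫ τ in a..c, J.runningCost L Z τ =
      (∫ τ in a..b, J.runningCost L X τ) + ∫ τ in b..c, J.runningCost L Y τ := by
  have hXY : X b = Y b := hX.mem.2.2.2.2.trans hY.mem.2.2.2.1.symm
  let Z : ℝ → Plane := fun τ => if τ ≤ b then X τ else Y τ
  have hZX : ∀ τ < b, Z =ᶠ[𝓝 τ] X := fun τ hτ => by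
    filter_upwards [Iio_mem_nhds hτ] with σ hσ
    exact if_pos (le_of_lt hσ)
  have hZY : ∀ τ, b < τ → Z =ᶠ[𝓝 τ] Y := fun τ hτ => by
    filter_upwards [Ioi_mem_nhds hτ] with σ hσ
    exact if_neg (not_le.2 hσ)
  have e1 : EqOn (J.runningCost L Z) (J.runningCost L X) (uIoo a b) := fun τ hτ => by
    rw [uIoo_of_le hab] at hτ
    exact runningCost_congr (hZX τ hτ.2)
  have e2 : EqOn (J.runningCost L Z) (J.runningCost L Y) (uIoo b c) := fun τ hτ => by
    rw [uIoo_of_le hbc] at hτ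
    exact runningCost_congr (hZY τ hτ.1)
  have i1 := (intervalIntegrable_congr_uIoo (μ := volume) e1).2 hX.integrable
  have i2 := (intervalIntegrable_congr_uIoo (μ := volume) e2).2 hY.integrable
  refine ⟨Z, ⟨⟨hX.mem.1.ite_le hab hbc hY.mem.1 hXY, fun τ hτ => ?_, ?_, ?_, ?_⟩, i1.trans i2⟩, ?_⟩
  · rcases lt_trichotomy τ b with h | rfl | h
    · rw [(hZX τ h).eq_of_nhds]; exact hX.mem.2.1 τ ⟨hτ.1, h⟩
    · simpa [Z, hX.mem.2.2.2.2] using hz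
    · rw [(hZY τ h).eq_of_nhds]; exact hY.mem.2.1 τ ⟨h, hτ.2⟩
  · rw [ae_restrict_iff' measurableSet_Ioo]
    filter_upwards [(ae_restrict_iff' measurableSet_Ioo).1 hX.mem.2.2.1,
      (ae_restrict_iff' measurableSet_Ioo).1 hY.mem.2.2.1, Measure.ae_ne volume b]
      with τ h1 h2 h3 hτ
    rcases h3.lt_or_gt with h | h
    · rw [(hZX τ h).eq_of_nhds, (hZX τ h).deriv_eq]; exact h1 ⟨hτ.1, h⟩
    · rw [(hZY τ h).eq_of_nhds, (hZY τ h).deriv_eq]; exact h2 ⟨h, hτ.2⟩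
  · simpa [Z, hab] using hX.mem.2.2.2.1
  · rcases hbc.eq_or_lt with rfl | h
    · simpa [Z, hXY] using hY.mem.2.2.2.2
    · simpa [Z, h.not_ge] using hY.mem.2.2.2.2
  · rw [← intervalIntegral.integral_add_adjacent_intervals i1 i2,
      intervalIntegral.integral_congr_uIoo e1, intervalIntegral.integral_congr_uIoo e2]

-- The cost is bounded above rather than computed, since resting at the vertex costs the minimum of
-- all `L j 0`.
variable (J L) in
theorem exists_segment (i : Fin N) {t₀ t₁ r q : ℝ} (ht : t₀ ≤ t₁) (hr : 0 ≤ r)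
    (hr' : 0 ≤ r + q * (t₁ - t₀)) :
    ∃ X, J.IsFinitePath L t₀ (r • J.e i) t₁ ((r + q * (t₁ - t₀)) • J.e i) X ∧
      ∫ τ in t₀..t₁, J.runningCost L X τ ≤ (t₁ - t₀) * L i q := by
  let X : ℝ → Plane := fun τ => (r + q * (τ - t₀)) • J.e i
  have hd : ∀ τ, deriv X τ = q • J.e i := fun τ => by
    have : HasDerivAt X ((q * 1) • J.e i) τ :=
      ((((hasDerivAt_id τ).sub_const t₀).const_mul q).const_add r).smul_const _
    rw [this.deriv, mul_one]
  have hac : AbsolutelyContinuousOnInterval X t₀ t₁ := by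
    refine ContDiffOn.absolutelyContinuousOnInterval (ContDiff.contDiffOn ?_)
    fun_prop
  have hX0 : X t₀ = r • J.e i := by simp [X]
  by_cases h0 : r = 0 ∧ q = 0
  · obtain ⟨rfl, rfl⟩ := h0
    have hX : ∀ τ, X τ = 0 := fun τ => by simp [X]
    have hc : ∀ τ, J.runningCost L X τ = ⨅ j, L j 0 := fun τ => by
      have := J.lagrangian_zero L i le_rfl
      rwa [runningCost, hd, hX]
    have hc' : J.runningCost L X = fun _ => ⨅ j, L j 0 := funext hc
    refine ⟨X, ⟨⟨hac, fun τ _ => ?_, .of_forall fun τ => ?_, hX0, rfl⟩, ?_⟩, ?_⟩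
    · rw [hX]; simpa using J.smul_mem_carrier i le_rfl
    · rw [hd, hX]; exact Or.inr ⟨rfl, i, 0, le_rfl, rfl⟩
    · rw [hc']; simp
    · rw [hc', intervalIntegral.integral_const, smul_eq_mul]
      exact mul_le_mul_of_nonneg_left (ciInf_le (finite_range _).bddBelow i) (by linarith)
  · have hpos : ∀ τ ∈ Ioo t₀ t₁, 0 < r + q * (τ - t₀) := fun τ hτ => by
      obtain ⟨h1, h2⟩ := hτ
      rcases lt_trichotomy q 0 with hq | rfl | hq
      · nlinarith
      · have : r ≠ 0 := fun h => h0 ⟨h, rfl⟩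
        have := lt_of_le_of_ne hr this.symm
        simpa
      · nlinarith
    have hc : ∀ τ ∈ Ioo t₀ t₁, J.runningCost L X τ = L i q := fun τ hτ => by
      rw [runningCost, hd, J.lagrangian_of_branchStar L (hpos τ hτ)]
    have hc' : EqOn (J.runningCost L X) (fun _ => L i q) (uIoo t₀ t₁) := by
      rw [uIoo_of_le ht]; exact hc
    refine ⟨X, ⟨⟨hac, fun τ hτ => J.smul_mem_carrier i (hpos τ hτ).le, ?_, hX0, rfl⟩, ?_⟩, ?_⟩
    · rw [ae_restrict_iff' measurableSet_Ioo]
      refine .of_forall fun τ hτ => ?_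
      rw [hd]
      exact Or.inl ⟨i, J.smul_mem_branchStar i (hpos τ hτ), q, rfl⟩
    · rw [intervalIntegrable_congr_uIoo hc']; simp
    · rw [intervalIntegral.integral_congr_uIoo hc', intervalIntegral.integral_const, smul_eq_mul]

/-- At the vertex all coordinates are minimal, so their derivatives vanish and only `c ≤ L j 0` is
needed. On an open branch a single coordinate moves. -/
theorem le_runningCost {τ c : ℝ} {p : Fin N → ℝ} [Nonempty (Fin N)]
    (hd : ∀ i, DifferentiableAt ℝ (fun σ => J.coord i (X σ)) τ)
    (hJ : ∀ᶠ σ in 𝓝 τ, X σ ∈ J.carrier)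
    (hbr : ∀ i, 0 < J.coord i (X τ) → ∀ q, c + p i * q ≤ L i q)
    (h0 : X τ = 0 → ∀ j, c ≤ L j 0) :
    c + ∑ i, p i * deriv (fun σ => J.coord i (X σ)) τ ≤ J.runningCost L X τ := by
  have hX : X =ᶠ[𝓝 τ] fun σ => ∑ i, J.coord i (X σ) • J.e i := by
    filter_upwards [hJ] with σ hσ using J.eq_sum_coord hσ
  have hdX : deriv X τ = ∑ i, deriv (fun σ => J.coord i (X σ)) τ • J.e i := by
    rw [hX.deriv_eq]
    have h := HasDerivAt.fun_sum (u := Finset.univ)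
      (fun i _ => (hd i).hasDerivAt.smul_const (J.e i))
    exact h.deriv
  by_cases hx : X τ = 0
  · have hz : ∀ i, deriv (fun σ => J.coord i (X σ)) τ = 0 := fun i => by
      refine IsLocalMin.deriv_eq_zero (.of_forall fun σ => ?_)
      simp only [hx, coord_zero]
      exact J.coord_nonneg i _
    have hl := J.lagrangian_zero L (Classical.arbitrary (Fin N)) le_rfl
    simp only [hz, zero_smul, Finset.sum_const_zero] at hdX hl
    simp only [hz, mul_zero, Finset.sum_const_zero, add_zero, runningCost, hx, hdX, hl]
    exact le_ciInf (h0 hx)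
  · obtain ⟨i, hi⟩ := J.exists_coord_pos hJ.self_of_nhds hx
    have hz : ∀ j, j ≠ i → deriv (fun σ => J.coord j (X σ)) τ = 0 := fun j hj => by
      have : (fun σ => J.coord j (X σ)) =ᶠ[𝓝 τ] fun _ => 0 := by
        filter_upwards [hJ, (hd i).continuousAt.eventually (lt_mem_nhds hi)] with σ h1 h2
        exact J.coord_eq_zero_of_ne h1 hj h2
      rw [this.deriv_eq, deriv_const]
    rw [Finset.sum_eq_single i (fun j _ hj => by rw [hz j hj, zero_smul]) (by simp)] at hdX
    rw [Finset.sum_eq_single i (fun j _ hj => by rw [hz j hj, mul_zero]) (by simp)]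
    rw [runningCost, hdX]
    conv_rhs => rw [J.eq_coord_smul_of_coord_pos hJ.self_of_nhds hi]
    rw [J.lagrangian_of_branchStar L hi]
    exact hbr i hi _

/-- Lower bound of the cost of a trajectory by a linear calibration. -/
theorem IsFinitePath.calibration [Nonempty (Fin N)] (hX : J.IsFinitePath L s y t x X) (hst : s ≤ t)
    {c : ℝ} {p : Fin N → ℝ}
    (hbr : ∀ τ ∈ Ioo s t, ∀ i, 0 < J.coord i (X τ) → ∀ q, c + p i * q ≤ L i q)
    (h0 : ∀ τ ∈ Ioo s t, X τ = 0 → ∀ j, c ≤ L j 0) :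
    c * (t - s) + ∑ i, p i * (J.coord i x - J.coord i y) ≤ ∫ τ in s..t, J.runningCost L X τ := by
  obtain ⟨K, hK⟩ := J.exists_lipschitzWith_coord
  have hac : ∀ i, AbsolutelyContinuousOnInterval (fun σ => J.coord i (X σ)) s t := fun i =>
    (hK i).comp_absolutelyContinuousOnInterval hX.mem.1
  have hi : ∀ i, IntervalIntegrable (fun τ => p i * deriv (fun σ => J.coord i (X σ)) τ)
      volume s t := fun i => (hac i).intervalIntegrable_deriv.const_mul _
  have hsum : IntervalIntegrable (fun τ => ∑ i, p i * deriv (fun σ => J.coord i (X σ)) τ)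
      volume s t := by
    convert! IntervalIntegrable.sum Finset.univ (fun i _ => hi i) using 1
    ext τ
    simp
  have e : ∫ τ in s..t, (c + ∑ i, p i * deriv (fun σ => J.coord i (X σ)) τ) =
      c * (t - s) + ∑ i, p i * (J.coord i x - J.coord i y) := by
    rw [intervalIntegral.integral_add (by simp) hsum, intervalIntegral.integral_const,
      intervalIntegral.integral_finsetSum (fun i _ => hi i), smul_eq_mul, mul_comm]
    congr 1
    refine Finset.sum_congr rfl fun i _ => ?_
    rw [intervalIntegral.integral_const_mul, (hac i).integral_deriv_eq_sub, hX.mem.2.2.2.1,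
      hX.mem.2.2.2.2]
  rw [← e]
  refine intervalIntegral.integral_mono_ae_restrict hst
    ((by simp : IntervalIntegrable (fun _ => c) volume s t).add hsum) hX.integrable ?_
  rw [EventuallyLE, ae_restrict_iff' measurableSet_Icc]
  have hdiff : ∀ᵐ τ : ℝ, ∀ i, τ ∈ uIcc s t → DifferentiableAt ℝ (fun σ => J.coord i (X σ)) τ :=
    ae_all_iff.2 fun i => (hac i).ae_differentiableAt
  filter_upwards [hdiff, Measure.ae_ne volume s, Measure.ae_ne volume t] with τ h1 h2 h3 h4
  have hτ : τ ∈ Ioo s t := ⟨lt_of_le_of_ne h4.1 h2.symm, lt_of_le_of_ne h4.2 h3⟩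
  refine le_runningCost (fun i => h1 i (uIcc_of_le hst ▸ h4)) ?_ (hbr τ hτ) (h0 τ hτ)
  filter_upwards [Ioo_mem_nhds hτ.1 hτ.2] with σ hσ using hX.mem.2.1 σ hσ

end Junction

end JunctionHJ

end

/-! ### The value function: finiteness, dynamic programming, Lipschitz continuity. -/

noncomputable section

namespace JunctionHJ

namespace Junction

variable {N : ℕ}

/-- The standing assumptions on the Lagrangians and on the initial datum. -/
structure IsAdmissibleData (J : Junction N) (L : Fin N → ℝ → ℝ) (u₀ : Plane → ℝ) : Prop where
  lagrangian : ∀ i, IsStronglyConvexLagrangian (L i)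
  lipschitz : ∃ K : NNReal, LipschitzOnWith K u₀ J.carrier
  nonempty : Nonempty (Fin N)

/-- The value function as a real-valued function. -/
def value (J : Junction N) (L : Fin N → ℝ → ℝ) (u₀ : Plane → ℝ) (t : ℝ) (x : Plane) : ℝ :=
  (J.valueFunction L u₀ t x).toReal

variable {J : Junction N} {L : Fin N → ℝ → ℝ} {u₀ : Plane → ℝ}

theorem exists_superlinear (hL : ∀ i, IsStronglyConvexLagrangian (L i)) (K : ℝ) :
    ∃ A : ℝ, 0 ≤ A ∧ ∀ i q, K * |q| - A ≤ L i q := by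
  choose A hA using fun i => (hL i).superlinear K
  refine ⟨∑ i, |A i|, Finset.sum_nonneg fun i _ => abs_nonneg _, fun i q => ?_⟩
  have h1 : |A i| ≤ ∑ i, |A i| :=
    Finset.single_le_sum (f := fun i => |A i|) (fun i _ => abs_nonneg _) (Finset.mem_univ i)
  linarith [hA i q, le_abs_self (A i)]

theorem IsFinitePath.mem_carrier {s t : ℝ} {y x : Plane} {X : ℝ → Plane}
    (hX : J.IsFinitePath L s y t x X) (hy : y ∈ J.carrier) (hx : x ∈ J.carrier) {τ : ℝ}
    (h : τ ∈ Icc s t) : X τ ∈ J.carrier := by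
  rcases h.1.eq_or_lt with rfl | h1
  · rwa [hX.mem.2.2.2.1]
  rcases h.2.eq_or_lt with rfl | h2
  · rwa [hX.mem.2.2.2.2]
  exact hX.mem.2.1 τ ⟨h1, h2⟩

theorem IsFinitePath.action_eq {s t : ℝ} {y x : Plane} {X : ℝ → Plane}
    (hX : J.IsFinitePath L s y t x X) :
    J.action L s t X = ((∫ τ in s..t, J.runningCost L X τ : ℝ) : EReal) := by
  have h : IntervalIntegrable (fun τ => J.lagrangian L (X τ) (deriv X τ)) volume s t :=
    hX.integrable
  rw [action, if_pos h]
  rfl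

theorem norm_sub_le_sum_coord {x y : Plane} (hx : x ∈ J.carrier) (hy : y ∈ J.carrier) :
    ‖x - y‖ ≤ ∑ i, |J.coord i x - J.coord i y| := by
  have e : x - y = ∑ i, (J.coord i x - J.coord i y) • J.e i := by
    conv_lhs => rw [J.eq_sum_coord hx, J.eq_sum_coord hy]
    simp [sub_smul]
  rw [e]
  refine (norm_sum_le _ _).trans_eq (Finset.sum_congr rfl fun i _ => ?_)
  rw [norm_smul, J.norm_e, mul_one, Real.norm_eq_abs]

theorem valueFunction_ne_top {t : ℝ} (ht : 0 ≤ t) {x : Plane} (hx : x ∈ J.carrier) :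
    J.valueFunction L u₀ t x ≠ ⊤ := by
  obtain ⟨i, r, hr, rfl⟩ := J.mem_carrier.1 hx
  obtain ⟨X, hX, -⟩ := J.exists_segment L i (q := 0) ht hr (by simpa using hr)
  rw [zero_mul, add_zero] at hX
  refine ne_top_of_le_ne_top (b := ((u₀ (r • J.e i) : ℝ) : EReal) + J.action L 0 t X) ?_
    ((iInf₂_le _ hx).trans (iInf₂_le X hX.mem))
  rw [hX.action_eq, ← EReal.coe_add]
  exact EReal.coe_ne_top _

namespace IsAdmissibleData

variable (hD : J.IsAdmissibleData L u₀)
include hD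

/-- Calibration with slopes `±K`, the sign being that of the increment of each coordinate, so that
the increments add up to at least the distance. -/
theorem exists_le_cost {K : ℝ} (hK : 0 ≤ K) :
    ∃ A : ℝ, 0 ≤ A ∧ ∀ s t y x X, s ≤ t → y ∈ J.carrier → x ∈ J.carrier →
      J.IsFinitePath L s y t x X →
      K * ‖x - y‖ - A * (t - s) ≤ ∫ τ in s..t, J.runningCost L X τ := by
  have := hD.nonempty
  obtain ⟨A, hA0, hA⟩ := exists_superlinear hD.lagrangian K
  refine ⟨A, hA0, fun s t y x X hst hy hx hX => ?_⟩
  have h := hX.calibration hst (c := -A)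
    (p := fun i => if 0 ≤ J.coord i x - J.coord i y then K else -K)
    (fun τ _ i _ q => ?_) (fun τ _ _ j => by simpa using hA j 0)
  · have e : ∑ i, (if 0 ≤ J.coord i x - J.coord i y then K else -K) *
        (J.coord i x - J.coord i y) = K * ∑ i, |J.coord i x - J.coord i y| := by
      rw [Finset.mul_sum]
      refine Finset.sum_congr rfl fun i _ => ?_
      split_ifs with h
      · rw [abs_of_nonneg h]
      · rw [abs_of_neg (not_le.1 h)]; ring
    rw [e] at h
    have := mul_le_mul_of_nonneg_left (norm_sub_le_sum_coord hx hy) hK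
    linarith
  · have h1 := hA i q
    have h2 : (if 0 ≤ J.coord i x - J.coord i y then K else -K) * q ≤ K * |q| := by
      split_ifs
      · exact mul_le_mul_of_nonneg_left (le_abs_self q) hK
      · rw [neg_mul, ← mul_neg]; exact mul_le_mul_of_nonneg_left (neg_le_abs q) hK
    linarith

/-- The cost, taken with growth rate equal to the Lipschitz constant of `u₀`, pays for the variation
of `u₀` between the end points. -/
theorem exists_sub_le :
    ∃ A : ℝ, 0 ≤ A ∧ ∀ s t y x X, s ≤ t → y ∈ J.carrier → x ∈ J.carrier →
      J.IsFinitePath L s y t x X →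
      u₀ x - A * (t - s) ≤ u₀ y + ∫ τ in s..t, J.runningCost L X τ := by
  obtain ⟨K, hK⟩ := hD.lipschitz
  obtain ⟨A, hA0, hA⟩ := hD.exists_le_cost K.2
  refine ⟨A, hA0, fun s t y x X hst hy hx hX => ?_⟩
  have h1 := hA s t y x X hst hy hx hX
  have h2 := hK.dist_le_mul x hx y hy
  rw [Real.dist_eq, dist_eq_norm] at h2
  have := le_abs_self (u₀ x - u₀ y)
  have h3 : (K : ℝ) = K.1 := rfl
  rw [h3] at h2
  linarith

theorem exists_sub_le_valueFunction : ∃ A : ℝ, 0 ≤ A ∧ ∀ t, 0 ≤ t → ∀ x ∈ J.carrier,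
    ((u₀ x - A * t : ℝ) : EReal) ≤ J.valueFunction L u₀ t x := by
  obtain ⟨A, hA0, hA⟩ := hD.exists_sub_le
  refine ⟨A, hA0, fun t ht x hx => le_iInf₂ fun y hy => le_iInf₂ fun X hX => ?_⟩
  rw [action]
  split_ifs with h
  · rw [← EReal.coe_add, EReal.coe_le_coe_iff]
    have := hA 0 t y x X ht hy hx ⟨hX, h⟩
    rwa [sub_zero] at this
  · rw [EReal.coe_add_top]; exact le_top

theorem coe_value {t : ℝ} (ht : 0 ≤ t) {x : Plane} (hx : x ∈ J.carrier) :
    ((J.value L u₀ t x : ℝ) : EReal) = J.valueFunction L u₀ t x := by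
  obtain ⟨A, -, hA⟩ := hD.exists_sub_le_valueFunction
  refine EReal.coe_toReal (valueFunction_ne_top ht hx) fun h => ?_
  have := hA t ht x hx
  rw [h, le_bot_iff] at this
  exact EReal.coe_ne_bot _ this

theorem value_le {t : ℝ} (ht : 0 ≤ t) {x y : Plane} (hx : x ∈ J.carrier) (hy : y ∈ J.carrier)
    {X : ℝ → Plane} (hX : J.IsFinitePath L 0 y t x X) :
    J.value L u₀ t x ≤ u₀ y + ∫ τ in 0..t, J.runningCost L X τ := by
  rw [← EReal.coe_le_coe_iff, hD.coe_value ht hx]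
  refine ((iInf₂_le y hy).trans (iInf₂_le X hX.mem)).trans_eq ?_
  rw [hX.action_eq, ← EReal.coe_add]

theorem exists_lt_value_add {t : ℝ} (ht : 0 ≤ t) {x : Plane} (hx : x ∈ J.carrier) {ε : ℝ}
    (hε : 0 < ε) : ∃ y ∈ J.carrier, ∃ X, J.IsFinitePath L 0 y t x X ∧
      u₀ y + ∫ τ in 0..t, J.runningCost L X τ < J.value L u₀ t x + ε := by
  have h : J.valueFunction L u₀ t x < ((J.value L u₀ t x + ε : ℝ) : EReal) := by
    rw [← hD.coe_value ht hx, EReal.coe_lt_coe_iff]; linarith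
  simp only [valueFunction, iInf_lt_iff] at h
  obtain ⟨y, hy, X, hX, h⟩ := h
  rw [action] at h
  split_ifs at h with hi
  · rw [← EReal.coe_add, EReal.coe_lt_coe_iff] at h
    exact ⟨y, hy, X, ⟨hX, hi⟩, h⟩
  · rw [EReal.coe_add_top] at h
    exact absurd h (not_lt.2 le_top)

theorem exists_sub_le_value : ∃ A : ℝ, 0 ≤ A ∧ ∀ t, 0 ≤ t → ∀ x ∈ J.carrier,
    u₀ x - A * t ≤ J.value L u₀ t x := by
  obtain ⟨A, hA0, hA⟩ := hD.exists_sub_le_valueFunction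
  refine ⟨A, hA0, fun t ht x hx => ?_⟩
  rw [← EReal.coe_le_coe_iff, hD.coe_value ht hx]
  exact hA t ht x hx

/-- An almost optimal trajectory continued by a segment is a competitor: the suboptimality principle
for the value function. -/
theorem value_segment_le (i : Fin N) {t h r q : ℝ} (ht : 0 ≤ t) (hh : 0 ≤ h) (hr : 0 ≤ r)
    (hr' : 0 ≤ r + q * h) :
    J.value L u₀ (t + h) ((r + q * h) • J.e i) ≤ J.value L u₀ t (r • J.e i) + h * L i q := by
  refine le_of_forall_pos_le_add fun ε hε => ?_
  obtain ⟨y, hy, X, hX, h1⟩ := hD.exists_lt_value_add ht (J.smul_mem_carrier i hr) hε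
  obtain ⟨Y, hY, h2⟩ := J.exists_segment L i (t₀ := t) (t₁ := t + h) (q := q) (by linarith) hr
    (by simpa using hr')
  obtain ⟨Z, hZ, h3⟩ := hX.trans ht (by linarith) (J.smul_mem_carrier i hr) hY
  rw [add_sub_cancel_left] at hZ h2
  have := hD.value_le (by linarith) (J.smul_mem_carrier i hr') hy hZ
  linarith

/-- The initial part of a trajectory competes for the value at the intermediate point. For an almost
optimal trajectory this is the superoptimality half of dynamic programming. -/
theorem value_add_integral_le {t s : ℝ} (hs : 0 ≤ s) (hst : s ≤ t) {x y : Plane}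
    (hx : x ∈ J.carrier) (hy : y ∈ J.carrier) {X : ℝ → Plane} (hX : J.IsFinitePath L 0 y t x X) :
    J.value L u₀ s (X s) + ∫ τ in s..t, J.runningCost L X τ ≤
      u₀ y + ∫ τ in 0..t, J.runningCost L X τ := by
  have h1 := hX.mono le_rfl hs hst
  rw [hX.mem.2.2.2.1] at h1
  have := hD.value_le hs (hX.mem_carrier hy hx ⟨hs, hst⟩) hy h1
  linarith [hX.integral_add hs hst]

/-- The upper bound waits at `x`. The lower bound deletes the first `h` units of time of an almost
optimal trajectory and shifts the rest; by `exists_sub_le` the deleted part costs at least `u₀ (X h)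
- u₀ y - A * h`. -/
theorem exists_abs_time_le : ∃ C : ℝ, 0 ≤ C ∧ ∀ s t, 0 ≤ s → 0 ≤ t → ∀ x ∈ J.carrier,
    |J.value L u₀ s x - J.value L u₀ t x| ≤ C * |s - t| := by
  obtain ⟨A, hA0, hA⟩ := hD.exists_sub_le
  have hB : ∀ i, |L i 0| ≤ ∑ i, |L i 0| := fun i =>
    Finset.single_le_sum (f := fun i => |L i 0|) (fun i _ => abs_nonneg _) (Finset.mem_univ i)
  set B := ∑ i, |L i 0|
  have hB0 : 0 ≤ B := Finset.sum_nonneg fun i _ => abs_nonneg _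
  have key : ∀ t h, 0 ≤ t → 0 ≤ h → ∀ x ∈ J.carrier,
      |J.value L u₀ (t + h) x - J.value L u₀ t x| ≤ (A + B) * h := fun t h ht hh x hx => by
    refine abs_le.2 ⟨?_, ?_⟩
    · refine le_of_forall_pos_le_add fun ε hε => ?_
      obtain ⟨y, hy, X, hX, h1⟩ := hD.exists_lt_value_add (add_nonneg ht hh) hx hε
      have hXh := hX.mem_carrier hy hx (τ := h) ⟨hh, by linarith⟩
      have h2 := hX.mono le_rfl hh (by linarith : h ≤ t + h)
      rw [hX.mem.2.2.2.1] at h2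
      have h3 := hX.mono hh (by linarith : h ≤ t + h) le_rfl
      rw [hX.mem.2.2.2.2] at h3
      have h4 := hA 0 h y (X h) X hh hy hXh h2
      have h5 := IsFinitePath.comp_add_right (s := 0) (t := t) h (by rwa [zero_add])
      have h6 := hD.value_le ht hx hXh h5.1
      rw [h5.2, zero_add] at h6
      have h7 := hX.integral_add hh (by linarith : h ≤ t + h)
      have : 0 ≤ B * h := mul_nonneg hB0 hh
      linarith
    · obtain ⟨i, r, hr, rfl⟩ := J.mem_carrier.1 hx
      have := hD.value_segment_le i (q := 0) ht hh hr (by simpa using hr)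
      rw [zero_mul, add_zero] at this
      have h1 : h * L i 0 ≤ h * B :=
        mul_le_mul_of_nonneg_left ((le_abs_self _).trans (hB i)) hh
      have : 0 ≤ A * h := mul_nonneg hA0 hh
      linarith
  refine ⟨A + B, by linarith, fun s t hs ht x hx => ?_⟩
  rcases le_total s t with h | h
  · have := key s (t - s) hs (by linarith) x hx
    rw [add_sub_cancel] at this
    rwa [abs_sub_comm, abs_sub_comm s, abs_of_nonneg (by linarith : 0 ≤ t - s)]
  · have := key t (s - t) ht (by linarith) x hx
    rw [add_sub_cancel] at this
    rwa [abs_of_nonneg (by linarith : 0 ≤ s - t)]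

/-- Travelling at unit speed joins the two points in time `|a - b|`, and regularity in time
compensates the delay. -/
theorem exists_abs_branch_le : ∃ C : ℝ, 0 ≤ C ∧ ∀ t, 0 ≤ t → ∀ i a b, 0 ≤ a → 0 ≤ b →
    |J.value L u₀ t (a • J.e i) - J.value L u₀ t (b • J.e i)| ≤ C * |a - b| := by
  obtain ⟨C, hC0, hC⟩ := hD.exists_abs_time_le
  have hB : ∀ i, |L i 1| + |L i (-1)| ≤ ∑ i, (|L i 1| + |L i (-1)|) := fun i =>
    Finset.single_le_sum (f := fun i => |L i 1| + |L i (-1)|)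
      (fun i _ => by positivity) (Finset.mem_univ i)
  set B := ∑ i, (|L i 1| + |L i (-1)|)
  have hB0 : 0 ≤ B := Finset.sum_nonneg fun i _ => by positivity
  have key : ∀ t, 0 ≤ t → ∀ i a b, 0 ≤ a → 0 ≤ b →
      J.value L u₀ t (a • J.e i) - J.value L u₀ t (b • J.e i) ≤ (C + B) * |a - b| := by
    intro t ht i a b ha hb
    have h1 := hC (t + |a - b|) t (by positivity) ht _ (J.smul_mem_carrier i ha)
    rw [add_sub_cancel_left, abs_abs] at h1
    have h2 := (abs_le.1 h1).1
    have hBi := hB i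
    rcases le_total b a with hab | hab
    · rw [abs_of_nonneg (by linarith : 0 ≤ a - b)] at *
      have h3 := hD.value_segment_le i (t := t) (h := a - b) (r := b) (q := 1) ht (by linarith) hb
        (by linarith)
      rw [one_mul, add_sub_cancel] at h3
      have h4 : (a - b) * L i 1 ≤ (a - b) * B :=
        mul_le_mul_of_nonneg_left (by linarith [le_abs_self (L i 1), abs_nonneg (L i (-1))])
          (by linarith)
      linarith
    · rw [abs_of_nonpos (by linarith : a - b ≤ 0)] at *
      have h3 := hD.value_segment_le i (t := t) (h := -(a - b)) (r := b) (q := -1) ht (by linarith)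
        hb (by linarith)
      rw [show b + -1 * -(a - b) = a by ring] at h3
      have h4 : -(a - b) * L i (-1) ≤ -(a - b) * B :=
        mul_le_mul_of_nonneg_left (by linarith [le_abs_self (L i (-1)), abs_nonneg (L i 1)])
          (by linarith)
      linarith
  refine ⟨C + B, by linarith, fun t ht i a b ha hb => abs_sub_le_iff.2 ⟨key t ht i a b ha hb, ?_⟩⟩
  rw [abs_sub_comm]
  exact key t ht i b a hb ha

/-- The value function is Lipschitz continuous in time and space. -/
theorem exists_abs_value_le : ∃ C : ℝ, 0 ≤ C ∧ ∀ s t, 0 ≤ s → 0 ≤ t → ∀ x ∈ J.carrier,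
    ∀ y ∈ J.carrier, |J.value L u₀ s x - J.value L u₀ t y| ≤ C * (|s - t| + ‖x - y‖) := by
  obtain ⟨C, hC0, hC⟩ := hD.exists_abs_time_le
  obtain ⟨B, hB0, hB⟩ := hD.exists_abs_branch_le
  obtain ⟨K, hK⟩ := J.exists_lipschitzWith_coord
  have hK' : ∀ i x y, |J.coord i x - J.coord i y| ≤ K * ‖x - y‖ := fun i x y => by
    simpa [Real.dist_eq, dist_eq_norm] using (hK i).dist_le_mul x y
  have key : ∀ t, 0 ≤ t → ∀ x ∈ J.carrier, ∀ y ∈ J.carrier,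
      |J.value L u₀ t x - J.value L u₀ t y| ≤ B * (2 * K) * ‖x - y‖ := by
    intro t ht x hx y hy
    obtain ⟨i, a, ha, rfl⟩ := J.mem_carrier.1 hx
    obtain ⟨j, b, hb, rfl⟩ := J.mem_carrier.1 hy
    have hi := hK' i (a • J.e i) (b • J.e j)
    rw [J.coord_smul_self i ha] at hi
    have hn : 0 ≤ K * ‖a • J.e i - b • J.e j‖ := by positivity
    by_cases hij : i = j
    · subst hij
      rw [J.coord_smul_self i hb] at hi
      refine (hB t ht i a b ha hb).trans ?_
      rw [mul_assoc, mul_assoc]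
      exact mul_le_mul_of_nonneg_left (by linarith) hB0
    -- On different branches the comparison goes through the vertex: each coordinate vanishes at the
    -- other point, so `a` and `b` are both at most `K` times the distance.
    · have hj := hK' j (a • J.e i) (b • J.e j)
      rw [J.coord_smul_self j hb, J.coord_smul_of_ne (Ne.symm hij) ha, zero_sub, abs_neg,
        abs_of_nonneg hb] at hj
      rw [J.coord_smul_of_ne hij hb, sub_zero, abs_of_nonneg ha] at hi
      have h1 := hB t ht i a 0 ha le_rfl
      have h2 := hB t ht j 0 b le_rfl hb
      simp only [zero_smul, sub_zero, zero_sub, abs_neg, abs_of_nonneg ha, abs_of_nonneg hb]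
        at h1 h2
      refine (abs_sub_le _ (J.value L u₀ t 0) _).trans ((add_le_add h1 h2).trans ?_)
      rw [← mul_add, mul_assoc, mul_assoc]
      exact mul_le_mul_of_nonneg_left (by linarith) hB0
  refine ⟨C + B * (2 * K), by positivity, fun s t hs ht x hx y hy => ?_⟩
  refine (abs_sub_le _ (J.value L u₀ t x) _).trans
    ((add_le_add (hC s t hs ht x hx) (key t ht x hx y hy)).trans ?_)
  have h1 : 0 ≤ C * ‖x - y‖ := by positivity
  have h2 : 0 ≤ B * (2 * K) * |s - t| := by positivity
  linarith

theorem value_zero {x : Plane} (hx : x ∈ J.carrier) : J.value L u₀ 0 x = u₀ x := by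
  obtain ⟨A, -, hA⟩ := hD.exists_sub_le_value
  refine le_antisymm ?_ (by simpa using hA 0 le_rfl x hx)
  obtain ⟨i, r, hr, rfl⟩ := J.mem_carrier.1 hx
  obtain ⟨X, hX, -⟩ := J.exists_segment L i (t₀ := 0) (t₁ := 0) (q := 0) le_rfl hr (by simpa)
  rw [zero_mul, add_zero] at hX
  simpa using hD.value_le le_rfl hx hx hX

theorem continuousOn_value :
    ContinuousOn (Function.uncurry (J.value L u₀)) (Ici 0 ×ˢ J.carrier) := by
  obtain ⟨C, hC0, hC⟩ := hD.exists_abs_value_le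
  have : LipschitzOnWith (2 * C).toNNReal (Function.uncurry (J.value L u₀))
      (Ici 0 ×ˢ J.carrier) := by
    refine LipschitzOnWith.of_dist_le_mul fun p hp q hq => ?_
    rw [Real.coe_toNNReal _ (by positivity), Real.dist_eq]
    refine (hC p.1 q.1 hp.1 hq.1 p.2 hp.2 q.2 hq.2).trans ?_
    rw [Prod.dist_eq, ← Real.dist_eq, ← dist_eq_norm]
    have h1 := le_max_left (dist p.1 q.1) (dist p.2 q.2)
    have h2 := le_max_right (dist p.1 q.1) (dist p.2 q.2)
    nlinarith
  exact this.continuousOn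

end IsAdmissibleData

end Junction

end JunctionHJ

end

/-! ### The value function solves the equation. -/

noncomputable section

namespace JunctionHJ

namespace Junction

namespace IsAdmissibleData

variable {N : ℕ} {J : Junction N} {L : Fin N → ℝ → ℝ} {u₀ : Plane → ℝ}
  (hD : J.IsAdmissibleData L u₀)
include hD

/-- The touching point is reached by a short segment of velocity `q` started at coordinate `r - q *
h`, and the suboptimality principle is expanded to first order in `h`. The condition on `q` keeps
this starting point on the branch. -/
theorem deriv_add_mul_le_of_value_le {T : ℝ} {φ : ℝ → Plane → ℝ} (hφ : J.IsC1Star T φ) {t : ℝ}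
    (i : Fin N) {r : ℝ} (hr : 0 ≤ r) (ht : t ∈ Ioo 0 T) {ρ : ℝ} (hρ : 0 < ρ)
    (hle : ∀ s y, (s, y) ∈ Metric.ball (t, r • J.e i) ρ ∩ J.cylinder T →
      J.value L u₀ s y ≤ φ s y)
    (heq : J.value L u₀ t (r • J.e i) = φ t (r • J.e i)) {q : ℝ} (hq : 0 < r ∨ q ≤ 0) :
    timeDeriv φ t (r • J.e i) + J.spaceDeriv φ i t r * q ≤ L i q := by
  by_contra! hcon
  set a := timeDeriv φ t (r • J.e i)
  set b := J.spaceDeriv φ i t r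
  have hq1 : 0 < 1 + |q| := by positivity
  -- With this `δ`, the expansion error `δ * (h + h * |q|)` is half of the supposed gap times `h`.
  obtain ⟨η, hη, hφη⟩ := hφ.exists_abs_le ht i hr
    (δ := (a + b * q - L i q) / (2 * (1 + |q|))) (div_pos (by linarith) (by positivity))
  obtain ⟨m, hm0, hmr⟩ : ∃ m : ℝ, 0 < m ∧ ∀ h, 0 ≤ h → h * (1 + |q|) < m → 0 ≤ r + -q * h := by
    by_cases hq0 : q ≤ 0
    · exact ⟨1, one_pos, fun h hh _ => by nlinarith⟩
    · refine ⟨r, by tauto, fun h hh hm => ?_⟩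
      have := le_abs_self q
      nlinarith
  set M := min (min η ρ) (min t m) with hM
  have hM0 : 0 < M := lt_min (lt_min hη hρ) (lt_min ht.1 hm0)
  obtain ⟨h, hh0, hhM⟩ : ∃ h : ℝ, 0 < h ∧ h * (1 + |q|) < M := by
    refine ⟨M / (2 * (1 + |q|)), by positivity, ?_⟩
    rw [show M / (2 * (1 + |q|)) * (1 + |q|) = M / 2 by field_simp]
    linarith
  have hη' : h * (1 + |q|) < η := hhM.trans_le ((min_le_left _ _).trans (min_le_left _ _))
  have hρ' : h * (1 + |q|) < ρ := hhM.trans_le ((min_le_left _ _).trans (min_le_right _ _))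
  have ht' : h * (1 + |q|) < t := hhM.trans_le ((min_le_right _ _).trans (min_le_left _ _))
  have hm' : h * (1 + |q|) < m := hhM.trans_le ((min_le_right _ _).trans (min_le_right _ _))
  have hr' := hmr h hh0.le hm'
  have hqh : 0 ≤ h * |q| := by positivity
  have hqa : |-q * h| = h * |q| := by rw [abs_mul, abs_neg, abs_of_pos hh0, mul_comm]
  have hth : |t - h - t| = h := by rw [sub_sub_cancel_left, abs_neg, abs_of_pos hh0]
  have h1 := hφη (t - h) (r + -q * h) (by rw [hth]; linarith)
    (by rw [add_sub_cancel_left, hqa]; linarith) hr'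
  rw [hth, add_sub_cancel_left, hqa, sub_sub_cancel_left] at h1
  have h2 := hle (t - h) ((r + -q * h) • J.e i) ⟨?_, ⟨by linarith, by linarith [ht.2]⟩,
    J.smul_mem_carrier i hr'⟩
  · have h3 := hD.value_segment_le i (t := t - h) (h := h) (q := q) (by linarith) hh0.le hr'
      (by linarith)
    rw [sub_add_cancel, show r + -q * h + q * h = r by ring, heq] at h3
    have h4 := (abs_le.1 h1).2
    have h5 : (a + b * q - L i q) / (2 * (1 + |q|)) * (h + h * |q|) =
        (a + b * q - L i q) / 2 * h := by field_simp
    nlinarith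
  · rw [Metric.mem_ball, Prod.dist_eq, Real.dist_eq, dist_eq_norm, ← sub_smul,
      add_sub_cancel_left, norm_smul, J.norm_e, mul_one, Real.norm_eq_abs, hqa, hth]
    exact max_lt (by linarith) (by linarith)

theorem isSubsolution_value (T : ℝ) : J.IsSubsolution L T (J.value L u₀) where
  usc := (hD.continuousOn_value.mono (prod_mono Ico_subset_Ici_self le_rfl)).upperSemicontinuousOn
  touch φ hφ t x htx hle heq := by
    obtain ⟨ρ, hρ, hle⟩ := hle
    have := hD.nonempty
    refine ⟨fun i r hr hx => ?_, fun hx => ?_⟩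
    · subst hx
      have : hamiltonian (L i) (J.spaceDeriv φ i t r) ≤ - timeDeriv φ t (r • J.e i) :=
        hamiltonian_le fun q => by
          linarith [hD.deriv_add_mul_le_of_value_le hφ i hr.le htx.1 hρ hle heq (q := q) (.inl hr)]
      linarith
    · subst hx
      have : ⨆ i, hamiltonianMinus (L i) (J.spaceDeriv φ i t 0) ≤ - timeDeriv φ t 0 :=
        ciSup_le fun i => hamiltonianMinus_le fun q hq => by
          have := hD.deriv_add_mul_le_of_value_le hφ i (r := 0) le_rfl htx.1 hρ
            (by simpa using hle) (by simpa using heq) (q := q) (.inr hq)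
          rw [zero_smul] at this
          linarith
      linarith

/-- Almost optimal trajectories have bounded mean speed near their end: the cost grows at rate `C +
1` in the displacement, the value function only at rate `C`. -/
theorem exists_norm_sub_le : ∃ C : ℝ, 0 ≤ C ∧ ∀ t x y X ε, x ∈ J.carrier → y ∈ J.carrier →
    J.IsFinitePath L 0 y t x X →
    u₀ y + ∫ τ in 0..t, J.runningCost L X τ < J.value L u₀ t x + ε →
    ∀ τ ∈ Icc 0 t, ‖x - X τ‖ ≤ C * (t - τ) + ε := by
  obtain ⟨C, hC0, hC⟩ := hD.exists_abs_value_le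
  obtain ⟨A, hA0, hA⟩ := hD.exists_le_cost (K := C + 1) (by linarith)
  refine ⟨A + C, by linarith, fun t x y X ε hx hy hX hε τ hτ => ?_⟩
  have hXτ := hX.mem_carrier hy hx hτ
  have h1 := hX.mono hτ.1 hτ.2 le_rfl
  rw [hX.mem.2.2.2.2] at h1
  have h2 := hA τ t (X τ) x X hτ.2 hXτ hx h1
  have h3 := hD.value_add_integral_le hτ.1 hτ.2 hx hy hX
  have h4 := (abs_le.1 (hC t τ (hτ.1.trans hτ.2) hτ.1 x hx (X τ) hXτ)).2
  rw [abs_of_nonneg (by linarith [hτ.2] : 0 ≤ t - τ)] at h4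
  linarith

/-- The common part of the supersolution inequality on the branches and at the junction point:
almost optimal trajectories are compared with a linear calibration. -/
theorem not_forall_calibration {T : ℝ} {φ : ℝ → Plane → ℝ} {t : ℝ} {x : Plane}
    (htx : (t, x) ∈ J.cylinder T) {ρ : ℝ} (hρ : 0 < ρ)
    (hle : ∀ s y, (s, y) ∈ Metric.ball (t, x) ρ ∩ J.cylinder T → φ s y ≤ J.value L u₀ s y)
    (heq : J.value L u₀ t x = φ t x) {θ a R : ℝ} (hθ : 0 < θ) (hR : 0 < R) {p : Fin N → ℝ}
    (hexp : ∀ δ > 0, ∃ η > 0, ∀ s, ∀ y ∈ J.carrier, |s - t| < η → ‖x - y‖ < η →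
      φ t x + a * (s - t) + ∑ i, p i * (J.coord i y - J.coord i x) - δ * (|s - t| + ‖x - y‖) ≤
        φ s y)
    (hbr : ∀ y ∈ J.carrier, ‖x - y‖ < R → ∀ i, 0 < J.coord i y →
      ∀ q, a + 2 * θ + p i * q ≤ L i q)
    (h0 : ‖x‖ < R → ∀ j, a + 2 * θ ≤ L j 0) : False := by
  have := hD.nonempty
  obtain ⟨ht, hx⟩ : t ∈ Ioo 0 T ∧ x ∈ J.carrier := htx
  obtain ⟨C, hC0, hC⟩ := hD.exists_norm_sub_le
  -- On `[t - h, t]` a trajectory that is optimal up to `h * θ` stays within `h * (C + θ)` of `x`,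
  -- so this `δ` makes the expansion error at most `θ / 2 * h`.
  obtain ⟨η, hη, hφη⟩ := hexp (θ / (2 * (1 + C + θ))) (by positivity)
  set M := min (min η ρ) (min t R) with hM
  have hM0 : 0 < M := lt_min (lt_min hη hρ) (lt_min ht.1 hR)
  obtain ⟨h, hh0, hhM⟩ : ∃ h : ℝ, 0 < h ∧ h * (1 + C + θ) < M := by
    refine ⟨M / (2 * (1 + C + θ)), by positivity, ?_⟩
    rw [show M / (2 * (1 + C + θ)) * (1 + C + θ) = M / 2 by field_simp]
    linarith
  have hη' : h * (1 + C + θ) < η := hhM.trans_le ((min_le_left _ _).trans (min_le_left _ _))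
  have hρ' : h * (1 + C + θ) < ρ := hhM.trans_le ((min_le_left _ _).trans (min_le_right _ _))
  have ht' : h * (1 + C + θ) < t := hhM.trans_le ((min_le_right _ _).trans (min_le_left _ _))
  have hR' : h * (1 + C + θ) < R := hhM.trans_le ((min_le_right _ _).trans (min_le_right _ _))
  have hhC : 0 ≤ h * C := by positivity
  have hhθ : 0 < h * θ := by positivity
  obtain ⟨y, hy, X, hX, hε⟩ := hD.exists_lt_value_add ht.1.le hx hhθ
  have hdist : ∀ τ ∈ Icc (t - h) t, ‖x - X τ‖ ≤ h * (C + θ) := fun τ hτ => by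
    have := hC t x y X _ hx hy hX hε τ ⟨by linarith [hτ.1], hτ.2⟩
    have : C * (t - τ) ≤ C * h := mul_le_mul_of_nonneg_left (by linarith [hτ.1]) hC0
    linarith
  have hmem : ∀ τ ∈ Icc (t - h) t, X τ ∈ J.carrier := fun τ hτ =>
    hX.mem_carrier hy hx ⟨by linarith [hτ.1], hτ.2⟩
  have hth : t - h ∈ Icc (t - h) t := ⟨le_rfl, by linarith⟩
  have hX' := hX.mono (a := t - h) (b := t) (by linarith) (by linarith) le_rfl
  have hcal := hX'.calibration (c := a + 2 * θ) (p := p) (by linarith)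
    (fun τ hτ => hbr (X τ) (hmem τ ⟨hτ.1.le, hτ.2.le⟩)
      (by linarith [hdist τ ⟨hτ.1.le, hτ.2.le⟩]))
    (fun τ hτ hz => h0 (by
      have := hdist τ ⟨hτ.1.le, hτ.2.le⟩
      rw [hz, sub_zero] at this
      linarith))
  have hdp := hD.value_add_integral_le (s := t - h) (by linarith) (by linarith) hx hy hX
  have hd := hdist (t - h) hth
  have habs : |t - h - t| = h := by rw [sub_sub_cancel_left, abs_neg, abs_of_pos hh0]
  have hexp' := hφη (t - h) (X (t - h)) (hmem _ hth) (by rw [habs]; linarith) (by linarith)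
  rw [habs] at hexp'
  have htouch := hle (t - h) (X (t - h)) ⟨by
    rw [Metric.mem_ball, Prod.dist_eq, Real.dist_eq, dist_eq_norm, habs, norm_sub_rev]
    exact max_lt (by linarith) (by linarith), ⟨by linarith, by linarith [ht.2]⟩, hmem _ hth⟩
  have hsum : ∑ i, p i * (J.coord i (X t) - J.coord i (X (t - h))) =
      - ∑ i, p i * (J.coord i (X (t - h)) - J.coord i x) := by
    rw [hX.mem.2.2.2.2, ← Finset.sum_neg_distrib]
    exact Finset.sum_congr rfl fun i _ => by ring
  rw [hsum] at hcal
  have hδ : θ / (2 * (1 + C + θ)) * (h + ‖x - X (t - h)‖) ≤ θ / 2 * h := by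
    have : θ / 2 * h = θ / (2 * (1 + C + θ)) * (h * (1 + C + θ)) := by field_simp
    rw [this]
    exact mul_le_mul_of_nonneg_left (by linarith) (by positivity)
  -- The slope terms cancel. What is left is a margin `2 * θ * h` from the calibration against an
  -- error `θ * h` in optimality and `θ / 2 * h` in the expansion.
  nlinarith

/-- If the inequality failed, the derivatives of the test function would give a strict calibration
near the touching point, which `not_forall_calibration` excludes. -/
theorem isSupersolution_value (T : ℝ) : J.IsSupersolution L T (J.value L u₀) where
  lsc := (hD.continuousOn_value.mono (prod_mono Ico_subset_Ici_self le_rfl)).lowerSemicontinuousOn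
  touch φ hφ t x htx hle heq := by
    obtain ⟨ρ, hρ, hle⟩ := hle
    have := hD.nonempty
    obtain ⟨K, hK⟩ := J.exists_lipschitzWith_coord
    have hK' : ∀ i x y, |J.coord i x - J.coord i y| ≤ K * ‖x - y‖ := fun i x y => by
      simpa [Real.dist_eq, dist_eq_norm] using (hK i).dist_le_mul x y
    refine ⟨fun i r hr hx => ?_, fun hx => ?_⟩
    · subst hx
      by_contra! hcon
      set a := timeDeriv φ t (r • J.e i)
      set b := J.spaceDeriv φ i t r
      have hK0 : (0 : ℝ) < K + 1 := by positivity
      have hnear : ∀ y ∈ J.carrier, ‖r • J.e i - y‖ < r / (K + 1) → 0 < J.coord i y := by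
        intro y hy hyr
        have h1 := hK' i (r • J.e i) y
        rw [J.coord_smul_self i hr.le] at h1
        have h2 := (abs_le.1 h1).2
        rw [lt_div_iff₀ hK0] at hyr
        have : 0 ≤ ‖r • J.e i - y‖ := norm_nonneg _
        nlinarith
      have hsum : ∀ y ∈ J.carrier, ‖r • J.e i - y‖ < r / (K + 1) →
          y = J.coord i y • J.e i := fun y hy hyr =>
        J.eq_coord_smul_of_coord_pos hy (hnear y hy hyr)
      refine hD.not_forall_calibration htx hρ hle heq (a := a)
        (θ := -(a + hamiltonian (L i) b) / 2) (R := r / (K + 1))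
        (p := fun j => if j = i then b else 0) (by linarith) (by positivity) (fun δ hδ => ?_)
        (fun y hy hyr j hj q => ?_) (fun h => ?_)
      · obtain ⟨η, hη, hφη⟩ := hφ.exists_abs_le htx.1 i hr.le hδ
        refine ⟨min η (r / (K + 1)), by positivity, fun s y hy hs hyr => ?_⟩
        have hyr' := hyr.trans_le (min_le_right _ _)
        obtain ⟨z, hz, rfl⟩ : ∃ z, 0 ≤ z ∧ y = z • J.e i :=
          ⟨_, (hnear y hy hyr').le, hsum y hy hyr'⟩
        have hn : ‖r • J.e i - z • J.e i‖ = |z - r| := by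
          rw [← sub_smul, norm_smul, J.norm_e, mul_one, Real.norm_eq_abs, abs_sub_comm]
        rw [hn] at hyr ⊢
        have := hφη s z (hs.trans_le (min_le_left _ _)) (hyr.trans_le (min_le_left _ _)) hz
        rw [Finset.sum_eq_single i (by intro j _ hj; simp [hj]) (by simp), if_pos rfl,
          J.coord_smul_self i hz, J.coord_smul_self i hr.le]
        linarith [(abs_le.1 this).1]
      · obtain rfl : j = i := by
          by_contra hji
          rw [J.coord_eq_zero_of_ne hy hji (hnear y hy hyr)] at hj
          exact hj.false
        simp only [if_true]
        linarith [(hD.lagrangian j).le_hamiltonian b q]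
      · rw [J.norm_smul_e i hr.le, lt_div_iff₀ hK0] at h
        have : (0 : ℝ) ≤ r * K := by positivity
        linarith
    · subst hx
      by_contra! hcon
      set a := timeDeriv φ t 0 with ha
      set S := ⨆ i, hamiltonianMinus (L i) (J.spaceDeriv φ i t 0) with hS
      have hSi : ∀ i, hamiltonianMinus (L i) (J.spaceDeriv φ i t 0) ≤ S := fun i =>
        le_ciSup (f := fun i => hamiltonianMinus (L i) (J.spaceDeriv φ i t 0))
          (finite_range _).bddAbove i
      have hq : ∀ i, ∀ q ≤ 0, a + 2 * (-(a + S) / 2) + J.spaceDeriv φ i t 0 * q ≤ L i q :=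
        fun i q hq => by
          linarith [(hD.lagrangian i).le_hamiltonianMinus (J.spaceDeriv φ i t 0) hq, hSi i]
      -- The failed inequality controls velocities `q ≤ 0` only. Lowering the slope to `deriv (L i)
      -- 0` where it is larger makes the calibration valid for every `q`, and preserves the lower
      -- expansion of `φ` because coordinates are nonnegative.
      have hcal : ∀ i q, a + 2 * (-(a + S) / 2) +
          min (J.spaceDeriv φ i t 0) (deriv (L i) 0) * q ≤ L i q := fun i q => by
        have hs := (hD.lagrangian i).support 0 q
        have h00 := hq i 0 le_rfl
        rw [sub_zero] at hs
        rw [mul_zero] at h00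
        rcases min_cases (J.spaceDeriv φ i t 0) (deriv (L i) 0) with ⟨h, h'⟩ | ⟨h, h'⟩
        · rw [h]
          rcases le_total q 0 with hq0 | hq0
          · exact hq i q hq0
          · linarith [mul_le_mul_of_nonneg_right h' hq0]
        · rw [h]; linarith
      refine hD.not_forall_calibration htx hρ hle heq (a := a) (θ := -(a + S) / 2) (R := 1)
        (p := fun i => min (J.spaceDeriv φ i t 0) (deriv (L i) 0)) (by linarith) one_pos
        (fun δ hδ => ?_) (fun y hy hyr j hj q => hcal j q) (fun h j => by simpa using hcal j 0)
      choose η hη hφη using fun i => hφ.exists_abs_le htx.1 i le_rfl hδ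
      refine ⟨Finset.univ.inf' Finset.univ_nonempty η,
        (Finset.lt_inf'_iff _).2 fun i _ => hη i, fun s y hy hs hyr => ?_⟩
      obtain ⟨i, z, hz, rfl⟩ := J.mem_carrier.1 hy
      have hn : ‖0 - z • J.e i‖ = z := by rw [zero_sub, norm_neg, J.norm_smul_e i hz]
      rw [hn] at hyr ⊢
      have hηi : Finset.univ.inf' Finset.univ_nonempty η ≤ η i :=
        Finset.inf'_le _ (Finset.mem_univ i)
      have := hφη i s z (hs.trans_le hηi)
        (by rw [sub_zero, abs_of_nonneg hz]; exact hyr.trans_le hηi) hz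
      rw [zero_smul, ← ha, sub_zero, abs_of_nonneg hz] at this
      rw [Finset.sum_eq_single i (by intro j _ hj; simp [J.coord_smul_of_ne hj hz]) (by simp),
        J.coord_smul_self i hz, coord_zero, sub_zero]
      have h2 := mul_le_mul_of_nonneg_right
        (min_le_left (J.spaceDeriv φ i t 0) (deriv (L i) 0)) hz
      linarith [(abs_le.1 this).1]

end IsAdmissibleData

end Junction

end JunctionHJ

end

/-! ### Subsolutions: barriers and suboptimality along segments. -/

noncomputable section

namespace JunctionHJ

namespace Junction

variable {N : ℕ} {J : Junction N} {L : Fin N → ℝ → ℝ} {T : ℝ}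

theorem IsC1Star.add_const {φ : ℝ → Plane → ℝ} (hφ : J.IsC1Star T φ) (m : ℝ) :
    J.IsC1Star T (fun s y => φ s y + m) where
  continuousOn := hφ.continuousOn.add continuousOn_const
  contDiffOn i := (hφ.contDiffOn i).add contDiffOn_const

theorem timeDeriv_add_const (φ : ℝ → Plane → ℝ) (m t : ℝ) (x : Plane) :
    timeDeriv (fun s y => φ s y + m) t x = timeDeriv φ t x :=
  deriv_add_const _

theorem spaceDeriv_add_const (φ : ℝ → Plane → ℝ) (m : ℝ) (i : Fin N) (t r : ℝ) :
    J.spaceDeriv (fun s y => φ s y + m) i t r = J.spaceDeriv φ i t r :=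
  derivWithin_add_const _

theorem box_subset_cylinder₀ {t₀ t₂ : ℝ} (h0 : 0 ≤ t₀) (h2 : t₂ < T) (R : ℝ) :
    Icc t₀ t₂ ×ˢ (J.carrier ∩ Metric.closedBall 0 R) ⊆ J.cylinder₀ T :=
  prod_mono (fun _ hs => ⟨h0.trans hs.1, hs.2.trans_lt h2⟩) inter_subset_left

theorem exists_ball_inter_subset {t₀ t₂ R t : ℝ} {x : Plane} (ht : t ∈ Ioo t₀ t₂) (hx : ‖x‖ < R) :
    ∃ ρ : ℝ, 0 < ρ ∧ Metric.ball (t, x) ρ ∩ J.cylinder T ⊆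
      Icc t₀ t₂ ×ˢ (J.carrier ∩ Metric.closedBall 0 R) := by
  have h : Ioo t₀ t₂ ×ˢ Metric.ball (0 : Plane) R ∈ 𝓝 (t, x) :=
    (isOpen_Ioo.prod Metric.isOpen_ball).mem_nhds ⟨ht, by simpa⟩
  obtain ⟨ρ, hρ, hsub⟩ := Metric.mem_nhds_iff.1 h
  refine ⟨ρ, hρ, fun p hp => ?_⟩
  have h1 := hsub hp.1
  exact ⟨Ioo_subset_Icc_self h1.1, hp.2.2, Metric.ball_subset_closedBall h1.2⟩

/-- A strict supersolution lying above a subsolution on the parabolic boundary of a box lies above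
it in the box. -/
theorem IsSubsolution.lt_of_boundary {v : ℝ → Plane → ℝ} (hv : J.IsSubsolution L T v)
    {φ : ℝ → Plane → ℝ} (hφ : J.IsC1Star T φ) (hφc : Continuous (Function.uncurry φ))
    {t₀ t₂ R : ℝ} (h0 : 0 ≤ t₀) (h2 : t₂ < T)
    (hbot : ∀ y ∈ J.carrier, ‖y‖ ≤ R → v t₀ y < φ t₀ y)
    (htop : ∀ y ∈ J.carrier, ‖y‖ ≤ R → v t₂ y < φ t₂ y)
    (hside : ∀ s ∈ Icc t₀ t₂, ∀ y ∈ J.carrier, ‖y‖ = R → v s y < φ s y)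
    (hbranch : ∀ s ∈ Ioo t₀ t₂, ∀ i r, 0 < r → v s (r • J.e i) < φ s (r • J.e i) ∨
      0 < timeDeriv φ s (r • J.e i) + hamiltonian (L i) (J.spaceDeriv φ i s r))
    (hzero : ∀ s ∈ Ioo t₀ t₂, v s 0 < φ s 0 ∨
      0 < timeDeriv φ s 0 + ⨆ i, hamiltonianMinus (L i) (J.spaceDeriv φ i s 0))
    {s : ℝ} (hs : s ∈ Icc t₀ t₂) {y : Plane} (hy : y ∈ J.carrier) (hyR : ‖y‖ ≤ R) :
    v s y < φ s y := by
  by_contra! hcon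
  have hsub := J.box_subset_cylinder₀ h0 h2 R
  have husc : UpperSemicontinuousOn (fun p : ℝ × Plane => v p.1 p.2 + - φ p.1 p.2)
      (Icc t₀ t₂ ×ˢ (J.carrier ∩ Metric.closedBall 0 R)) :=
    (hv.usc.mono hsub).add hφc.neg.continuousOn.upperSemicontinuousOn
  have hsy : (s, y) ∈ Icc t₀ t₂ ×ˢ (J.carrier ∩ Metric.closedBall 0 R) :=
    ⟨hs, hy, by simpa using hyR⟩
  obtain ⟨⟨t, x⟩, ⟨ht, hx, hxR⟩, hmax⟩ := husc.exists_isMaxOn ⟨_, hsy⟩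
    (isCompact_Icc.prod (J.isCompact_carrier_inter_closedBall R))
  have hxR' : ‖x‖ ≤ R := by simpa using hxR
  have h1 : v s y + - φ s y ≤ v t x + - φ t x := hmax hsy
  have hge : φ t x ≤ v t x := by linarith
  -- The final time is excluded as well, since touching is required on a full neighbourhood in time.
  have htne0 : t ≠ t₀ := by rintro rfl; exact (hbot x hx hxR').not_ge hge
  have htne2 : t ≠ t₂ := by rintro rfl; exact (htop x hx hxR').not_ge hge
  have hxne : ‖x‖ ≠ R := fun h => (hside t ht x hx h).not_ge hge
  have ht' : t ∈ Ioo t₀ t₂ := ⟨lt_of_le_of_ne ht.1 htne0.symm, lt_of_le_of_ne ht.2 htne2⟩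
  obtain ⟨ρ, hρ, hball⟩ := J.exists_ball_inter_subset (T := T) ht' (lt_of_le_of_ne hxR' hxne)
  have htouch := hv.touch _ (hφ.add_const (v t x - φ t x)) t x
    ⟨⟨h0.trans_lt ht'.1, ht'.2.trans h2⟩, hx⟩
    ⟨ρ, hρ, fun s' y' h => by
      have : v s' y' + - φ s' y' ≤ v t x + - φ t x := hmax (hball h)
      linarith⟩ (by ring)
  simp only [timeDeriv_add_const, spaceDeriv_add_const] at htouch
  obtain ⟨i, r, hr, rfl⟩ := J.mem_carrier.1 hx
  rcases hr.eq_or_lt with rfl | hr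
  · rw [zero_smul] at *
    rcases hzero t ht' with h | h
    · exact h.not_ge hge
    · exact (htouch.2 rfl).not_gt h
  · rcases hbranch t ht' i r hr with h | h
    · exact h.not_ge hge
    · exact (htouch.1 i r hr rfl).not_gt h

variable [Nonempty (Fin N)]

/-- The suboptimality principle for subsolutions along a segment that either runs towards the
junction point or does not meet it, up to an error. -/
theorem IsSubsolution.segment_le_aux {v : ℝ → Plane → ℝ}
    (hL : ∀ i, IsStronglyConvexLagrangian (L i)) (hv : J.IsSubsolution L T v) (i : Fin N)
    {t₀ t₁ r q : ℝ} (h0 : 0 ≤ t₀) (h01 : t₀ < t₁) (h1 : t₁ < T) (hr : 0 ≤ r)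
    (hr' : 0 ≤ r + q * (t₁ - t₀)) (hq : q ≤ 0 ∨ (0 < r ∧ 0 < r + q * (t₁ - t₀)))
    {ε : ℝ} (hε : 0 < ε) :
    v t₁ ((r + q * (t₁ - t₀)) • J.e i) ≤
      v t₀ (r • J.e i) + (t₁ - t₀) * L i q + ε * (2 + (t₁ - t₀)) := by
  set v₀ := v t₀ (r • J.e i)
  -- The box extends past `t₁` so that the barrier can rise before its final time. If `q > 0`, the
  -- number `c` bounds the distance from the segment to the vertex from below; if `q ≤ 0` its value
  -- is immaterial.
  obtain ⟨t₂, h12, h2, c, hc, hqc⟩ : ∃ t₂, t₁ < t₂ ∧ t₂ < T ∧ ∃ c : ℝ, 0 < c ∧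
      (q ≤ 0 ∨ ∀ s ∈ Icc t₀ t₂, c ≤ r + q * (s - t₀)) := by
    rcases hq with hq | ⟨hr0, hr1⟩
    · exact ⟨(t₁ + T) / 2, by linarith, by linarith, 1, one_pos, .inl hq⟩
    · rcases le_total q 0 with hq | hq
      · exact ⟨(t₁ + T) / 2, by linarith, by linarith, 1, one_pos, .inl hq⟩
      · exact ⟨(t₁ + T) / 2, by linarith, by linarith, r, hr0, .inr fun s hs => by
          have := mul_nonneg hq (sub_nonneg.2 hs.1)
          linarith⟩
  set R : ℝ := r + |q| * (t₂ - t₀) + 1 with hR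
  have hR1 : 1 ≤ R := by
    have : 0 ≤ |q| * (t₂ - t₀) := mul_nonneg (abs_nonneg _) (by linarith)
    linarith
  have hx : ∀ s ∈ Icc t₀ t₂, |r + q * (s - t₀)| ≤ R - 1 := fun s hs => by
    have e1 : |q * (s - t₀)| ≤ |q| * (t₂ - t₀) := by
      rw [abs_mul, abs_of_nonneg (sub_nonneg.2 hs.1)]
      exact mul_le_mul_of_nonneg_left (by linarith [hs.2]) (abs_nonneg _)
    have e2 := abs_add_le r (q * (s - t₀))
    rw [abs_of_nonneg hr] at e2
    linarith
  obtain ⟨m, hm⟩ := (hv.usc.mono (J.box_subset_cylinder₀ h0 h2 R)).bddAbove_of_isCompact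
    (isCompact_Icc.prod (J.isCompact_carrier_inter_closedBall R))
  have hm' : ∀ s ∈ Icc t₀ t₂, ∀ y ∈ J.carrier, ‖y‖ ≤ R → v s y ≤ m := fun s hs y hy hyR =>
    hm ⟨(s, y), ⟨hs, hy, by simpa using hyR⟩, rfl⟩
  obtain ⟨ρ, hρ, hρv⟩ : ∃ ρ > 0, ∀ y ∈ J.carrier, ‖y - r • J.e i‖ < ρ → v t₀ y < v₀ + ε := by
    have := hv.usc (t₀, r • J.e i) ⟨⟨h0, by linarith⟩, J.smul_mem_carrier i hr⟩ (v₀ + ε)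
      (by simp only [Function.uncurry]; linarith)
    rw [eventually_nhdsWithin_iff, Metric.eventually_nhds_iff] at this
    obtain ⟨ρ, hρ, h⟩ := this
    refine ⟨ρ, hρ, fun y hy hyr => @h (t₀, y) ?_ ⟨⟨h0, by linarith⟩, hy⟩⟩
    rw [Prod.dist_eq, dist_self, dist_eq_norm]
    exact max_lt hρ hyr
  set D := L i q + ε with hD
  -- Any one term of the barrier of size `E` lifts it above the bound `m` of `v` on the box.
  set E := |m| + |v₀| + |D| * (t₂ - t₀) + 1 with hE
  have hE0 : 0 < E := by
    have : 0 ≤ |D| * (t₂ - t₀) := mul_nonneg (abs_nonneg _) (by linarith)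
    positivity
  have hbase : ∀ s ∈ Icc t₀ t₂, m < v₀ + ε + D * (s - t₀) + E := fun s hs => by
    have e1 : |D * (s - t₀)| ≤ |D| * (t₂ - t₀) := by
      rw [abs_mul, abs_of_nonneg (sub_nonneg.2 hs.1)]
      exact mul_le_mul_of_nonneg_left (by linarith [hs.2]) (abs_nonneg _)
    linarith [neg_abs_le (D * (s - t₀)), neg_abs_le v₀, le_abs_self m]
  -- The parabola must exceed `E` at distance `1` from the segment (lateral side), `ρ / 2` (initial
  -- time) and `c` (vertex).
  obtain ⟨K, hK0, hK1, hKρ, hKc⟩ : ∃ K : ℝ, 0 ≤ K ∧ E ≤ K ∧ E ≤ K * (ρ / 2) ^ 2 ∧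
      E ≤ K * c ^ 2 := by
    refine ⟨E + E / (ρ / 2) ^ 2 + E / c ^ 2, by positivity, ?_, ?_, ?_⟩
    · have : 0 ≤ E / (ρ / 2) ^ 2 + E / c ^ 2 := by positivity
      linarith
    · have : E / (ρ / 2) ^ 2 * (ρ / 2) ^ 2 = E := by field_simp
      have : 0 ≤ (E + E / c ^ 2) * (ρ / 2) ^ 2 := by positivity
      linarith
    · have : E / c ^ 2 * c ^ 2 = E := by field_simp
      have : 0 ≤ (E + E / (ρ / 2) ^ 2) * c ^ 2 := by positivity
      linarith
  -- The exponential term is only `ε` at `t₁` but at least `E` at `t₂`.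
  obtain ⟨B, hB0, hB⟩ : ∃ B : ℝ, 0 ≤ B ∧ E ≤ ε * Real.exp (B * (t₂ - t₁)) := by
    have ht : 0 < t₂ - t₁ := by linarith
    refine ⟨E / (ε * (t₂ - t₁)), by positivity, ?_⟩
    have h1 := Real.add_one_le_exp (E / (ε * (t₂ - t₁)) * (t₂ - t₁))
    have h3 : E / (ε * (t₂ - t₁)) * (t₂ - t₁) = E / ε := by field_simp
    rw [h3] at h1 ⊢
    have h4 := mul_le_mul_of_nonneg_left h1 hε.le
    have h5 : ε * (E / ε + 1) = E + ε := by field_simp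
    linarith
  -- On the other branches the barrier rises with slope `M`, large enough for the boundary
  -- conditions and for strictness, where the Hamiltonian is bounded below with velocity `1`.
  obtain ⟨M, hM0, hM1, hMρ, hMt⟩ : ∃ M : ℝ, 0 ≤ M ∧ E ≤ M ∧ E ≤ M * (ρ / 2) ∧
      ∀ j, |D| + 2 * K * R * |q| + L j 1 < M := by
    have hs : ∀ j, |L j 1| ≤ ∑ j, |L j 1| := fun j =>
      Finset.single_le_sum (f := fun j => |L j 1|) (fun j _ => abs_nonneg _) (Finset.mem_univ j)
    set S := ∑ j, |L j 1|
    have hS0 : 0 ≤ S := Finset.sum_nonneg fun j _ => abs_nonneg _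
    have hKR : 0 ≤ 2 * K * R * |q| := by positivity
    refine ⟨E + E / (ρ / 2) + (|D| + 2 * K * R * |q| + S), by positivity, ?_, ?_, fun j => ?_⟩
    · have : 0 ≤ E / (ρ / 2) + (|D| + 2 * K * R * |q| + S) := by positivity
      linarith
    · have : E / (ρ / 2) * (ρ / 2) = E := by field_simp
      have : 0 ≤ (E + (|D| + 2 * K * R * |q| + S)) * (ρ / 2) := by positivity
      linarith
    · have : 0 < E / (ρ / 2) := by positivity
      linarith [hs j, le_abs_self (L j 1)]
  -- A parabola moving with the segment: `F_t + q * F_r ≥ D = L i q + ε`, hence `F_t + hamiltonian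
  -- (L i) F_r ≥ ε`.
  let F : ℝ × ℝ → ℝ := fun p => v₀ + ε + D * (p.1 - t₀) + K * (p.2 - (r + q * (p.1 - t₀))) ^ 2 +
    ε * Real.exp (B * (p.1 - t₁))
  let g : ℝ → ℝ := fun s => F (s, 0)
  let f : Fin N → ℝ × ℝ → ℝ := fun j p => if j = i then F p else F (p.1, 0) + M * p.2
  have hf0 : ∀ j s, f j (s, 0) = g s := fun j s => by simp [f, g]
  have hF : ContDiff ℝ 1 F := by fun_prop
  have hf : ∀ j, ContDiff ℝ 1 (f j) := fun j => by
    simp only [f]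
    split_ifs
    · exact hF
    · fun_prop
  have hg : Continuous g := hF.continuous.comp (by fun_prop)
  have hfi : ∀ p, f i p = F p := fun p => if_pos rfl
  have hfj : ∀ j p, j ≠ i → f j p = F (p.1, 0) + M * p.2 := fun j p hj => if_neg hj
  have hexp : ∀ s, 0 < ε * Real.exp (B * (s - t₁)) := fun s => by positivity
  have hFt : ∀ s ρ, HasDerivAt (fun s => F (s, ρ)) (D - 2 * K * (ρ - (r + q * (s - t₀))) * q +
      ε * B * Real.exp (B * (s - t₁))) s := fun s ρ => by
    have e0 := (hasDerivAt_id s).sub_const t₀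
    have e1 := (e0.const_mul D).const_add (v₀ + ε)
    have e2 := ((((e0.const_mul q).const_add r).const_sub ρ).pow 2).const_mul K
    have e3 := ((((hasDerivAt_id s).sub_const t₁).const_mul B).exp).const_mul ε
    convert! (e1.add e2).add e3 using 1
    simp; ring
  have hFr : ∀ s ρ, HasDerivAt (fun ρ => F (s, ρ)) (2 * K * (ρ - (r + q * (s - t₀)))) ρ :=
    fun s ρ => by
    have e2 := ((((hasDerivAt_id ρ).sub_const (r + q * (s - t₀))).pow 2).const_mul K).const_add
      (v₀ + ε + D * (s - t₀))
    convert! e2.add_const (ε * Real.exp (B * (s - t₁))) using 1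
    simp; ring
  have key := hv.lt_of_boundary (J.isC1Star_glue hf0 hg hf T)
    (J.continuous_glue hg fun j => (hf j).continuous) (t₀ := t₀) (t₂ := t₂) (R := R) h0 h2
    ?_ ?_ ?_ ?_ ?_ (s := t₁) ⟨h01.le, h12.le⟩ (J.smul_mem_carrier i hr') ?_
  · rw [glue_smul hf0 i _ hr', hfi] at key
    simp only [F, sub_self, mul_zero, Real.exp_zero] at key
    nlinarith
  · intro y hy hyR
    obtain ⟨j, z, hz, rfl⟩ := J.mem_carrier.1 hy
    rw [glue_smul hf0 j _ hz]
    have hmv := hm' t₀ ⟨le_rfl, by linarith⟩ _ hy hyR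
    have hb := hbase t₀ ⟨le_rfl, by linarith⟩
    rw [sub_self, mul_zero] at hb
    by_cases hji : j = i
    · subst hji
      rw [hfi]
      simp only [F, sub_self, mul_zero, add_zero]
      by_cases hzr : |z - r| < ρ
      · have := hρv _ hy (by rwa [← sub_smul, norm_smul, J.norm_e, mul_one, Real.norm_eq_abs])
        have : 0 ≤ K * (z - r) ^ 2 := by positivity
        linarith [hexp t₀]
      · have : (ρ / 2) ^ 2 ≤ (z - r) ^ 2 := by
          rw [← sq_abs (z - r)]
          exact pow_le_pow_left₀ (by positivity) (by linarith) 2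
        have := mul_le_mul_of_nonneg_left this hK0
        linarith [hexp t₀]
    · rw [hfj j _ hji]
      simp only [F, sub_self, mul_zero, add_zero, zero_sub, neg_sq]
      have hMz : 0 ≤ M * z := by positivity
      have hKr : 0 ≤ K * r ^ 2 := by positivity
      by_cases hzr : ‖z • J.e j - r • J.e i‖ < ρ
      · have := hρv _ hy hzr
        linarith [hexp t₀]
      · have hn := norm_sub_le (z • J.e j) (r • J.e i)
        rw [J.norm_smul_e j hz, J.norm_smul_e i hr] at hn
        rcases le_total (ρ / 2) z with h | h
        · have := mul_le_mul_of_nonneg_left h hM0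
          linarith [hexp t₀]
        · have : (ρ / 2) ^ 2 ≤ r ^ 2 := pow_le_pow_left₀ (by positivity) (by linarith) 2
          have := mul_le_mul_of_nonneg_left this hK0
          linarith [hexp t₀]
  · intro y hy hyR
    obtain ⟨j, z, hz, rfl⟩ := J.mem_carrier.1 hy
    rw [glue_smul hf0 j _ hz]
    have ht₂ : t₂ ∈ Icc t₀ t₂ := ⟨by linarith, le_rfl⟩
    have hmv := hm' t₂ ht₂ _ hy hyR
    have hb := hbase t₂ ht₂
    have hFge : ∀ z, v₀ + ε + D * (t₂ - t₀) + E ≤ F (t₂, z) := fun z => by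
      have : 0 ≤ K * (z - (r + q * (t₂ - t₀))) ^ 2 := by positivity
      simp only [F]; linarith
    by_cases hji : j = i
    · subst hji
      rw [hfi]
      linarith [hFge z]
    · rw [hfj j _ hji]
      have hMz : 0 ≤ M * z := by positivity
      simp only
      linarith [hFge 0]
  · intro s hs y hy hyR
    obtain ⟨j, z, hz, rfl⟩ := J.mem_carrier.1 hy
    rw [glue_smul hf0 j _ hz]
    have hmv := hm' s hs _ hy hyR.le
    have hb := hbase s hs
    rw [J.norm_smul_e j hz] at hyR
    subst hyR
    have hxs := abs_le.1 (hx s hs)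
    by_cases hji : j = i
    · subst hji
      rw [hfi]
      have : 1 ≤ (R - (r + q * (s - t₀))) ^ 2 := by nlinarith
      have := mul_le_mul_of_nonneg_left this hK0
      simp only [F]
      linarith [hexp s]
    · rw [hfj j _ hji]
      have := mul_le_mul_of_nonneg_left hR1 hM0
      have : 0 ≤ K * (0 - (r + q * (s - t₀))) ^ 2 := by positivity
      simp only [F]
      linarith [hexp s]
  · intro s hs j z hz
    right
    by_cases hji : j = i
    · subst hji
      rw [timeDeriv_glue hf0 j hz.le (a := D - 2 * K * (z - (r + q * (s - t₀))) * q +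
          ε * B * Real.exp (B * (s - t₁))) (by simpa only [hfi] using hFt s z),
        spaceDeriv_glue hf0 j hz.le (b := 2 * K * (z - (r + q * (s - t₀))))
          (by simpa only [hfi] using hFr s z)]
      have := (hL j).le_hamiltonian (2 * K * (z - (r + q * (s - t₀)))) q
      have : 0 ≤ ε * B * Real.exp (B * (s - t₁)) := by positivity
      linarith
    · have e1 : HasDerivAt (fun s => f j (s, z)) (D - 2 * K * (0 - (r + q * (s - t₀))) * q +
          ε * B * Real.exp (B * (s - t₁))) s := by
        simpa only [hfj j _ hji] using (hFt s 0).add_const (M * z)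
      have e2 : HasDerivAt (fun z => f j (s, z)) M z := by
        simp only [hfj j _ hji]
        simpa using ((hasDerivAt_id z).const_mul M).const_add (F (s, 0))
      rw [timeDeriv_glue hf0 j hz.le e1, spaceDeriv_glue hf0 j hz.le e2]
      have h3 := (hL j).le_hamiltonian M 1
      have h4 : 0 ≤ ε * B * Real.exp (B * (s - t₁)) := by positivity
      have h5 : |2 * K * (r + q * (s - t₀)) * q| ≤ 2 * K * R * |q| := by
        rw [abs_mul, abs_mul, abs_of_nonneg (by positivity : 0 ≤ 2 * K)]
        have := hx s ⟨hs.1.le, hs.2.le⟩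
        gcongr
        linarith
      linarith [hMt j, neg_abs_le D, neg_abs_le (2 * K * (r + q * (s - t₀)) * q)]
  · intro s hs
    -- If `q ≤ 0`, the velocity `q` is admissible in `hamiltonianMinus (L i)` and gives strictness.
    -- Otherwise the vertex is at distance at least `c` from the segment and the barrier already
    -- exceeds `v`.
    rcases hqc with hq0 | hqc
    · right
      have e1 := timeDeriv_glue (J := J) hf0 i (t := s) le_rfl
        (a := D - 2 * K * (0 - (r + q * (s - t₀))) * q + ε * B * Real.exp (B * (s - t₁)))
        (by simpa only [hfi] using hFt s 0)
      have e2 := spaceDeriv_glue (J := J) hf0 i (t := s) le_rfl (b := 2 * K * (0 - (r + q * (s - t₀))))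
        (by simpa only [hfi] using hFr s 0)
      rw [zero_smul] at e1
      rw [e1]
      have h1 := (hL i).le_hamiltonianMinus (2 * K * (0 - (r + q * (s - t₀)))) hq0
      rw [← e2] at h1
      have h2 := le_ciSup (f := fun j => hamiltonianMinus (L j) (J.spaceDeriv (J.glue g f) j s 0))
        (finite_range _).bddAbove i
      rw [e2] at h1 h2
      have : 0 ≤ ε * B * Real.exp (B * (s - t₁)) := by positivity
      linarith
    · left
      rw [glue_zero hf0]
      have hs' : s ∈ Icc t₀ t₂ := ⟨hs.1.le, hs.2.le⟩
      have hmv := hm' s hs' 0 J.zero_mem_carrier (by rw [norm_zero]; linarith)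
      have hb := hbase s hs'
      have : c ^ 2 ≤ (0 - (r + q * (s - t₀))) ^ 2 := by
        rw [zero_sub, neg_sq]
        exact pow_le_pow_left₀ hc.le (hqc s hs') 2
      have := mul_le_mul_of_nonneg_left this hK0
      simp only [g, F]
      linarith [hexp s]
  · rw [J.norm_smul_e i hr']
    have := hx t₁ ⟨h01.le, h12.le⟩
    rw [abs_of_nonneg hr'] at this
    linarith

/-- The suboptimality principle for subsolutions along a segment of a branch. -/
theorem IsSubsolution.segment_le {v : ℝ → Plane → ℝ}
    (hL : ∀ i, IsStronglyConvexLagrangian (L i)) (hv : J.IsSubsolution L T v) (i : Fin N)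
    {t₀ t₁ r q : ℝ} (h0 : 0 ≤ t₀) (h01 : t₀ ≤ t₁) (h1 : t₁ < T) (hr : 0 ≤ r)
    (hr' : 0 ≤ r + q * (t₁ - t₀)) :
    v t₁ ((r + q * (t₁ - t₀)) • J.e i) ≤ v t₀ (r • J.e i) + (t₁ - t₀) * L i q := by
  rcases h01.eq_or_lt with rfl | h01
  · simp
  have key : ∀ r q, 0 ≤ r → 0 ≤ r + q * (t₁ - t₀) → (q ≤ 0 ∨ (0 < r ∧ 0 < r + q * (t₁ - t₀))) →
      v t₁ ((r + q * (t₁ - t₀)) • J.e i) ≤ v t₀ (r • J.e i) + (t₁ - t₀) * L i q := by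
    intro r q hr hr' hq
    refine le_of_forall_pos_le_add fun ε hε => ?_
    have ht : 0 < 2 + (t₁ - t₀) := by linarith
    have := hv.segment_le_aux hL i h0 h01 h1 hr hr' hq (div_pos hε ht)
    rwa [div_mul_cancel₀ _ ht.ne'] at this
  rcases le_or_gt q 0 with hq | hq
  · exact key r q hr hr' (.inl hq)
  have ht : 0 < t₁ - t₀ := by linarith
  rcases hr.eq_or_lt with rfl | hr0
  · have hqt : 0 < q * (t₁ - t₀) := by positivity
    simp only [zero_add, zero_smul] at *
    refine le_of_forall_pos_le_add fun ε hε => ?_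
    -- A segment leaving the vertex is approximated by slightly slower ones that start at `η > 0`
    -- and have the same end. Upper semicontinuity of `v` at the vertex is in the right direction
    -- for the limit.
    have e1 : ∀ᶠ η in 𝓝[>] (0 : ℝ), v t₀ (η • J.e i) < v t₀ 0 + ε / 2 := by
      have h2 := hv.usc (t₀, 0) ⟨⟨h0, by linarith⟩, J.zero_mem_carrier⟩ (v t₀ 0 + ε / 2)
        (by simp only [Function.uncurry]; linarith)
      have h3 : Tendsto (fun η : ℝ => (t₀, η • J.e i)) (𝓝[>] 0) (𝓝[J.cylinder₀ T] (t₀, 0)) := by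
        refine tendsto_nhdsWithin_iff.2 ⟨?_, ?_⟩
        · have : Continuous fun η : ℝ => (t₀, η • J.e i) := by fun_prop
          have := this.tendsto 0
          rw [zero_smul] at this
          exact this.mono_left nhdsWithin_le_nhds
        · filter_upwards [self_mem_nhdsWithin] with η hη
          exact ⟨⟨h0, by linarith⟩, J.smul_mem_carrier i (le_of_lt hη)⟩
      exact h3.eventually h2
    have e2 : ∀ᶠ η in 𝓝[>] (0 : ℝ),
        (t₁ - t₀) * L i (q - η / (t₁ - t₀)) < (t₁ - t₀) * L i q + ε / 2 := by
      have hc : Continuous fun η : ℝ => (t₁ - t₀) * L i (q - η / (t₁ - t₀)) := by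
        have := (hL i).continuous
        fun_prop
      have := hc.tendsto 0
      rw [zero_div, sub_zero] at this
      exact (this.mono_left nhdsWithin_le_nhds).eventually (gt_mem_nhds (by linarith))
    obtain ⟨η, h2, h3, hη⟩ := (e1.and (e2.and self_mem_nhdsWithin)).exists
    have e : η + (q - η / (t₁ - t₀)) * (t₁ - t₀) = q * (t₁ - t₀) := by field_simp; ring
    have h4 := key η (q - η / (t₁ - t₀)) (le_of_lt hη) (by rw [e]; exact hqt.le)
      (.inr ⟨hη, by rw [e]; exact hqt⟩)
    rw [e] at h4
    linarith
  · exact key r q hr hr' (.inr ⟨hr0, by positivity⟩)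

end Junction

end JunctionHJ

end

/-! ### Subsolutions lie below the value function: arbitrary trajectories. -/

noncomputable section

namespace JunctionHJ

namespace Junction

variable {N : ℕ} {J : Junction N} {L : Fin N → ℝ → ℝ} {T s t : ℝ} {x y : Plane} {X : ℝ → Plane}

theorem IsFinitePath.continuousOn (hX : J.IsFinitePath L s y t x X) (hst : s ≤ t) :
    ContinuousOn X (Icc s t) :=
  uIcc_of_le hst ▸ hX.mem.1.continuousOn

/-- A point of `J` whose `i`-th coordinate vanishes and which is a limit of points of the open
branch `J_i^*` is the junction point. -/
theorem eq_zero_of_frequently {p : Plane} (hp : p ∈ J.carrier) {i : Fin N}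
    (hi : J.coord i p = 0) (h : ∃ᶠ z in 𝓝 p, z ∈ J.carrier ∧ 0 < J.coord i z) : p = 0 := by
  by_contra hne
  obtain ⟨j, hj⟩ := J.exists_coord_pos hp hne
  have hji : j ≠ i := by rintro rfl; exact hj.ne' hi
  obtain ⟨z, ⟨hz, hzi⟩, hzj⟩ :=
    (h.and_eventually ((J.continuous_coord j).tendsto p |>.eventually (lt_mem_nhds hj))).exists
  exact hzj.ne' (J.coord_eq_zero_of_ne hz hji hzi)

/-- Decomposition of a trajectory ending on an open branch: a final part inside the branch, started
at the initial time or at the junction point. -/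
theorem IsFinitePath.exists_last_zero (hX : J.IsFinitePath L s y t x X) (hst : s ≤ t)
    (hy : y ∈ J.carrier) (hx : x ∈ J.carrier) {i : Fin N} (hi : 0 < J.coord i x) :
    ∃ a ∈ Icc s t, (∀ τ ∈ Ioo a t, 0 < J.coord i (X τ)) ∧
      X a = J.coord i (X a) • J.e i ∧ (a = s ∨ X a = 0) := by
  have hc : ContinuousOn (fun τ => J.coord i (X τ)) (Icc s t) :=
    (J.continuous_coord i).comp_continuousOn (hX.continuousOn hst)
  set S := Icc s t ∩ (fun τ => J.coord i (X τ)) ⁻¹' {0} with hS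
  have hSc : IsCompact S := isCompact_Icc.of_isClosed_subset
    (hc.preimage_isClosed_of_isClosed isClosed_Icc isClosed_singleton) inter_subset_left
  rcases S.eq_empty_or_nonempty with he | hne
  · have hpos : ∀ τ ∈ Icc s t, 0 < J.coord i (X τ) := fun τ hτ => by
      refine lt_of_le_of_ne (J.coord_nonneg i _) fun h => ?_
      have : τ ∈ S := ⟨hτ, h.symm⟩
      simp [he] at this
    exact ⟨s, ⟨le_rfl, hst⟩, fun τ hτ => hpos τ ⟨hτ.1.le, hτ.2.le⟩,
      J.eq_coord_smul_of_coord_pos (hX.mem_carrier hy hx ⟨le_rfl, hst⟩) (hpos s ⟨le_rfl, hst⟩),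
      .inl rfl⟩
  · obtain ⟨ha, ha0⟩ := hSc.sSup_mem hne
    set a := sSup S
    have ha0 : J.coord i (X a) = 0 := ha0
    have hat : a < t := lt_of_le_of_ne ha.2 fun h => by
      rw [h, hX.mem.2.2.2.2] at ha0
      exact hi.ne' ha0
    have hpos : ∀ τ ∈ Ioc a t, 0 < J.coord i (X τ) := fun τ hτ => by
      refine lt_of_le_of_ne (J.coord_nonneg i _) fun h => ?_
      have : τ ∈ S := ⟨⟨ha.1.trans hτ.1.le, hτ.2⟩, h.symm⟩
      exact (le_csSup hSc.bddAbove this).not_gt hτ.1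
    have hz : X a = 0 := by
      refine eq_zero_of_frequently (hX.mem_carrier hy hx ha) ha0 ?_
      have h1 : Tendsto X (𝓝[Ioc a t] a) (𝓝 (X a)) :=
        (hX.continuousOn hst a ha).mono_left (nhdsWithin_mono _ fun τ hτ =>
          ⟨ha.1.trans hτ.1.le, hτ.2⟩)
      have : (𝓝[Ioc a t] a).NeBot := by
        rw [nhdsWithin_Ioc_eq_nhdsGT hat]; infer_instance
      refine h1.frequently (Eventually.frequently ?_)
      filter_upwards [self_mem_nhdsWithin] with τ hτ
      exact ⟨hX.mem_carrier hy hx ⟨ha.1.trans hτ.1.le, hτ.2⟩, hpos τ hτ⟩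
    exact ⟨a, ha, fun τ hτ => hpos τ ⟨hτ.1, hτ.2.le⟩, by rw [ha0, zero_smul, hz], .inr hz⟩

/-- Decomposition of a trajectory starting on an open branch and reaching the junction point: an
initial part inside the branch, up to the junction point. -/
theorem IsFinitePath.exists_first_zero (hX : J.IsFinitePath L s y t 0 X) (hst : s ≤ t)
    (hy : y ∈ J.carrier) (h0 : (0 : Plane) ∈ J.carrier) {i : Fin N} (hi : 0 < J.coord i y) :
    ∃ a ∈ Icc s t, (∀ τ ∈ Ioo s a, 0 < J.coord i (X τ)) ∧ X a = 0 := by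
  have hc : ContinuousOn (fun τ => J.coord i (X τ)) (Icc s t) :=
    (J.continuous_coord i).comp_continuousOn (hX.continuousOn hst)
  set S := Icc s t ∩ (fun τ => J.coord i (X τ)) ⁻¹' {0} with hS
  have hSc : IsCompact S := isCompact_Icc.of_isClosed_subset
    (hc.preimage_isClosed_of_isClosed isClosed_Icc isClosed_singleton) inter_subset_left
  have hne : S.Nonempty := ⟨t, ⟨hst, le_rfl⟩, by simp [hX.mem.2.2.2.2]⟩
  obtain ⟨ha, ha0⟩ := hSc.sInf_mem hne
  set a := sInf S
  have ha0 : J.coord i (X a) = 0 := ha0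
  have hat : s < a := lt_of_le_of_ne ha.1 fun h => by
    rw [← h, hX.mem.2.2.2.1] at ha0
    exact hi.ne' ha0
  have hpos : ∀ τ ∈ Ico s a, 0 < J.coord i (X τ) := fun τ hτ => by
    refine lt_of_le_of_ne (J.coord_nonneg i _) fun h => ?_
    have : τ ∈ S := ⟨⟨hτ.1, hτ.2.le.trans ha.2⟩, h.symm⟩
    exact (csInf_le hSc.bddBelow this).not_gt hτ.2
  refine ⟨a, ha, fun τ hτ => hpos τ ⟨hτ.1.le, hτ.2⟩, ?_⟩
  refine eq_zero_of_frequently (hX.mem_carrier hy h0 ha) ha0 ?_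
  have h1 : Tendsto X (𝓝[Ico s a] a) (𝓝 (X a)) :=
    (hX.continuousOn hst a ha).mono_left (nhdsWithin_mono _ fun τ hτ =>
      ⟨hτ.1, hτ.2.le.trans ha.2⟩)
  have : (𝓝[Ico s a] a).NeBot := by
    rw [nhdsWithin_Ico_eq_nhdsLT hat]; infer_instance
  refine h1.frequently (Eventually.frequently ?_)
  filter_upwards [self_mem_nhdsWithin] with τ hτ
  exact ⟨hX.mem_carrier hy h0 ⟨hτ.1, hτ.2.le.trans ha.2⟩, hpos τ hτ⟩

variable [Nonempty (Fin N)]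

/-- Jensen's inequality on a branch. -/
theorem IsFinitePath.le_cost_of_branch (hL : ∀ i, IsStronglyConvexLagrangian (L i)) {i : Fin N}
    {a b q : ℝ} (ha : 0 ≤ a) (hb : 0 ≤ b) (hX : J.IsFinitePath L s (a • J.e i) t (b • J.e i) X)
    (hst : s ≤ t) (hq : b = a + q * (t - s)) (hpos : ∀ τ ∈ Ioo s t, 0 < J.coord i (X τ)) :
    (t - s) * L i q ≤ ∫ τ in s..t, J.runningCost L X τ := by
  -- The calibration is the tangent to `L i` at the mean velocity `q`.
  have h := hX.calibration hst (c := L i q - q * deriv (L i) q)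
    (p := fun j => if j = i then deriv (L i) q else 0) (fun τ hτ j hj q' => ?_)
    (fun τ hτ h0 j => ?_)
  · rw [Finset.sum_eq_single i (by intro j _ hj; simp [hj]) (by simp), if_pos rfl,
      J.coord_smul_self i ha, J.coord_smul_self i hb, hq] at h
    linarith
  · obtain rfl : j = i := by
      by_contra hji
      exact hj.ne' (J.coord_eq_zero_of_ne (hX.mem.2.1 τ hτ) hji (hpos τ hτ))
    simp only [if_true]
    linarith [(hL j).support q q']
  · have := hpos τ hτ
    simp [h0] at this

/-- The tangents at `0`, lowered to the common intercept `min L j 0`, form a calibration whose slope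
terms vanish on a loop. No loop at the vertex is thus cheaper than waiting there. -/
theorem IsFinitePath.le_cost_of_loop (hL : ∀ i, IsStronglyConvexLagrangian (L i))
    (hX : J.IsFinitePath L s 0 t 0 X) (hst : s ≤ t) :
    ∃ i, (t - s) * L i 0 ≤ ∫ τ in s..t, J.runningCost L X τ := by
  obtain ⟨i, hi⟩ := Finite.exists_min fun i => L i 0
  have h := hX.calibration hst (c := L i 0) (p := fun j => deriv (L j) 0)
    (fun τ hτ j _ q => ?_) (fun _ _ _ => hi)
  · simp only [sub_self, mul_zero, Finset.sum_const_zero, add_zero] at h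
    exact ⟨i, by linarith⟩
  · have := (hL j).support 0 q
    rw [sub_zero] at this
    linarith [hi j]

/-- The suboptimality principle for subsolutions along arbitrary trajectories. -/
theorem IsSubsolution.le_add_cost {v : ℝ → Plane → ℝ}
    (hL : ∀ i, IsStronglyConvexLagrangian (L i)) (hv : J.IsSubsolution L T v) (hs : 0 ≤ s)
    (hst : s ≤ t) (ht : t < T) (hy : y ∈ J.carrier) (hx : x ∈ J.carrier)
    (hX : J.IsFinitePath L s y t x X) :
    v t x ≤ v s y + ∫ τ in s..t, J.runningCost L X τ := by
  -- A trajectory may visit the vertex infinitely often, but only the first and last visits matter: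
  -- everything in between is one loop, and the remaining pieces stay inside a branch.
  have leg : ∀ {s t a b : ℝ} {i : Fin N}, 0 ≤ s → s ≤ t → t < T → 0 ≤ a → 0 ≤ b →
      J.IsFinitePath L s (a • J.e i) t (b • J.e i) X → (∀ τ ∈ Ioo s t, 0 < J.coord i (X τ)) →
      v t (b • J.e i) ≤ v s (a • J.e i) + ∫ τ in s..t, J.runningCost L X τ := by
    intro s t a b i hs hst ht ha hb hX hpos
    rcases hst.eq_or_lt with rfl | hst'
    · have : a • J.e i = b • J.e i := hX.mem.2.2.2.1.symm.trans hX.mem.2.2.2.2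
      simp [this]
    · have hq : b = a + (b - a) / (t - s) * (t - s) := by
        rw [div_mul_cancel₀ _ (by linarith)]; ring
      have h1 := hX.le_cost_of_branch hL ha hb hst hq hpos
      have h2 := hv.segment_le hL i hs hst ht ha (hq ▸ hb)
      rw [← hq] at h2
      linarith
  have loop : ∀ {s t : ℝ}, 0 ≤ s → s ≤ t → t < T → J.IsFinitePath L s 0 t 0 X →
      v t 0 ≤ v s 0 + ∫ τ in s..t, J.runningCost L X τ := by
    intro s t hs hst ht hX
    obtain ⟨i, hi⟩ := hX.le_cost_of_loop hL hst
    have := hv.segment_le hL i (q := 0) hs hst ht le_rfl (by simp)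
    simp only [zero_mul, add_zero, zero_smul] at this
    linarith
  have tozero : ∀ {t : ℝ}, s ≤ t → t < T → J.IsFinitePath L s y t 0 X →
      v t 0 ≤ v s y + ∫ τ in s..t, J.runningCost L X τ := by
    intro t hst ht hX
    by_cases hy0 : y = 0
    · subst hy0
      exact loop hs hst ht hX
    · obtain ⟨i, hi⟩ := J.exists_coord_pos hy hy0
      obtain ⟨a, ha, hpos, ha0⟩ := hX.exists_first_zero hst hy J.zero_mem_carrier hi
      have hX1 := hX.mono le_rfl ha.1 ha.2
      have hX2 := hX.mono ha.1 ha.2 le_rfl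
      rw [hX.mem.2.2.2.1, ha0] at hX1
      rw [hX.mem.2.2.2.2, ha0] at hX2
      have hye := J.eq_coord_smul_of_coord_pos hy hi
      have h1 := leg (a := J.coord i y) (b := 0) (i := i) hs ha.1 (ha.2.trans_lt ht) hi.le le_rfl
        (by rw [zero_smul, ← hye]; exact hX1) hpos
      rw [zero_smul, ← hye] at h1
      have h2 := loop (hs.trans ha.1) ha.2 ht hX2
      linarith [hX.integral_add ha.1 ha.2]
  by_cases hx0 : x = 0
  · subst hx0
    exact tozero hst ht hX
  · obtain ⟨i, hi⟩ := J.exists_coord_pos hx hx0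
    obtain ⟨a, ha, hpos, hae, ha0⟩ := hX.exists_last_zero hst hy hx hi
    have hX2 := hX.mono ha.1 ha.2 le_rfl
    have hxe := J.eq_coord_smul_of_coord_pos hx hi
    have h2 := leg (a := J.coord i (X a)) (b := J.coord i x) (i := i) (hs.trans ha.1) ha.2 ht
      (J.coord_nonneg _ _) hi.le (by
        rw [← hae, ← hxe]
        rwa [hX.mem.2.2.2.2] at hX2) hpos
    rw [← hae, ← hxe] at h2
    rcases ha0 with rfl | ha0
    · rwa [hX.mem.2.2.2.1] at h2
    · have hX1 := hX.mono le_rfl ha.1 ha.2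
      rw [hX.mem.2.2.2.1, ha0] at hX1
      rw [ha0] at h2
      have h1 := tozero ha.1 (ha.2.trans_lt ht) hX1
      linarith [hX.integral_add ha.1 ha.2]

/-- A subsolution lying below the initial datum lies below the value function. -/
theorem IsAdmissibleData.le_value {u₀ : Plane → ℝ} (hD : J.IsAdmissibleData L u₀)
    {v : ℝ → Plane → ℝ} (hv : J.IsSubsolution L T v) (hv0 : ∀ x ∈ J.carrier, v 0 x ≤ u₀ x)
    (ht : 0 ≤ t) (htT : t < T) (hx : x ∈ J.carrier) : v t x ≤ J.value L u₀ t x := by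
  refine le_of_forall_pos_le_add fun ε hε => ?_
  obtain ⟨y, hy, X, hX, h⟩ := hD.exists_lt_value_add ht hx hε
  have := hv.le_add_cost hD.lagrangian le_rfl ht htT hy hx hX
  linarith [hv0 y hy]

end Junction

end JunctionHJ

end

/-! ### Mollification, and supersolutions against strictly suboptimal functions. -/

noncomputable section

theorem HasDerivAt.le_of_eventually_le {g : ℝ → ℝ} {a t c : ℝ} (hg : HasDerivAt g a t)
    (h : ∀ᶠ s in 𝓝[>] (0 : ℝ), g (t + s) ≤ g t + s * c) : a ≤ c := by
  refine le_of_tendsto hg.tendsto_slope_zero_right ?_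
  filter_upwards [h, self_mem_nhdsWithin] with s hs hs0
  rw [smul_eq_mul, inv_mul_le_iff₀ hs0]
  linarith

open Convolution in
/-- Mollification of a continuous function: one-sided bounds on difference quotients pass to the
derivative of the mollified function. -/
theorem exists_contDiff_approx {E : Type*} [NormedAddCommGroup E] [NormedSpace ℝ E]
    [FiniteDimensional ℝ E] [MeasureSpace E] [BorelSpace E]
    [(volume : Measure E).IsAddHaarMeasure] {G : E → ℝ}
    (hG : Continuous G) (p₀ : E) {R ω : ℝ} (hR : 0 < R) (hω : 0 < ω) :
    ∃ S : E → ℝ, ContDiff ℝ 1 S ∧ (∀ p ∈ Metric.closedBall p₀ R, |S p - G p| ≤ ω) ∧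
      ∀ p ∈ Metric.closedBall p₀ R, ∀ v C, (∀ᶠ h in 𝓝[>] (0 : ℝ),
        ∀ p' ∈ Metric.closedBall p₀ (2 * R), G (p' + h • v) ≤ G p' + h * C) →
        fderiv ℝ S p v ≤ C := by
  have hu : UniformContinuousOn G (Metric.closedBall p₀ (2 * R)) :=
    (isCompact_closedBall p₀ (2 * R)).uniformContinuousOn_of_continuous hG.continuousOn
  obtain ⟨δ, hδ, hδG⟩ := Metric.uniformContinuousOn_iff_le.1 hu ω hω
  have hρ : 0 < min δ R := lt_min hδ hR
  -- The radius is at most the modulus `δ`, for closeness, and at most `R`, so that averages over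
  -- points of the ball of radius `R` only see the ball of radius `2 * R`.
  let ψ : ContDiffBump (0 : E) := ⟨min δ R / 2, min δ R, by positivity, by linarith⟩
  have hψR : ψ.rOut ≤ R := min_le_right _ _
  have hψδ : ψ.rOut ≤ δ := min_le_left _ _
  let k : E → ℝ := ψ.normed volume
  have hk : Continuous k := ψ.continuous_normed
  have hkc : HasCompactSupport k := ψ.hasCompactSupport_normed
  let S : E → ℝ := k ⋆[ContinuousLinearMap.lsmul ℝ ℝ, volume] G
  have hS : ContDiff ℝ 1 S := by
    exact_mod_cast hkc.contDiff_convolution_left (n := 1) (ContinuousLinearMap.lsmul ℝ ℝ)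
      ψ.contDiff_normed hG.locallyIntegrable
  have hball : ∀ p ∈ Metric.closedBall p₀ R, ∀ z ∈ Metric.ball (0 : E) ψ.rOut,
      p - z ∈ Metric.closedBall p₀ (2 * R) := fun p hp z hz => by
    rw [Metric.mem_closedBall, dist_eq_norm] at hp ⊢
    rw [mem_ball_zero_iff] at hz
    calc ‖p - z - p₀‖ = ‖p - p₀ - z‖ := by congr 1; abel
      _ ≤ 2 * R := (norm_sub_le _ _).trans (by linarith)
  refine ⟨S, hS, fun p hp => ?_, fun p hp v C hC => ?_⟩
  · rw [← Real.dist_eq]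
    refine ψ.dist_normed_convolution_le hG.aestronglyMeasurable fun z hz => ?_
    rw [Metric.mem_ball] at hz
    have hp' := Metric.mem_closedBall.1 hp
    refine hδG z ?_ p ?_ (hz.le.trans hψδ)
    · exact (dist_triangle z p p₀).trans (by linarith)
    · exact Metric.closedBall_subset_closedBall (by linarith) hp
  · have hi : ∀ f : E → ℝ, Continuous f → Integrable (fun z => k z * f z) volume := fun f hf =>
      (hk.mul hf).integrable_of_hasCompactSupport hkc.mul_right
    have hd : HasDerivAt (fun h : ℝ => S (p + h • v)) (fderiv ℝ S p v) 0 := by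
      have h1 : HasFDerivAt S (fderiv ℝ S p) (p + (0 : ℝ) • v) := by
        rw [zero_smul, add_zero]
        exact ((hS.differentiable one_ne_zero) p).hasFDerivAt
      have h2 : HasDerivAt (fun h : ℝ => p + h • v) v 0 := by
        simpa using ((hasDerivAt_id (0 : ℝ)).smul_const v).const_add p
      exact h1.comp_hasDerivAt 0 h2
    refine hd.le_of_eventually_le ?_
    filter_upwards [hC] with h hh
    rw [zero_smul, add_zero, zero_add]
    have e1 : S (p + h • v) = ∫ z, k z * G (p + h • v - z) := rfl
    have e2 : S p + h * C = ∫ z, k z * (G (p - z) + h * C) := by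
      have e3 : S p = ∫ z, k z * G (p - z) := rfl
      have e4 : ∫ z, k z * (h * C) = h * C := by
        rw [integral_mul_const, show ∫ z, k z = 1 from ψ.integral_normed, one_mul]
      simp only [mul_add]
      rw [integral_add (hi _ (by fun_prop)) (hi _ continuous_const), e4, e3]
    rw [e1, e2]
    refine integral_mono (hi _ (by fun_prop)) (hi _ (by fun_prop)) fun z => ?_
    by_cases hz : z ∈ Metric.ball (0 : E) ψ.rOut
    · refine mul_le_mul_of_nonneg_left ?_ (ψ.nonneg_normed z)
      have := hh (p - z) (hball p hp z hz)
      rwa [show p - z + h • v = p + h • v - z by abel] at this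
    · have : k z = 0 := by
        by_contra hne
        exact hz (ψ.support_normed_eq (μ := volume) ▸ Function.mem_support.2 hne)
      simp [this]

namespace JunctionHJ

namespace Junction

variable {N : ℕ} {J : Junction N} {L : Fin N → ℝ → ℝ} {T : ℝ}

/-- Functions that satisfy the suboptimality principle with a strict inequality. -/
def IsStrictlySuboptimal (J : Junction N) (L : Fin N → ℝ → ℝ) (κ : ℝ) (V : ℝ → Plane → ℝ) : Prop :=
  ∀ i s h r q, 0 ≤ s → 0 ≤ h → 0 ≤ r → 0 ≤ r + q * h →
    V (s + h) ((r + q * h) • J.e i) ≤ V s (r • J.e i) + h * (L i q - κ * (1 + |q|))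

/-- No regularity of `V` in space is needed: suboptimality along segments entering the vertex bounds
`V` below near the vertex by a `C¹` function built from its trace, with equality on the vertex. This
function, shifted by a constant, touches `w` from below and violates the junction condition. -/
theorem IsSupersolution.not_isLocalMax_zero [Nonempty (Fin N)] {w V : ℝ → Plane → ℝ} {κ : ℝ}
    (hL : ∀ i, IsStronglyConvexLagrangian (L i)) (hw : J.IsSupersolution L T w) (hκ : 0 < κ)
    (hV : J.IsStrictlySuboptimal L κ V) (hV0 : ContDiff ℝ 1 fun s => V s 0) {t ρ : ℝ}
    (ht : t ∈ Ioo 0 T) (hρ : 0 < ρ)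
    (hmax : ∀ s y, (s, y) ∈ Metric.ball (t, 0) ρ ∩ J.cylinder T →
      V s y - w s y ≤ V t 0 - w t 0) : False := by
  set g₀ : ℝ → ℝ := fun s => V s 0 with hg₀
  set lam := deriv g₀ t with hlam
  have hd : HasDerivAt g₀ lam t := ((hV0.differentiable one_ne_zero) t).hasDerivAt
  have hlamle : ∀ i, lam ≤ L i 0 - κ := fun i => by
    refine hd.le_of_eventually_le ?_
    filter_upwards [self_mem_nhdsWithin] with h hh
    have := hV i t h 0 0 ht.1.le (le_of_lt hh) le_rfl (by simp)
    simpa [g₀] using this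
  -- The tangent to `L i` at `q i` has intercept `lam + κ / 2`, so the Hamiltonian at the slope
  -- `deriv (L i) (q i)` is `-lam - κ / 2`, strictly below `-lam`.
  choose q hq hqe using fun i => (hL i).exists_neg_sub_mul_deriv_eq (c := lam + κ / 2)
    (by linarith [hlamle i])
  set m := V t 0 - w t 0 with hm
  let g : ℝ → ℝ := fun s => g₀ s - m
  -- From coordinate `r` at time `s`, the vertex is reached with velocity `q i < 0` at time `s - r /
  -- q i`.
  let f : Fin N → ℝ × ℝ → ℝ := fun i p =>
    g₀ (p.1 - p.2 / q i) + p.2 / q i * (L i (q i) - κ) - m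
  have hf0 : ∀ i s, f i (s, 0) = g s := fun i s => by simp [f, g]
  have hf : ∀ i, ContDiff ℝ 1 (f i) := fun i => by
    have : ContDiff ℝ 1 fun p : ℝ × ℝ => g₀ (p.1 - p.2 / q i) :=
      hV0.comp (by fun_prop)
    exact (this.add (by fun_prop)).sub contDiff_const
  have hg : Continuous g := by
    have := hV0.continuous
    fun_prop
  have htouch := hw.touch _ (J.isC1Star_glue hf0 hg hf T) t 0 ⟨ht, J.zero_mem_carrier⟩
    ⟨ρ, hρ, fun s y hy => ?_⟩ (by rw [glue_zero hf0]; simp [g, g₀, m])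
  · have h0 := htouch.2 rfl
    have e1 := timeDeriv_glue (J := J) hf0 (Classical.arbitrary _) (t := t) le_rfl (a := lam)
      (by simpa only [hf0] using hd.sub_const m)
    have e2 : ∀ i, J.spaceDeriv (J.glue g f) i t 0 = lam * (-(1 / q i)) +
        1 / q i * (L i (q i) - κ) := fun i => by
      refine spaceDeriv_glue hf0 i le_rfl ?_
      have h1 : HasDerivAt (fun r : ℝ => t - r / q i) (-(1 / q i)) 0 :=
        ((hasDerivAt_id (0 : ℝ)).div_const (q i)).const_sub t
      have h2 : HasDerivAt (fun r : ℝ => g₀ (t - r / q i)) (lam * (-(1 / q i))) 0 :=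
        HasDerivAt.comp (0 : ℝ) (h₂ := g₀) (h₂' := lam) (by simpa using hd) h1
      exact (h2.add (((hasDerivAt_id (0 : ℝ)).div_const (q i)).mul_const _)).sub_const m
    rw [zero_smul] at e1
    have hS : ⨆ i, hamiltonianMinus (L i) (J.spaceDeriv (J.glue g f) i t 0) ≤ -lam - κ / 2 := by
      refine ciSup_le fun i => hamiltonianMinus_le fun q' hq' => ?_
      have hb : lam * (-(1 / q i)) + 1 / q i * (L i (q i) - κ) =
          deriv (L i) (q i) - κ / (2 * q i) := by
        have := (hq i).ne
        have h3 : L i (q i) = lam + κ / 2 + q i * deriv (L i) (q i) := by linarith [hqe i]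
        rw [h3]
        field_simp
        ring
      rw [e2, hb]
      -- The extra slope `-κ / (2 * q i)` is positive, hence harmless for the velocities `q' ≤ 0`
      -- that enter `hamiltonianMinus`.
      have h4 : 0 ≤ κ / (2 * q i) * q' := by
        rw [div_mul_eq_mul_div]
        exact div_nonneg_of_nonpos (by nlinarith) (by linarith [hq i])
      linarith [(hL i).support (q i) q', hqe i]
    linarith
  · obtain ⟨i, z, hz, rfl⟩ := J.mem_carrier.1 hy.2.2
    rw [glue_smul hf0 i s hz]
    have hzq : 0 ≤ -(z / q i) := by
      rw [← div_neg]; exact div_nonneg hz (by linarith [hq i])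
    have hr : z + q i * -(z / q i) = 0 := by
      have := (hq i).ne
      field_simp
      ring
    have h1 := hV i s (-(z / q i)) z (q i) hy.2.1.1.le hzq hz hr.ge
    rw [hr, zero_smul] at h1
    have h2 := hmax s _ hy
    have h3 : 0 ≤ -(z / q i) * (κ * |q i|) := by positivity
    simp only [f, g₀, sub_eq_add_neg s]
    linarith

/-- Strict suboptimality is a bound on difference quotients, hence survives mollification and makes
the mollified function a strict classical subsolution. A small concave quadratic then produces an
interior touching point. -/
theorem IsSupersolution.not_isLocalMax_branch {w V : ℝ → Plane → ℝ} {κ : ℝ}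
    (hw : J.IsSupersolution L T w) (hκ : 0 < κ)
    (hV : J.IsStrictlySuboptimal L κ V) (i : Fin N)
    (hVc : ContinuousOn (Function.uncurry V) (univ ×ˢ J.carrier)) {t r ρ : ℝ}
    (ht : t ∈ Ioo 0 T) (hr : 0 < r) (hρ : 0 < ρ)
    (hmax : ∀ s y, (s, y) ∈ Metric.ball (t, r • J.e i) ρ ∩ J.cylinder T →
      V s y - w s y ≤ V t (r • J.e i) - w t (r • J.e i)) : False := by
  set m := V t (r • J.e i) - w t (r • J.e i) with hm
  let G : ℝ × ℝ → ℝ := fun p => V p.1 (max p.2 0 • J.e i)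
  have hG : Continuous G := by
    have : Continuous fun p : ℝ × ℝ => (p.1, max p.2 0 • J.e i) := by fun_prop
    exact hVc.comp_continuous this fun p => ⟨mem_univ _, J.smul_mem_carrier i (le_max_right _ _)⟩
  obtain ⟨R, hR, hRρ, hRt, hRT, hRr⟩ : ∃ R : ℝ, 0 < R ∧ R < ρ ∧ 3 * R < t ∧ R < T - t ∧
      3 * R < r := by
    have h0 : 0 < min (min ρ (T - t)) (min t r) :=
      lt_min (lt_min hρ (by linarith [ht.2])) (lt_min ht.1 hr)
    refine ⟨min (min ρ (T - t)) (min t r) / 4, by positivity, ?_, ?_, ?_, ?_⟩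
    · linarith [(min_le_left (min ρ (T - t)) (min t r)).trans (min_le_left _ _)]
    · linarith [(min_le_right (min ρ (T - t)) (min t r)).trans (min_le_left _ _)]
    · linarith [(min_le_left (min ρ (T - t)) (min t r)).trans (min_le_right _ _)]
    · linarith [(min_le_right (min ρ (T - t)) (min t r)).trans (min_le_right _ _)]
  have hmemball : ∀ (p : ℝ × ℝ) (a : ℝ), p ∈ Metric.closedBall (t, r) a ↔
      |p.1 - t| ≤ a ∧ |p.2 - r| ≤ a := fun p a => by
    rw [Metric.mem_closedBall, Prod.dist_eq, max_le_iff, Real.dist_eq, Real.dist_eq]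
  -- The quadratic changes each partial derivative by at most `2 * c * R = κ / 2`, half of the
  -- strictness. Its drop `c * R ^ 2` at distance `R` exceeds twice the mollification error `c * R ^
  -- 2 / 4`, so the minimum is interior.
  set c := κ / (4 * R) with hc
  have hc0 : 0 < c := by positivity
  have hcR : 2 * c * R = κ / 2 := by rw [hc]; field_simp; ring
  obtain ⟨S, hS, hSG, hSd⟩ := exists_contDiff_approx hG (t, r) hR
    (by positivity : 0 < c * R ^ 2 / 4)
  have hslope : ∀ p ∈ Metric.closedBall (t, r) R, ∀ q,
      fderiv ℝ S p (1, q) ≤ L i q - κ * (1 + |q|) := fun p hp q => by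
    refine hSd p hp (1, q) _ ?_
    have h1 : ∀ᶠ h in 𝓝[>] (0 : ℝ), h * |q| < R := by
      have : Continuous fun h : ℝ => h * |q| := by fun_prop
      have := this.tendsto 0
      rw [zero_mul] at this
      exact (this.mono_left nhdsWithin_le_nhds).eventually (gt_mem_nhds hR)
    filter_upwards [h1, self_mem_nhdsWithin] with h hh h0 p' hp'
    obtain ⟨ha, hb⟩ := (hmemball _ _).1 hp'
    have h2 : |q * h| < R := by rwa [abs_mul, abs_of_pos (show 0 < h from h0), mul_comm]
    have h3 := abs_lt.1 h2
    have ha' := abs_le.1 ha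
    have hb' := abs_le.1 hb
    have h4 := hV i p'.1 h p'.2 q (by linarith) (le_of_lt h0) (by linarith) (by linarith)
    simp only [G, Prod.fst_add, Prod.snd_add, Prod.smul_fst, Prod.smul_snd, smul_eq_mul, mul_one]
    rw [mul_comm h q, max_eq_left (by linarith), max_eq_left (by linarith)]
    exact h4
  let F : ℝ × ℝ → ℝ := fun p => S p - c * ((p.1 - t) ^ 2 + (p.2 - r) ^ 2)
  have hF : ContDiff ℝ 1 F := hS.sub (by fun_prop)
  have hmaps : MapsTo (fun p : ℝ × ℝ => (p.1, p.2 • J.e i)) (Metric.closedBall (t, r) R)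
      (J.cylinder₀ T) := fun p hp => by
    obtain ⟨ha, hb⟩ := (hmemball _ _).1 hp
    have ha' := abs_le.1 ha
    have hb' := abs_le.1 hb
    exact ⟨⟨by linarith, by linarith⟩, J.smul_mem_carrier i (by linarith)⟩
  have hlsc : LowerSemicontinuousOn (fun p : ℝ × ℝ => w p.1 (p.2 • J.e i) + - F p)
      (Metric.closedBall (t, r) R) := by
    refine LowerSemicontinuousOn.add ?_ hF.continuous.neg.continuousOn.lowerSemicontinuousOn
    exact hw.lsc.comp (g := fun p : ℝ × ℝ => (p.1, p.2 • J.e i)) (by fun_prop) hmaps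
  have hc₀ : (t, r) ∈ Metric.closedBall (t, r) R := Metric.mem_closedBall_self hR.le
  obtain ⟨⟨s, z⟩, hp, hmin⟩ := hlsc.exists_isMinOn ⟨_, hc₀⟩ (isCompact_closedBall _ _)
  have hmin' : ∀ p ∈ Metric.closedBall (t, r) R,
      w s (z • J.e i) + - F (s, z) ≤ w p.1 (p.2 • J.e i) + - F p := fun p hp => hmin hp
  obtain ⟨hs, hz⟩ := (hmemball _ _).1 hp
  simp only at hs hz
  have hs' := abs_le.1 hs
  have hz' := abs_le.1 hz
  have hz0 : 0 < z := by linarith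
  have hbd : c * ((s - t) ^ 2 + (z - r) ^ 2) < c * R ^ 2 := by
    have h1 := hmin' _ hc₀
    have h2 := (abs_le.1 (hSG _ hc₀)).1
    have h3 := (abs_le.1 (hSG _ hp)).2
    have h4 := hmax s (z • J.e i) ⟨?_, ⟨by linarith, by linarith⟩, J.smul_mem_carrier i hz0.le⟩
    · simp only [F, G, sub_self, max_eq_left hr.le, max_eq_left hz0.le] at h1 h2 h3
      have : 0 < c * R ^ 2 := by positivity
      linarith
    · rw [Metric.mem_ball, Prod.dist_eq, Real.dist_eq, dist_eq_norm, ← sub_smul, norm_smul,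
        J.norm_e, mul_one, Real.norm_eq_abs]
      exact max_lt (by linarith) (by linarith)
  have hbd' := lt_of_mul_lt_mul_left hbd hc0.le
  have hsR : |s - t| < R := abs_lt_of_sq_lt_sq (by nlinarith [sq_nonneg (z - r)]) hR.le
  have hzR : |z - r| < R := abs_lt_of_sq_lt_sq (by nlinarith [sq_nonneg (s - t)]) hR.le
  set μ := w s (z • J.e i) - F (s, z) with hμ
  let g : ℝ → ℝ := fun σ => F (σ, 0) + μ
  -- The other branches carry any admissible extension; touching takes place away from the vertex.
  let f : Fin N → ℝ × ℝ → ℝ := fun j p => if j = i then F p + μ else F (p.1, 0) + μ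
  have hf0 : ∀ j σ, f j (σ, 0) = g σ := fun j σ => by simp [f, g]
  have hfi : ∀ p, f i p = F p + μ := fun p => if_pos rfl
  have hf : ∀ j, ContDiff ℝ 1 (f j) := fun j => by
    simp only [f]
    split_ifs
    · exact hF.add contDiff_const
    · exact (hF.comp (by fun_prop : ContDiff ℝ 1 fun p : ℝ × ℝ => (p.1, (0 : ℝ)))).add
        contDiff_const
  have hg : Continuous g := (hF.continuous.comp (by fun_prop)).add continuous_const
  have hst : s ∈ Ioo 0 T := ⟨by linarith, by linarith⟩
  obtain ⟨ρ', hρ', hball⟩ : ∃ ρ' > 0, ∀ p : ℝ × Plane, p ∈ Metric.ball (s, z • J.e i) ρ' →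
      (p.1, J.coord i p.2) ∈ Metric.ball (t, r) R := by
    have hcont : Continuous fun p : ℝ × Plane => (p.1, J.coord i p.2) := by
      have := J.continuous_coord i
      fun_prop
    have : (fun p : ℝ × Plane => (p.1, J.coord i p.2)) ⁻¹' Metric.ball (t, r) R ∈
        𝓝 (s, z • J.e i) := by
      refine (Metric.isOpen_ball.preimage hcont).mem_nhds ?_
      rw [mem_preimage, J.coord_smul_self i hz0.le, Metric.mem_ball, Prod.dist_eq, Real.dist_eq,
        Real.dist_eq]
      exact max_lt hsR hzR
    exact Metric.mem_nhds_iff.1 this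
  have htouch := (hw.touch _ (J.isC1Star_glue hf0 hg hf T) s (z • J.e i)
    ⟨hst, J.smul_mem_carrier i hz0.le⟩ ⟨ρ', hρ', fun σ y hy => ?_⟩
    (by rw [glue_smul hf0 i s hz0.le, hfi]; simp [μ])).1 i z hz0 rfl
  · have hSd := ((hS.differentiable one_ne_zero) (s, z)).hasFDerivAt
    set D := fderiv ℝ S (s, z)
    have e1 : timeDeriv (J.glue g f) s (z • J.e i) = D (1, 0) - c * (2 * (s - t)) := by
      refine timeDeriv_glue hf0 i hz0.le ?_
      simp only [hfi]
      refine HasDerivAt.add_const μ ?_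
      have h1 : HasDerivAt (fun σ => S (σ, z)) (D (1, 0)) s :=
        hSd.comp_hasDerivAt s ((hasDerivAt_id s).prodMk (hasDerivAt_const s z))
      have h2 := ((((hasDerivAt_id s).sub_const t).pow 2).add_const ((z - r) ^ 2)).const_mul c
      convert! h1.sub h2 using 1
      simp
    have e2 : J.spaceDeriv (J.glue g f) i s z = D (0, 1) - c * (2 * (z - r)) := by
      refine spaceDeriv_glue hf0 i hz0.le ?_
      simp only [hfi]
      refine HasDerivAt.add_const μ ?_
      have h1 : HasDerivAt (fun ζ => S (s, ζ)) (D (0, 1)) z :=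
        hSd.comp_hasDerivAt z ((hasDerivAt_const z s).prodMk (hasDerivAt_id z))
      have h2 := ((((hasDerivAt_id z).sub_const r).pow 2).const_add ((s - t) ^ 2)).const_mul c
      convert! h1.sub h2 using 1
      simp
    rw [e1, e2] at htouch
    have hH : hamiltonian (L i) (D (0, 1) - c * (2 * (z - r))) ≤
        -(D (1, 0) - c * (2 * (s - t))) - κ / 2 := hamiltonian_le fun q => by
      have h1 := hslope _ hp q
      have h2 : D (1, q) = D (1, 0) + q * D (0, 1) := by
        have : ((1 : ℝ), q) = (1, 0) + q • (0, 1) := by simp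
        rw [this, map_add, map_smul, smul_eq_mul]
      change D (1, q) ≤ _ at h1
      rw [h2] at h1
      have h3 : -(2 * c * (s - t)) ≤ κ / 2 := by
        rw [← hcR, ← mul_neg]
        exact mul_le_mul_of_nonneg_left (by linarith [hs'.1]) (by positivity)
      have h4 : -(2 * c * (z - r) * q) ≤ κ / 2 * |q| := by
        refine (neg_le_abs _).trans ?_
        rw [abs_mul, abs_mul, abs_of_pos (by positivity : 0 < 2 * c), ← hcR]
        gcongr
      have h5 : 0 ≤ κ * |q| := by positivity
      linarith
    linarith
  · have hb := hball _ hy.1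
    have hbc := Metric.ball_subset_closedBall hb
    obtain ⟨h1, h2⟩ := (hmemball _ _).1 hbc
    have h2' := abs_le.1 h2
    simp only at h2'
    have hpos : 0 < J.coord i y := by linarith
    have hye : y = J.coord i y • J.e i := J.eq_coord_smul_of_coord_pos hy.2.2 hpos
    have h3 := hmin' _ hbc
    simp only [← hye] at h3
    have h4 := glue_smul (J := J) hf0 i σ hpos.le
    rw [← hye, hfi] at h4
    rw [h4]
    linarith

end Junction

end JunctionHJ

end

/-! ### Supersolutions lie above the value function; uniqueness. -/

noncomputable section

namespace JunctionHJ

namespace Junction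

variable {N : ℕ}

/-- Forward averages in time of the value function, extended by its initial value to negative
times. -/
def averagedValue (J : Junction N) (L : Fin N → ℝ → ℝ) (u₀ : Plane → ℝ) (σ s : ℝ) (x : Plane) : ℝ :=
  ∫ τ in (0 : ℝ)..1, J.value L u₀ (max (s + σ * τ) 0) x

namespace IsAdmissibleData

variable {J : Junction N} {L : Fin N → ℝ → ℝ} {u₀ : Plane → ℝ} (hD : J.IsAdmissibleData L u₀)
include hD

theorem continuous_value_max {x : Plane} (hx : x ∈ J.carrier) :
    Continuous fun s => J.value L u₀ (max s 0) x :=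
  hD.continuousOn_value.comp_continuous (f := fun s : ℝ => (max s 0, x)) (by fun_prop)
    fun _ => ⟨mem_Ici.2 (le_max_right _ _), hx⟩

theorem intervalIntegrable_value (σ s : ℝ) {x : Plane} (hx : x ∈ J.carrier) :
    IntervalIntegrable (fun τ => J.value L u₀ (max (s + σ * τ) 0) x) volume 0 1 :=
  ((hD.continuous_value_max hx).comp (f := fun τ : ℝ => s + σ * τ) (by fun_prop)).intervalIntegrable
    _ _

/-- The average is a difference quotient of a primitive of a continuous function. Differentiability
in time at the vertex is the reason for averaging. -/
theorem contDiff_averagedValue {σ : ℝ} (hσ : 0 < σ) {x : Plane} (hx : x ∈ J.carrier) :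
    ContDiff ℝ 1 fun s => J.averagedValue L u₀ σ s x := by
  have hc := hD.continuous_value_max hx
  let P : ℝ → ℝ := fun s => ∫ τ in (0 : ℝ)..s, J.value L u₀ (max τ 0) x
  have hP : ContDiff ℝ 1 P := by
    refine contDiff_one_iff_deriv.2 ⟨fun s => ?_, ?_⟩
    · exact (hc.integral_hasStrictDerivAt 0 s).hasDerivAt.differentiableAt
    · rw [show deriv P = fun s => J.value L u₀ (max s 0) x from
        funext fun s => hc.deriv_integral _ 0 s]
      exact hc
  have e : (fun s => J.averagedValue L u₀ σ s x) = fun s => σ⁻¹ * (P (s + σ) - P s) := by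
    ext s
    rw [averagedValue,
      intervalIntegral.integral_comp_add_mul (fun τ => J.value L u₀ (max τ 0) x) hσ.ne' s,
      mul_zero, mul_one, add_zero, smul_eq_mul,
      intervalIntegral.integral_interval_sub_left (hc.intervalIntegrable _ _)
        (hc.intervalIntegrable _ _)]
  rw [e]
  exact contDiff_const.mul ((hP.comp (contDiff_id.add contDiff_const)).sub hP)

/-- The suboptimality principle is invariant under forward shifts of time and linear in the
function, so it passes to averages. -/
theorem averagedValue_segment_le {σ : ℝ} (hσ : 0 ≤ σ) (i : Fin N) {s h r q : ℝ} (hs : 0 ≤ s)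
    (hh : 0 ≤ h) (hr : 0 ≤ r) (hr' : 0 ≤ r + q * h) :
    J.averagedValue L u₀ σ (s + h) ((r + q * h) • J.e i) ≤
      J.averagedValue L u₀ σ s (r • J.e i) + h * L i q := by
  have h1 := hD.intervalIntegrable_value σ s (J.smul_mem_carrier i hr)
  have h2 := hD.intervalIntegrable_value σ (s + h) (J.smul_mem_carrier i hr')
  have e : J.averagedValue L u₀ σ s (r • J.e i) + h * L i q =
      ∫ τ in (0 : ℝ)..1, (J.value L u₀ (max (s + σ * τ) 0) (r • J.e i) + h * L i q) := by
    rw [intervalIntegral.integral_add h1 (by simp)]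
    simp [averagedValue]
  rw [e]
  refine intervalIntegral.integral_mono_on zero_le_one h2 (h1.add (by simp)) fun τ hτ => ?_
  have h3 : 0 ≤ σ * τ := mul_nonneg hσ hτ.1
  rw [max_eq_left (by linarith), max_eq_left (by linarith), add_right_comm]
  exact hD.value_segment_le i (by linarith) hh hr hr'

theorem abs_averagedValue_sub_le {C : ℝ} (hC : ∀ s t, 0 ≤ s → 0 ≤ t → ∀ x ∈ J.carrier,
    ∀ y ∈ J.carrier, |J.value L u₀ s x - J.value L u₀ t y| ≤ C * (|s - t| + ‖x - y‖))
    (hC0 : 0 ≤ C) (σ s t : ℝ) {x y : Plane} (hx : x ∈ J.carrier) (hy : y ∈ J.carrier) :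
    |J.averagedValue L u₀ σ s x - J.averagedValue L u₀ σ t y| ≤ C * (|s - t| + ‖x - y‖) := by
  rw [averagedValue, averagedValue, ← intervalIntegral.integral_sub
    (hD.intervalIntegrable_value σ s hx) (hD.intervalIntegrable_value σ t hy), ← Real.norm_eq_abs]
  refine (intervalIntegral.norm_integral_le_of_norm_le_const
    (C := C * (|s - t| + ‖x - y‖)) fun τ _ => ?_).trans (by simp)
  refine (hC _ _ (le_max_right _ _) (le_max_right _ _) x hx y hy).trans ?_
  have := abs_max_sub_max_le_abs (s + σ * τ) (t + σ * τ) 0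
  rw [add_sub_add_right_eq_sub] at this
  gcongr

theorem abs_averagedValue_sub_value_le {C : ℝ} (hC : ∀ s t, 0 ≤ s → 0 ≤ t → ∀ x ∈ J.carrier,
    ∀ y ∈ J.carrier, |J.value L u₀ s x - J.value L u₀ t y| ≤ C * (|s - t| + ‖x - y‖))
    (hC0 : 0 ≤ C) {σ s : ℝ} (hσ : 0 ≤ σ) (hs : 0 ≤ s) {x : Plane} (hx : x ∈ J.carrier) :
    |J.averagedValue L u₀ σ s x - J.value L u₀ s x| ≤ C * σ := by
  have e : J.averagedValue L u₀ σ s x - J.value L u₀ s x =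
      ∫ τ in (0 : ℝ)..1, (J.value L u₀ (max (s + σ * τ) 0) x - J.value L u₀ s x) := by
    rw [intervalIntegral.integral_sub (hD.intervalIntegrable_value σ s hx) (by simp)]
    simp [averagedValue]
  rw [e, ← Real.norm_eq_abs]
  refine (intervalIntegral.norm_integral_le_of_norm_le_const (C := C * σ) fun τ hτ => ?_).trans
    (by simp)
  rw [uIoc_of_le zero_le_one] at hτ
  have h3 : 0 ≤ σ * τ := mul_nonneg hσ hτ.1.le
  refine (hC _ _ (le_max_right _ _) hs x hx x hx).trans ?_
  rw [max_eq_left (by linarith), add_sub_cancel_left, abs_of_nonneg h3, sub_self, norm_zero,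
    add_zero]
  exact mul_le_mul_of_nonneg_left (mul_le_of_le_one_right hσ hτ.2) hC0

/-- A supersolution lying above the initial datum, and at bounded distance above it, lies above the
value function. -/
theorem value_le_supersolution {T : ℝ} {w : ℝ → Plane → ℝ} (hw : J.IsSupersolution L T w)
    (hw0 : ∀ x ∈ J.carrier, u₀ x ≤ w 0 x) {Cw : ℝ}
    (hCw : ∀ t x, (t, x) ∈ J.cylinder T → u₀ x - Cw ≤ w t x) {t : ℝ} {x : Plane} (ht : 0 ≤ t)
    (htT : t < T) (hx : x ∈ J.carrier) : J.value L u₀ t x ≤ w t x := by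
  have := hD.nonempty
  by_contra! hcon
  have ht0 : 0 < t := lt_of_le_of_ne ht fun h => by
    rw [← h, hD.value_zero hx] at hcon
    exact (hw0 x hx).not_gt hcon
  obtain ⟨θ, hθ, hθw⟩ : ∃ θ > 0, w t x + 4 * θ = J.value L u₀ t x :=
    ⟨(J.value L u₀ t x - w t x) / 4, by linarith, by ring⟩
  obtain ⟨C, hC0, hC⟩ := hD.exists_abs_value_le
  -- Of the rate `C + 2`, a part `C + 1` pays for the slope of `ψ` and the rest provides the strict
  -- margin in `|q|`.
  obtain ⟨A, hA0, hA⟩ := exists_superlinear hD.lagrangian (C + 2)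
  obtain ⟨σ, hσ, hCσ⟩ : ∃ σ > 0, C * σ ≤ θ / 2 := by
    refine ⟨θ / (2 * (C + 1)), by positivity, ?_⟩
    rw [mul_div_assoc', div_le_div_iff₀ (by positivity) two_pos]
    nlinarith
  set a := J.averagedValue L u₀ σ
  -- This function is strictly suboptimal and decays in space faster than the value function can.
  -- Mixing in a fraction `κ` of it gives both strictness and confinement.
  let ψ : ℝ → Plane → ℝ := fun s y => -(C + 1) * ‖y‖ - (A + 1) * s
  have ha : ∀ s, 0 ≤ s → ∀ y ∈ J.carrier, |a s y - J.value L u₀ s y| ≤ θ / 2 := fun s hs y hy =>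
    (hD.abs_averagedValue_sub_value_le hC hC0 hσ.le hs hy).trans hCσ
  have hu₀ : ∀ s ∈ Icc 0 T, ∀ y ∈ J.carrier, |J.value L u₀ s y - u₀ y| ≤ C * T :=
    fun s hs y hy => by
      rw [← hD.value_zero hy]
      refine (hC s 0 hs.1 le_rfl y hy y hy).trans ?_
      rw [sub_zero, sub_self, norm_zero, add_zero, abs_of_nonneg hs.1]
      exact mul_le_mul_of_nonneg_left hs.2 hC0
  have hT : 0 < T := ht0.trans htT
  set P := |u₀ 0| + C * T + θ / 2 with hP
  have hP0 : 0 < P := by positivity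
  have hψ : ∀ s ∈ Icc 0 T, ∀ y ∈ J.carrier, ψ s y - a s y ≤ P - ‖y‖ := fun s hs y hy => by
    have h1 := (abs_le.1 (ha s hs.1 y hy)).1
    have h2 := (abs_le.1 (hu₀ s hs y hy)).1
    have h3 := (abs_le.1 (hC 0 0 le_rfl le_rfl y hy 0 J.zero_mem_carrier)).1
    rw [hD.value_zero hy, hD.value_zero J.zero_mem_carrier, sub_self, abs_zero, zero_add,
      sub_zero] at h3
    have h4 : 0 ≤ (A + 1) * s := mul_nonneg (by linarith) hs.1
    have := neg_abs_le (u₀ 0)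
    simp only [ψ]
    linarith
  -- The mixing raises the average by at most `θ / 2` anywhere and lowers it by at most `θ / 2` at
  -- `(t, x)`.
  obtain ⟨κ, hκ, hκ1, hκP, hκx⟩ : ∃ κ > 0, κ ≤ 1 ∧ κ * P ≤ θ / 2 ∧
      κ * |ψ t x - a t x| ≤ θ / 2 := by
    have hpos : 0 < P + |ψ t x - a t x| + θ := by positivity
    refine ⟨θ / (2 * (P + |ψ t x - a t x| + θ)), by positivity, ?_, ?_, ?_⟩
    · rw [div_le_one (by positivity)]
      linarith [abs_nonneg (ψ t x - a t x)]
    · rw [div_mul_eq_mul_div, div_le_div_iff₀ (by positivity) two_pos]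
      nlinarith [abs_nonneg (ψ t x - a t x)]
    · rw [div_mul_eq_mul_div, div_le_div_iff₀ (by positivity) two_pos]
      nlinarith [abs_nonneg (ψ t x - a t x)]
  set Q := C * T + θ + |Cw| with hQ
  have hQ0 : 0 < Q := by positivity
  obtain ⟨t₂, htt₂, ht₂T⟩ : ∃ t₂, t < t₂ ∧ t₂ < T := exists_between htT
  -- The exponential penalty is `θ` at time `t` and at least `Q` at `t₂`, which keeps the maximum of
  -- `V - w` away from the final time.
  obtain ⟨B, hB0, hB⟩ : ∃ B : ℝ, 0 ≤ B ∧ Q ≤ θ * Real.exp (B * (t₂ - t)) := by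
    have ht : 0 < t₂ - t := by linarith
    refine ⟨Q / (θ * (t₂ - t)), by positivity, ?_⟩
    have h1 := Real.add_one_le_exp (Q / (θ * (t₂ - t)) * (t₂ - t))
    have h3 : Q / (θ * (t₂ - t)) * (t₂ - t) = Q / θ := by field_simp
    rw [h3] at h1 ⊢
    have h4 := mul_le_mul_of_nonneg_left h1 hθ.le
    have h5 : θ * (Q / θ + 1) = Q + θ := by field_simp
    linarith
  set R := Q / κ + ‖x‖ + 1 with hR
  have hκR : Q ≤ κ * R := by
    have h1 : κ * (Q / κ) = Q := by field_simp
    have h2 : 0 ≤ κ * (‖x‖ + 1) := by positivity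
    rw [hR]
    linarith
  have hxR : ‖x‖ ≤ R := by
    have : 0 ≤ Q / κ := by positivity
    linarith
  let V : ℝ → Plane → ℝ := fun s y =>
    (1 - κ) * a s y + κ * ψ s y - θ * Real.exp (B * (s - t))
  have hVeq : ∀ s y, V s y = a s y + κ * (ψ s y - a s y) - θ * Real.exp (B * (s - t)) :=
    fun s y => by simp only [V]; ring
  have hexp : ∀ s, 0 < θ * Real.exp (B * (s - t)) := fun s => by positivity
  have hVs : J.IsStrictlySuboptimal L κ V := fun i s h r q hs hh hr hr' => by
    have h1 := hD.averagedValue_segment_le hσ.le i hs hh hr hr'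
    have h2 : ψ (s + h) ((r + q * h) • J.e i) ≤ ψ s (r • J.e i) + h * (L i q - (1 + |q|)) := by
      have h4 := mul_le_mul_of_nonneg_left (hA i q) hh
      have h5 : -((C + 1) * (q * h)) ≤ (C + 1) * (|q| * h) := by
        rw [← mul_neg, ← neg_mul]
        have := neg_le_abs q
        gcongr
      simp only [ψ, J.norm_smul_e i hr, J.norm_smul_e i hr']
      linarith
    have h3 : θ * Real.exp (B * (s - t)) ≤ θ * Real.exp (B * (s + h - t)) := by
      gcongr
      linarith
    have h4 := mul_le_mul_of_nonneg_left h1 (sub_nonneg.2 hκ1)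
    have h5 := mul_le_mul_of_nonneg_left h2 hκ.le
    simp only [V]
    linarith
  have hac : ContinuousOn (Function.uncurry a) (univ ×ˢ J.carrier) := by
    refine LipschitzOnWith.continuousOn (K := (2 * C).toNNReal) ?_
    refine LipschitzOnWith.of_dist_le_mul fun p hp q hq => ?_
    rw [Real.coe_toNNReal _ (by positivity), Real.dist_eq]
    refine (hD.abs_averagedValue_sub_le hC hC0 σ p.1 q.1 hp.2 hq.2).trans ?_
    rw [Prod.dist_eq, ← Real.dist_eq, ← dist_eq_norm]
    have h1 := le_max_left (dist p.1 q.1) (dist p.2 q.2)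
    have h2 := le_max_right (dist p.1 q.1) (dist p.2 q.2)
    nlinarith
  have hVc : ContinuousOn (Function.uncurry V) (univ ×ˢ J.carrier) := by
    have h1 : Continuous fun p : ℝ × Plane => κ * ψ p.1 p.2 := by
      simp only [ψ]; fun_prop
    have h2 : Continuous fun p : ℝ × Plane => θ * Real.exp (B * (p.1 - t)) := by fun_prop
    exact ((continuousOn_const.mul hac).add h1.continuousOn).sub h2.continuousOn
  have hV0 : ContDiff ℝ 1 fun s => V s 0 := by
    have h1 := hD.contDiff_averagedValue hσ J.zero_mem_carrier
    have h2 : ContDiff ℝ 1 fun s => κ * ψ s 0 := by simp only [ψ]; fun_prop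
    have h3 : ContDiff ℝ 1 fun s => θ * Real.exp (B * (s - t)) := by fun_prop
    exact ((contDiff_const.mul h1).add h2).sub h3
  have hsub := J.box_subset_cylinder₀ (T := T) le_rfl ht₂T R
  have hlsc : LowerSemicontinuousOn (fun p : ℝ × Plane => w p.1 p.2 + - V p.1 p.2)
      (Icc 0 t₂ ×ˢ (J.carrier ∩ Metric.closedBall 0 R)) :=
    (hw.lsc.mono hsub).add
      (hVc.mono (prod_mono (subset_univ _) inter_subset_left)).neg.lowerSemicontinuousOn
  have htx : (t, x) ∈ Icc 0 t₂ ×ˢ (J.carrier ∩ Metric.closedBall 0 R) :=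
    ⟨⟨ht, htt₂.le⟩, hx, by simpa using hxR⟩
  obtain ⟨⟨s, y⟩, ⟨hs, hy, hyR⟩, hmin⟩ := hlsc.exists_isMinOn ⟨_, htx⟩
    (isCompact_Icc.prod (J.isCompact_carrier_inter_closedBall R))
  have hyR' : ‖y‖ ≤ R := by simpa using hyR
  have hlow : 2 * θ ≤ V s y - w s y := by
    have h1 : w s y + - V s y ≤ w t x + - V t x := hmin htx
    have h2 := (abs_le.1 (ha t ht x hx)).1
    have h3 : -(κ * |ψ t x - a t x|) ≤ κ * (ψ t x - a t x) := by
      rw [← mul_neg]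
      exact mul_le_mul_of_nonneg_left (neg_abs_le _) hκ.le
    have h4 := hVeq t x
    rw [sub_self, mul_zero, Real.exp_zero, mul_one] at h4
    linarith
  have hsT : s ∈ Icc 0 T := ⟨hs.1, hs.2.trans ht₂T.le⟩
  have hup1 := mul_le_mul_of_nonneg_left (hψ s hsT y hy) hκ.le
  have hup2 := (abs_le.1 (ha s hs.1 y hy)).2
  have hκy : 0 ≤ κ * ‖y‖ := by positivity
  -- At time `0`, averaging and mixing contribute at most `θ / 2` each, so `V - w < 2 * θ` there.
  have hs0 : 0 < s := lt_of_le_of_ne hs.1 fun h => by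
    subst h
    rw [hD.value_zero hy] at hup2
    linarith [hw0 y hy, hVeq 0 y, hexp 0]
  have hup3 : V s y - w s y ≤ Q - κ * ‖y‖ - θ * Real.exp (B * (s - t)) := by
    have h1 := hCw s y ⟨⟨hs0, hs.2.trans_lt ht₂T⟩, hy⟩
    have h2 := (abs_le.1 (hu₀ s hsT y hy)).2
    linarith [hVeq s y, le_abs_self Cw]
  have hst₂ : s < t₂ := lt_of_le_of_ne hs.2 fun h => by
    subst h
    linarith
  have hyR₁ : ‖y‖ < R := lt_of_le_of_ne hyR' fun h => by
    rw [h] at hup3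
    linarith [hexp s]
  obtain ⟨ρ, hρ, hball⟩ := J.exists_ball_inter_subset (T := T) ⟨hs0, hst₂⟩ hyR₁
  have hmax : ∀ s' y', (s', y') ∈ Metric.ball (s, y) ρ ∩ J.cylinder T →
      V s' y' - w s' y' ≤ V s y - w s y := fun s' y' h => by
    have : w s y + - V s y ≤ w s' y' + - V s' y' := hmin (hball h)
    linarith
  have hs' : s ∈ Ioo 0 T := ⟨hs0, hst₂.trans ht₂T⟩
  obtain ⟨i, r, hr, rfl⟩ := J.mem_carrier.1 hy
  rcases hr.eq_or_lt with rfl | hr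
  · rw [zero_smul] at hmax
    exact hw.not_isLocalMax_zero hD.lagrangian hκ hVs hV0 hs' hρ hmax
  · exact hw.not_isLocalMax_branch hκ hVs i hVc hs' hr hρ hmax

theorem isViscositySolution_value (T : ℝ) : J.IsViscositySolution L u₀ T (J.value L u₀) := by
  have htend : ∀ t x, (t, x) ∈ J.cylinder₀ T →
      Tendsto (fun q : ℝ × Plane => ((J.value L u₀ q.1 q.2 : ℝ) : EReal)) (𝓝[J.cylinder₀ T] (t, x))
        (𝓝 ((J.value L u₀ t x : ℝ) : EReal)) := fun t x htx =>
    (continuous_coe_real_ereal.tendsto _).comp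
      ((hD.continuousOn_value.mono (prod_mono Ico_subset_Ici_self le_rfl)) (t, x) htx)
  refine ⟨J.value L u₀, J.value L u₀, fun t x htx => ?_, hD.isSubsolution_value T,
    fun x hx => (hD.value_zero hx).le, hD.isSupersolution_value T,
    fun x hx => (hD.value_zero hx).ge⟩
  have : (𝓝[J.cylinder₀ T] (t, x)).NeBot :=
    mem_closure_iff_nhdsWithin_neBot.1 (subset_closure htx)
  exact ⟨(htend t x htx).limsup_eq.symm, (htend t x htx).liminf_eq.symm⟩

theorem staysClose_value {T : ℝ} (hT : 0 < T) : J.StaysClose u₀ T (J.value L u₀) := by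
  obtain ⟨C, hC0, hC⟩ := hD.exists_abs_time_le
  refine ⟨C * T + 1, by positivity, fun t x htx => ?_⟩
  obtain ⟨ht, hx⟩ : t ∈ Ioo 0 T ∧ x ∈ J.carrier := htx
  have h1 := hC t 0 ht.1.le le_rfl x hx
  rw [hD.value_zero hx, sub_zero, abs_of_pos ht.1] at h1
  have := mul_le_mul_of_nonneg_left ht.2.le hC0
  linarith

/-- The chain is `w ≤ u ≤ v ≤ value ≤ w`; the lower growth bound passes from `u` to its lower
envelope because `u₀` is continuous. -/
theorem eq_value_of_isViscositySolution {T : ℝ} {u : ℝ → Plane → ℝ}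
    (hu : J.IsViscositySolution L u₀ T u) (hc : J.StaysClose u₀ T u) {t : ℝ} {x : Plane}
    (htx : (t, x) ∈ J.cylinder₀ T) : u t x = J.value L u₀ t x := by
  obtain ⟨v, w, henv, hv, hv0, hw, hw0⟩ := hu
  obtain ⟨C, -, hC⟩ := hc
  have hCw : ∀ t x, (t, x) ∈ J.cylinder T → u₀ x - C ≤ w t x := fun t x htx => by
    have htx₀ : (t, x) ∈ J.cylinder₀ T := ⟨Ioo_subset_Ico_self htx.1, htx.2⟩
    have : (𝓝[J.cylinder₀ T] (t, x)).NeBot :=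
      mem_closure_iff_nhdsWithin_neBot.1 (subset_closure htx₀)
    rw [← EReal.coe_le_coe_iff, (henv t x htx₀).2, lowerEnvelope]
    have hcont : ContinuousOn (fun p : ℝ × Plane => u₀ p.2 - C) (J.cylinder₀ T) := by
      obtain ⟨K, hK⟩ := hD.lipschitz
      exact (hK.continuousOn.comp continuousOn_snd fun p hp => hp.2).sub continuousOn_const
    have hlim : Tendsto (fun p : ℝ × Plane => ((u₀ p.2 - C : ℝ) : EReal))
        (𝓝[J.cylinder₀ T] (t, x)) (𝓝 ((u₀ x - C : ℝ) : EReal)) :=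
      (continuous_coe_real_ereal.tendsto _).comp (hcont (t, x) htx₀)
    rw [← hlim.liminf_eq]
    refine liminf_le_liminf ?_
    -- The growth bound is assumed for positive times only, so nearby points are restricted to
    -- these.
    have hpos : ∀ᶠ p : ℝ × Plane in 𝓝[J.cylinder₀ T] (t, x), 0 < p.1 :=
      (continuous_fst.tendsto (t, x)).mono_left nhdsWithin_le_nhds |>.eventually
        (lt_mem_nhds htx.1.1)
    filter_upwards [hpos, self_mem_nhdsWithin] with p hp hpc
    rw [EReal.coe_le_coe_iff]
    linarith [(abs_le.1 (hC p.1 p.2 ⟨⟨hp, hpc.1.2⟩, hpc.2⟩)).1]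
  have hfreq : ∀ P : ℝ × Plane → Prop, P (t, x) → ∃ᶠ p in 𝓝[J.cylinder₀ T] (t, x), P p :=
    fun P hP hn => hn.self_of_nhdsWithin htx hP
  have huv : u t x ≤ v t x := by
    rw [← EReal.coe_le_coe_iff, (henv t x htx).1]
    exact le_limsup_of_frequently_le (hfreq _ le_rfl)
  have hwu : w t x ≤ u t x := by
    rw [← EReal.coe_le_coe_iff, (henv t x htx).2]
    exact liminf_le_of_frequently_le (hfreq _ le_rfl)
  have := hD.nonempty
  have h1 := hD.le_value hv hv0 htx.1.1 htx.1.2 htx.2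
  have h2 := hD.value_le_supersolution hw hw0 hCw htx.1.1 htx.1.2 htx.2
  linarith

end IsAdmissibleData

/-- Adding a finite constant is invertible on the extended reals, so it commutes with infima,
including empty ones. -/
theorem coe_add_biInf {ι : Type*} (S : Set ι) (f : ι → EReal) (a : ℝ) :
    (a : EReal) + ⨅ i ∈ S, f i = ⨅ i ∈ S, ((a : EReal) + f i) := by
  refine le_antisymm (le_iInf₂ fun i hi => add_le_add_right (iInf₂_le i hi) _) ?_
  have h : (⨅ i ∈ S, ((a : EReal) + f i)) - a ≤ ⨅ i ∈ S, f i := le_iInf₂ fun i hi => by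
    rw [EReal.sub_le_iff_le_add (.inl (EReal.coe_ne_bot a)) (.inl (EReal.coe_ne_top a)), add_comm]
    exact iInf₂_le i hi
  rwa [EReal.sub_le_iff_le_add (.inl (EReal.coe_ne_bot a)) (.inl (EReal.coe_ne_top a)),
    add_comm] at h

end Junction

end JunctionHJ

end

/-! ### The representation theorem. -/

theorem theorem1p3 {N : ℕ} (hN : 1 ≤ N) (J : JunctionHJ.Junction N)
    (L : Fin N → ℝ → ℝ) (hL : ∀ i, ContDiff ℝ 2 (L i))
    (γ : ℝ) (hγ : 0 < γ) (hLγ : ∀ i q, γ ≤ deriv (deriv (L i)) q)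
    (u₀ : JunctionHJ.Plane → ℝ) (hu₀ : ∃ K : NNReal, LipschitzOnWith K u₀ J.carrier)
    (T : ℝ) (hT : 0 < T) :
    (∃ u : ℝ → JunctionHJ.Plane → ℝ,
      ContinuousOn (Function.uncurry u) (J.cylinder₀ T) ∧
      J.IsViscositySolution L u₀ T u ∧ J.StaysClose u₀ T u ∧
      ∀ t x, (t, x) ∈ J.cylinder₀ T → ((u t x : ℝ) : EReal) = J.valueFunction L u₀ t x) ∧
    (∀ u : ℝ → JunctionHJ.Plane → ℝ,
      J.IsViscositySolution L u₀ T u → J.StaysClose u₀ T u →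
      ∀ t x, (t, x) ∈ J.cylinder₀ T → ((u t x : ℝ) : EReal) = J.valueFunction L u₀ t x) ∧
    (∀ t, 0 ≤ t → ∀ x ∈ J.carrier,
      J.valueFunction L u₀ t x =
        ⨅ y ∈ J.carrier, (((u₀ y : ℝ) : EReal) + J.minimalAction L 0 y t x)) := by
  have hD : J.IsAdmissibleData L u₀ := ⟨fun i => ⟨hL i, γ, hγ, hLγ i⟩, hu₀, ⟨⟨0, hN⟩⟩⟩
  refine ⟨⟨J.value L u₀, hD.continuousOn_value.mono (Set.prod_mono Set.Ico_subset_Ici_self le_rfl),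
    hD.isViscositySolution_value T, hD.staysClose_value hT,
    fun t x htx => hD.coe_value htx.1.1 htx.2⟩, fun u hu hc t x htx => ?_, fun t _ x _ => ?_⟩
  · rw [hD.eq_value_of_isViscositySolution hu hc htx, hD.coe_value htx.1.1 htx.2]
  · simp only [JunctionHJ.Junction.valueFunction, JunctionHJ.Junction.minimalAction,
      JunctionHJ.Junction.coe_add_biInf]
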